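/- **Conventions.** Vector spaces are over $\mathbb C$. For a vector space $W$ let $\mathcal E(W)=\mathrm{Hom}(W,W((x)))$, let $1_W\in\mathcal E(W)$ be the identity operator, and for $\alpha\in\mathbb C^\times$ let $R_\alpha a(x)=a(\alpha x)$. An ordered pair $(a(x),b(x))$ in $\mathcal E(W)$ is *quasi compatible* if $p(x_1,x_2)a(x_1)b(x_2)\in \mathrm{Hom}(W,W((x_1,x_2)))$ for some polynomial $p\neq 0$; then the products $a(x)_nb(x)\in\mathcal E(W)$, $n\in\mathbb Z$, are defined by $$Y_{\mathcal E}(a(x),x_0)b(x)=\sum_{n\in\mathbb Z}a(x)_nb(x)\,x_0^{-n-1}=\iota_{x,x_0}\big(p(x_0+x,x)^{-1}\big)\,\big(p(x_1,x)a(x_1)b(x)\big)\big|_{x_1=x+x_0},$$ which does not depend on the choice of such a $p$. Here $\iota_{x,x_0}$ denotes expansion in $\mathbb C((x))((x_0))$, and $x_1=x+x_0$ is expanded in nonnegative powers of $x_0$. A subspace $U\subset\mathcal E(W)$ is *closed* if every ordered pair in $U$ is quasi compatible and $a(x)_nb(x)\in U$ for all $a(x),b(x)\in U$, $n\in\mathbb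 Z$. For a subgroup $\Gamma\subset\mathbb C^\times$ let $\mathbb C_\Gamma[x]$ be the multiplicative monoid generated by the polynomials $x-\alpha$, $\alpha\in\Gamma$, and let $\mathbb C_\Gamma(x,y)=\mathbb C[[x,y]][x^{-1},y^{-1},(x-\alpha y)^{-1}\mid\alpha\in\Gamma]$. A subset $U\subset\mathcal E(W)$ is *pseudo $\Gamma$-local* if for all $a(x),b(x)\in U$ there are $0\ne p\in\mathbb C_\Gamma[x]$ and finitely many $\psi_i\in\mathbb C_\Gamma(x,y)$, $u_i(x),v_i(x)\in U$ with $$p(x_1/x_2)\,a(x_1)b(x_2)=\sum_i p(x_1/x_2)\,\iota_{x_2,x_1}(\psi_i(x_1,x_2))\,u_i(x_2)v_i(x_1),$$ where $\iota_{x_2,x_1}$ denotes expansion in $\mathbb C((x_2))((x_1))$. A *nonlocal vertex algebra* is a vector space $V$ with a linear map $Y(\cdot,x):V\to\mathrm{Hom}(V,V((x)))$ and a vector $\mathbf 1\in V$ such that for all $v\in V$ one has $Y(\mathbf 1,x)v=v$, $Y(v,x)\mathbf 1\in V[[x]]$ and $Y(v,x)\mathbf 1|_{x=0}=v$, and such that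 for all $u,v,w\in V$ there is $l\ge 0$ with $(x_0+x_2)^lY(u,x_0+x_2)Y(v,x_2)w=(x_0+x_2)^lY(Y(u,x_0)v,x_2)w$. A *quasi module* for $V$ is a vector space $W$ with a linear map $Y_W:V\to\mathcal E(W)$ such that $Y_W(\mathbf 1,x)=1_W$ and such that for all $u,v\in V$, $w\in W$ there is a polynomial $f\ne0$ with $f(x_0+x_2,x_2)Y_W(u,x_0+x_2)Y_W(v,x_2)w=f(x_0+x_2,x_2)Y_W(Y(u,x_0)v,x_2)w$. It is *pseudo $\Gamma$-local* if $\{Y_W(v,x)\mid v\in V\}$ is pseudo $\Gamma$-local, and *faithful* if $Y_W$ is injective. **The quantum affine algebra.** Let $A=(A_{ij})$ be a Cartan matrix of type $A_l$ ($l\ge1$), $D_l$ ($l\ge4$) or $E_l$ ($l=6,7,8$), with associated simple Lie algebra $\mathfrak g$. Let $q$ be a nonzero complex number with $q^2\neq1$. Fix a value of $\log q$ and set $q^c=e^{c\log q}$ for $c\in\mathbb C$. Let $g_{ij}(x)^{\pm1}\in\mathbb C[[x]]$ be the Taylor series at $0$ of $\big((q^{A_{ij}}x-1)/(x-q^{A_{ij}})\big)^{\pm1}$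 and put $\delta(z)=\sum_{n\in\mathbb Z}z^n$. Then $U_q(\hat{\mathfrak g})$ is the unital associative algebra with generators $X^\pm_{ik}$ $(k\in\mathbb Z)$, $\phi_{im}$ $(m\le0)$, $\psi_{in}$ $(n\ge0)$, $1\le i\le l$, and $\gamma^{\pm1/2}$, with $\gamma^{\pm1/2}$ central, and with the following relations for $X_i^\pm(z)=\sum_k X_{ik}^\pm z^{-k}$, $\phi_i(z)=\sum_{m\le0}\phi_{im}z^{-m}$, $\psi_i(z)=\sum_{n\ge0}\psi_{in}z^{-n}$: $$\gamma^{1/2}\gamma^{-1/2}=\gamma^{-1/2}\gamma^{1/2}=1,\quad \phi_{i0}\psi_{i0}=\psi_{i0}\phi_{i0}=1,\quad [\phi_i(z),\phi_j(w)]=[\psi_i(z),\psi_j(w)]=0,$$ $$\phi_i(z)\psi_j(w)\phi_i(z)^{-1}\psi_j(w)^{-1}=g_{ij}(zw^{-1}\gamma^{-1})/g_{ij}(zw^{-1}\gamma),$$ $$\phi_i(z)X_j^\pm(w)\phi_i(z)^{-1}=g_{ij}(zw^{-1}\gamma^{\mp1/2})^{\pm1}X_j^\pm(w),\quad \psi_i(z)X_j^\pm(w)\psi_i(z)^{-1}=g_{ij}(z^{-1}w\gamma^{\mp1/2})^{\mp1}X_j^\pm(w),$$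 $$(z-q^{\pm A_{ij}}w)X_i^\pm(z)X_j^\pm(w)=(q^{\pm A_{ij}}z-w)X_j^\pm(w)X_i^\pm(z),$$ $$[X_i^+(z),X_j^-(w)]=\frac{\delta_{ij}}{q-q^{-1}}\big(\delta(zw^{-1}\gamma^{-1})\psi_i(w\gamma^{1/2})-\delta(zw^{-1}\gamma)\phi_i(z\gamma^{1/2})\big),$$ and the Serre relations: $[X_i^\pm(z),X_j^\pm(w)]=0$ if $A_{ij}=0$; and if $A_{ij}=-1$, the sum over both orders of $z_1,z_2$ of $X_i^\pm(z_1)X_i^\pm(z_2)X_j^\pm(w)-(q+q^{-1})X_i^\pm(z_1)X_j^\pm(w)X_i^\pm(z_2)+X_j^\pm(w)X_i^\pm(z_1)X_i^\pm(z_2)$ is $0$. A $U_q(\hat{\mathfrak g})$-module $W$ is *restricted* if $X_i^\pm(x),\phi_i(x),\psi_i(x)$, acting on $W$, are elements of $\mathcal E(W)$ for all $i$, and it is of *level* $\ell\in\mathbb C$ if $\gamma^{\pm1/2}$ act on $W$ as the scalars $q^{\pm\ell/4}$. Set $\Gamma(q,\ell)=\{q^{m+n\ell/4}\mid m,n\in\mathbb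 Z\}\subset\mathbb C^\times$. **Proposition.** Let $W$ be a restricted $U_q(\hat{\mathfrak g})$-module of level $\ell\in\mathbb C$ and set $$S_W=\{1_W,\phi_i(x),\psi_i(x),X_i^\pm(x)\mid i=1,\dots,l\}\subset\mathcal E(W).$$ Then $S_W$ is a pseudo $\Gamma(q,\ell)$-local subset of $\mathcal E(W)$, and there exists a unique smallest closed pseudo $\Gamma(q,\ell)$-local subspace $V_W$ of $\mathcal E(W)$ that contains $S_W\cup\{1_W\}$ and is stable under $R_\alpha$ for all $\alpha\in\Gamma(q,\ell)$. Furthermore, $(V_W,Y_{\mathcal E},1_W)$ is a nonlocal vertex algebra, and $W$, with $Y_W(a(x),x_0)=a(x_0)$ for $a(x)\in V_W$, is a faithful pseudo $\Gamma(q,\ell)$-local quasi module for $V_W$. -/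

import Mathlib

noncomputable section

namespace NVA

/-! ### Formal series and the space `E(W) = Hom(W, W((x)))`

A formal series in two variables with coefficients in `W`, an element of
`W[[x₁^{±1}, x₂^{±1}]]`, is a function `F : ℤ → ℤ → W`, where `F m n` is the coefficient of
`x₁ ^ m * x₂ ^ n`. Every infinite sum (`∑ᶠ`) below has only finitely many nonzero terms for the
series to which it is applied. -/

/-- `E(W) = Hom(W, W((x)))`: the coefficient of `x ^ m` in `a(x) w` is `(a w).coeff m`. -/
abbrev E (W : Type*) [AddCommGroup W] [Module ℂ W] : Type _ := W →ₗ[ℂ] LaurentSeries W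

section Fields

variable {W : Type*} [AddCommGroup W] [Module ℂ W]

/-- The identity operator `1_W`, as an element of `E(W)`. -/
def oneE (W : Type*) [AddCommGroup W] [Module ℂ W] : E W :=
  HahnSeries.single.linearMap (R := ℂ) (V := W) (0 : ℤ)

/-- `R_α a(x) = a(α x)`. -/
def scale (α : ℂˣ) (a : E W) : E W where
  toFun w := HahnSeries.mk (fun m : ℤ => ((α ^ m : ℂˣ) : ℂ) • (a w).coeff m)
    ((a w).isPWO_support.mono fun m hm => by
      simp only [Function.mem_support] at hm
      simp only [HahnSeries.mem_support]
      intro h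
      exact hm (by rw [h, smul_zero]))
  map_add' v w := by
    ext m
    simp only [map_add, HahnSeries.coeff_add, smul_add]
  map_smul' c w := by
    ext m
    simp only [map_smul, HahnSeries.coeff_smul, RingHom.id_apply]
    exact smul_comm _ _ _

/-- The formal series `a(x₁) b(x₂) w`. -/
def prodSeries (a b : E W) (w : W) : ℤ → ℤ → W :=
  fun m n => (a ((b w).coeff n)).coeff m

/-- The product of a polynomial in two variables with a formal series in these variables. -/
def polyMul (p : MvPolynomial (Fin 2) ℂ) (F : ℤ → ℤ → W) : ℤ → ℤ → W :=
  fun m n => ∑ d ∈ p.support, p.coeff d • F (m - (d 0 : ℤ)) (n - (d 1 : ℤ))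

/-- The product `p(x₁ / x₂) F(x₁, x₂)`, for a polynomial `p` in one variable. -/
def ratioMul (p : Polynomial ℂ) (F : ℤ → ℤ → W) : ℤ → ℤ → W :=
  fun m n => ∑ k ∈ p.support, p.coeff k • F (m - (k : ℤ)) (n + (k : ℤ))

/-- `C((y))((x))`: the inner variable is `y`, the outer variable is `x`. -/
abbrev Laurent2 : Type := LaurentSeries (LaurentSeries ℂ)

/-- The coefficient of `x ^ i * y ^ j` of an element of `C((y))((x))`. -/
def Laurent2.coef (f : Laurent2) (i j : ℤ) : ℂ := (f.coeff i).coeff j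

/-- The product of `f ∈ C((y))((x))` with `F ∈ W((y))((x))`, where `F m n` is the coefficient of
`x ^ m * y ^ n`. -/
def laurentMul (f : Laurent2) (F : ℤ → ℤ → W) : ℤ → ℤ → W :=
  fun m n => ∑ᶠ ij : ℤ × ℤ, f.coef ij.1 ij.2 • F (m - ij.1) (n - ij.2)

/-- The substitution `x₁ = x₀ + x₂`, expanded in nonnegative powers of `x₂`, in a series
`F(x₁, x₂)` of `W((x₁))((x₂))`. The value at `i s` is the coefficient of `x₀ ^ i * x₂ ^ s`. -/
def substOuter (F : ℤ → ℤ → W) : ℤ → ℤ → W :=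
  fun i s => ∑ᶠ j : ℕ, Ring.choose (i + (j : ℤ)) j • F (i + (j : ℤ)) (s - (j : ℤ))

/-- The substitution `x₁ = x + x₀`, expanded in nonnegative powers of `x₀`, in a series
`F(x₁, x)` of `W((x₁, x))`. The value at `i s` is the coefficient of `x₀ ^ i * x ^ s`. -/
def substInner (F : ℤ → ℤ → W) : ℤ → ℤ → W :=
  fun i s => if 0 ≤ i then ∑ᶠ m : ℤ, Ring.choose m i.toNat • F m (s + i - m) else 0

/-! ### Quasi compatible pairs and the products `a(x)_n b(x)` -/

/-- `p(x₁, x₂) a(x₁) b(x₂) ∈ Hom(W, W((x₁, x₂)))`. -/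
def Clears (p : MvPolynomial (Fin 2) ℂ) (a b : E W) : Prop :=
  ∀ w : W, ∃ N : ℤ, ∀ m n : ℤ, (m < N ∨ n < N) → polyMul p (prodSeries a b w) m n = 0

/-- The ordered pair `(a(x), b(x))` is quasi compatible. -/
def QuasiCompatible (a b : E W) : Prop :=
  ∃ p : MvPolynomial (Fin 2) ℂ, p ≠ 0 ∧ Clears p a b

/-- `p(x₀ + x, x)` as an element of the field `C((x))((x₀))`. -/
def shiftLaurent (p : MvPolynomial (Fin 2) ℂ) : Laurent2 :=
  MvPolynomial.eval₂
    ((HahnSeries.C : LaurentSeries ℂ →+* Laurent2).comp (HahnSeries.C : ℂ →+* LaurentSeries ℂ))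
    ![HahnSeries.single (1 : ℤ) (1 : LaurentSeries ℂ) +
        HahnSeries.C (HahnSeries.single (1 : ℤ) (1 : ℂ)),
      HahnSeries.C (HahnSeries.single (1 : ℤ) (1 : ℂ))] p

/-- The series
`Y_E(a(x), x₀) b(x) w = ι_{x,x₀}(p(x₀ + x, x)⁻¹) (p(x₁, x) a(x₁) b(x) w)|_{x₁ = x + x₀}`
computed with the polynomial `p`. The value at `i s` is the coefficient of `x₀ ^ i * x ^ s`. -/
def YEwith (p : MvPolynomial (Fin 2) ℂ) (a b : E W) (w : W) : ℤ → ℤ → W :=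
  laurentMul (shiftLaurent p)⁻¹ (substInner (polyMul p (prodSeries a b w)))

/-- `c(x) = a(x)_n b(x)`: the pair `(a(x), b(x))` is quasi compatible and `c(x)` is the coefficient
of `x₀ ^ (-n-1)` in `Y_E(a(x), x₀) b(x)`, computed with any polynomial `p ≠ 0` such that
`p(x₁, x₂) a(x₁) b(x₂) ∈ Hom(W, W((x₁, x₂)))`. There is at most one such `c(x)`. -/
def IsNthProduct (a b : E W) (n : ℤ) (c : E W) : Prop :=
  QuasiCompatible a b ∧
    ∀ p : MvPolynomial (Fin 2) ℂ, p ≠ 0 → Clears p a b →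
      ∀ (w : W) (s : ℤ), (c w).coeff s = YEwith p a b w (-n - 1) s

/-- A subspace `U` of `E(W)` is closed if every ordered pair in `U` is quasi compatible and
`a(x)_n b(x) ∈ U` for `a(x), b(x) ∈ U`, `n ∈ ℤ`. -/
def IsClosedSubspace (U : Submodule ℂ (E W)) : Prop :=
  ∀ a ∈ U, ∀ b ∈ U, QuasiCompatible a b ∧ ∀ n : ℤ, ∃ c ∈ U, IsNthProduct a b n c

end Fields

/-! ### Pseudo `Γ`-locality -/

/-- The ring `C[[x, y]]`, realized as `C[[y]][[x]]`. -/
abbrev PowerSeries2 : Type := PowerSeries (PowerSeries ℂ)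

/-- The variable `x` of `C[[x, y]]`. -/
def varX : PowerSeries2 := PowerSeries.X

/-- The variable `y` of `C[[x, y]]`. -/
def varY : PowerSeries2 := PowerSeries.C (PowerSeries.X : PowerSeries ℂ)

/-- The multiplicative set generated by `x`, `y` and `x - α y` for `α ∈ Γ`. -/
def denominators (Γ : Subgroup ℂˣ) : Submonoid PowerSeries2 :=
  Submonoid.closure ({varX, varY} ∪ {d | ∃ α ∈ Γ, d = varX - ((α : ℂˣ) : ℂ) • varY})

/-- `C_Γ(x, y) = C[[x, y]][x⁻¹, y⁻¹, (x - α y)⁻¹ | α ∈ Γ]`. -/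
abbrev RatΓ (Γ : Subgroup ℂˣ) : Type := Localization (denominators Γ)

/-- The embedding of `C[[x, y]]` into `C((y))((x))`. -/
def embedPS : PowerSeries2 →+* Laurent2 :=
  (HahnSeries.ofPowerSeries ℤ (LaurentSeries ℂ)).comp
    (PowerSeries.map (HahnSeries.ofPowerSeries ℤ ℂ))

theorem embedPS_injective : Function.Injective embedPS := by
  intro f g h
  have h1 : PowerSeries.map (HahnSeries.ofPowerSeries ℤ ℂ) f =
      PowerSeries.map (HahnSeries.ofPowerSeries ℤ ℂ) g :=
    HahnSeries.ofPowerSeries_injective (Γ := ℤ) (R := LaurentSeries ℂ) h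
  ext n : 1
  have h2 := congrArg (PowerSeries.coeff n) h1
  rw [PowerSeries.coeff_map, PowerSeries.coeff_map] at h2
  exact HahnSeries.ofPowerSeries_injective (Γ := ℤ) (R := ℂ) h2

theorem denominators_ne_zero (Γ : Subgroup ℂˣ) (d : denominators Γ) :
    (d : PowerSeries2) ≠ 0 := by
  have hle : denominators Γ ≤ nonZeroDivisors PowerSeries2 := by
    refine Submonoid.closure_le.2 ?_
    have hY : varY ≠ 0 := by
      intro h
      have h2 := congrArg (fun f => PowerSeries.coeff 1 (PowerSeries.coeff 0 f)) h
      simp [varY] at h2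
    rintro d ((rfl | rfl) | ⟨α, -, rfl⟩)
    · exact mem_nonZeroDivisors_of_ne_zero PowerSeries.X_ne_zero
    · exact mem_nonZeroDivisors_of_ne_zero hY
    · refine mem_nonZeroDivisors_of_ne_zero fun h => ?_
      have h2 := congrArg (fun f => PowerSeries.coeff 0 (PowerSeries.coeff 1 f)) h
      simp [varX, varY] at h2
  exact nonZeroDivisors.ne_zero (hle d.2)

/-- `ι_{y,x} : C_Γ(x, y) → C((y))((x))`, the unique ring homomorphism that extends the embedding
of `C[[x, y]]`. -/
def iota (Γ : Subgroup ℂˣ) : RatΓ Γ →+* Laurent2 :=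
  IsLocalization.lift (M := denominators Γ) (S := RatΓ Γ) (P := Laurent2) (g := embedPS) fun d =>
    isUnit_iff_ne_zero.2 fun h =>
      denominators_ne_zero Γ d (embedPS_injective (h.trans (map_zero embedPS).symm))

/-- `C_Γ[x]`: the multiplicative monoid generated by the polynomials `x - α`, `α ∈ Γ`. -/
def polyΓ (Γ : Subgroup ℂˣ) : Submonoid (Polynomial ℂ) :=
  Submonoid.closure {f | ∃ α ∈ Γ, f = Polynomial.X - Polynomial.C ((α : ℂˣ) : ℂ)}

/-- A subset `U` of `E(W)` is pseudo `Γ`-local if for all `a(x), b(x) ∈ U` there are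
`0 ≠ p(x) ∈ C_Γ[x]`, and `ψ_i(x, y) ∈ C_Γ(x, y)`, `u_i(x), v_i(x) ∈ U` for `i = 1, …, r`, with
`p(x₁/x₂) a(x₁) b(x₂) = ∑_i p(x₁/x₂) ι_{x₂,x₁}(ψ_i(x₁, x₂)) u_i(x₂) v_i(x₁)`.
The coefficient of `x₁ ^ m * x₂ ^ n` in `u(x₂) v(x₁) w` is `prodSeries u v w n m`. -/
def PseudoLocal {W : Type*} [AddCommGroup W] [Module ℂ W] (Γ : Subgroup ℂˣ)
    (U : Set (E W)) : Prop :=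
  ∀ a ∈ U, ∀ b ∈ U, ∃ p ∈ polyΓ Γ, p ≠ 0 ∧
    ∃ (r : ℕ) (ψ : Fin r → RatΓ Γ) (u v : Fin r → E W),
      (∀ i, u i ∈ U ∧ v i ∈ U) ∧
      ∀ w : W, ratioMul p (prodSeries a b w) =
        ∑ i, ratioMul p (laurentMul (iota Γ (ψ i)) fun m n => prodSeries (u i) (v i) w n m)

/-! ### Nonlocal vertex algebras and quasi modules -/

/-- The polynomial `f(x₀ + x₂, x₂)` in the variables `x₀, x₂`. -/
def shiftPoly (f : MvPolynomial (Fin 2) ℂ) : MvPolynomial (Fin 2) ℂ :=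
  MvPolynomial.aeval ![MvPolynomial.X 0 + MvPolynomial.X 1, MvPolynomial.X 1] f

/-- A nonlocal vertex algebra structure on the vector space `V`. The component `v_n` is given by
`v_n w = (Y v w).coeff (-n-1)`. -/
structure NonlocalVertexAlgebra (V : Type*) [AddCommGroup V] [Module ℂ V] where
  /-- The vertex operator map `Y(·, x) : V → Hom(V, V((x)))`. -/
  Y : V →ₗ[ℂ] E V
  /-- The vacuum vector. -/
  one : V
  /-- `Y(1, x) v = v`. -/
  vacuum : ∀ v : V, Y one v = oneE V v
  /-- `Y(v, x) 1 ∈ V[[x]]`, with constant term `v`. -/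
  creation : ∀ v : V, (∀ n : ℤ, n < 0 → (Y v one).coeff n = 0) ∧ (Y v one).coeff 0 = v
  /-- `(x₀ + x₂)^l Y(u, x₀ + x₂) Y(v, x₂) w = (x₀ + x₂)^l Y(Y(u, x₀) v, x₂) w`. -/
  weak_assoc : ∀ u v w : V, ∃ l : ℕ,
    polyMul ((MvPolynomial.X 0 + MvPolynomial.X 1) ^ l) (substOuter (prodSeries (Y u) (Y v) w)) =
      polyMul ((MvPolynomial.X 0 + MvPolynomial.X 1) ^ l)
        (fun i s => (Y ((Y u v).coeff i) w).coeff s)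

/-- `(W, Y_W)` is a quasi module for the nonlocal vertex algebra `V`. -/
structure NonlocalVertexAlgebra.IsQuasiModule {V W : Type*} [AddCommGroup V] [Module ℂ V]
    [AddCommGroup W] [Module ℂ W] (A : NonlocalVertexAlgebra V) (YW : V →ₗ[ℂ] E W) : Prop where
  /-- `Y_W(1, x) = 1_W`. -/
  vacuum : YW A.one = oneE W
  /-- `f(x₀+x₂, x₂) Y_W(u, x₀+x₂) Y_W(v, x₂) w = f(x₀+x₂, x₂) Y_W(Y(u, x₀) v, x₂) w`
  for some nonzero polynomial `f`. -/
  quasi_assoc : ∀ (u v : V) (w : W), ∃ f : MvPolynomial (Fin 2) ℂ, f ≠ 0 ∧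
    polyMul (shiftPoly f) (substOuter (prodSeries (YW u) (YW v) w)) =
      polyMul (shiftPoly f) (fun i s => (YW ((A.Y u v).coeff i) w).coeff s)

/-- A pseudo `Γ`-local quasi module: a quasi module `W` such that `{Y_W(v, x) | v ∈ V}` is a
pseudo `Γ`-local subspace of `E(W)`. -/
structure NonlocalVertexAlgebra.IsPseudoLocalQuasiModule {V W : Type*} [AddCommGroup V]
    [Module ℂ V] [AddCommGroup W] [Module ℂ W] (A : NonlocalVertexAlgebra V) (Γ : Subgroup ℂˣ)
    (YW : V →ₗ[ℂ] E W) : Prop extends A.IsQuasiModule YW where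
  pseudoLocal : PseudoLocal Γ (Set.range YW)

/-! ### The quantum affine algebra `U_q(ĝ)` in the Drinfeld realization -/

/-- `A` is the Cartan matrix of type `A_l` (`l ≥ 1`), `D_l` (`l ≥ 4`) or `E_6, E_7, E_8`. -/
inductive IsADE : (l : ℕ) → Matrix (Fin l) (Fin l) ℤ → Prop
  | typeA (l : ℕ) (hl : 1 ≤ l) : IsADE l (CartanMatrix.A l)
  | typeD (l : ℕ) (hl : 4 ≤ l) : IsADE l (CartanMatrix.D l)
  | typeE6 : IsADE 6 CartanMatrix.E₆
  | typeE7 : IsADE 7 CartanMatrix.E₇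
  | typeE8 : IsADE 8 CartanMatrix.E₈

/-- The generators. The sign `ε = ±1` distinguishes `X_{ik}^+` and `X_{ik}^-`. -/
inductive Gen (l : ℕ) : Type
  /-- `X_{ik}^ε` -/
  | X (ε : ℤˣ) (i : Fin l) (k : ℤ) : Gen l
  /-- `φ_{i,-m}`, for `m ≥ 0` -/
  | phi (i : Fin l) (m : ℕ) : Gen l
  /-- `ψ_{i,n}`, for `n ≥ 0` -/
  | psi (i : Fin l) (n : ℕ) : Gen l
  /-- `γ^{1/2}` -/
  | gam : Gen l
  /-- `γ^{-1/2}` -/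
  | gamInv : Gen l

/-- The free algebra on the generators. -/
abbrev Free (l : ℕ) : Type := FreeAlgebra ℂ (Gen l)

section Relations

variable {l : ℕ}

/-- `X_{ik}^ε` -/
def fX (ε : ℤˣ) (i : Fin l) (k : ℤ) : Free l := FreeAlgebra.ι ℂ (Gen.X ε i k)

/-- `φ_{im}` for `m ≤ 0`, and `0` for `m > 0`. -/
def fPhi (i : Fin l) (m : ℤ) : Free l :=
  if m ≤ 0 then FreeAlgebra.ι ℂ (Gen.phi i (-m).toNat) else 0

/-- `ψ_{in}` for `n ≥ 0`, and `0` for `n < 0`. -/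
def fPsi (i : Fin l) (n : ℤ) : Free l :=
  if 0 ≤ n then FreeAlgebra.ι ℂ (Gen.psi i n.toNat) else 0

/-- `γ^{k/2}` for `k ∈ ℤ`. -/
def fGam (l : ℕ) (k : ℤ) : Free l :=
  if 0 ≤ k then FreeAlgebra.ι ℂ (Gen.gam : Gen l) ^ k.toNat
  else FreeAlgebra.ι ℂ (Gen.gamInv : Gen l) ^ (-k).toNat

/-- `g_{ij}(x) ∈ C[[x]]`, the Taylor series at `0` of
`f_{ij}(x) = (q^{A_{ij}} x - 1) / (x - q^{A_{ij}})`. -/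
def gSeries (A : Matrix (Fin l) (Fin l) ℤ) (q : ℂ) (i j : Fin l) : PowerSeries ℂ :=
  (PowerSeries.C (q ^ A i j) * PowerSeries.X - 1) *
    (PowerSeries.X - PowerSeries.C (q ^ A i j))⁻¹

/-- `g_{ij}(x)^{ε}` for `ε = ±1`. -/
def gPow (A : Matrix (Fin l) (Fin l) ℤ) (q : ℂ) (i j : Fin l) (ε : ℤˣ) : PowerSeries ℂ :=
  if ε = 1 then gSeries A q i j else (gSeries A q i j)⁻¹

/-- The coefficient of `u ^ k` in `g_{ij}(u γ⁻¹) / g_{ij}(u γ)`. -/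
def gRatio (A : Matrix (Fin l) (Fin l) ℤ) (q : ℂ) (i j : Fin l) (k : ℕ) : Free l :=
  ∑ ab ∈ Finset.HasAntidiagonal.antidiagonal k,
    (PowerSeries.coeff ab.1 (gPow A q i j 1) * PowerSeries.coeff ab.2 (gPow A q i j (-1))) •
      (fGam l (-2 * (ab.1 : ℤ)) * fGam l (2 * (ab.2 : ℤ)))

/-- The defining relations of `U_q(ĝ)`. Each relation between generating functions
`X_i^±(z) = ∑ X_{ik}^± z^{-k}`, `φ_i(z) = ∑ φ_{im} z^{-m}`, `ψ_i(z) = ∑ ψ_{in} z^{-n}` is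
written out coefficient by coefficient. -/
inductive Rel (A : Matrix (Fin l) (Fin l) ℤ) (q : ℂ) : Free l → Free l → Prop
  /-- `γ^{1/2} γ^{-1/2} = 1` -/
  | gam_mul : Rel A q (FreeAlgebra.ι ℂ Gen.gam * FreeAlgebra.ι ℂ Gen.gamInv) 1
  /-- `γ^{-1/2} γ^{1/2} = 1` -/
  | mul_gam : Rel A q (FreeAlgebra.ι ℂ Gen.gamInv * FreeAlgebra.ι ℂ Gen.gam) 1
  /-- `γ^{1/2}` is central -/
  | gam_central (g : Gen l) :
      Rel A q (FreeAlgebra.ι ℂ Gen.gam * FreeAlgebra.ι ℂ g)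
        (FreeAlgebra.ι ℂ g * FreeAlgebra.ι ℂ Gen.gam)
  /-- `γ^{-1/2}` is central -/
  | gamInv_central (g : Gen l) :
      Rel A q (FreeAlgebra.ι ℂ Gen.gamInv * FreeAlgebra.ι ℂ g)
        (FreeAlgebra.ι ℂ g * FreeAlgebra.ι ℂ Gen.gamInv)
  /-- `φ_{i0} ψ_{i0} = 1` -/
  | phi_psi_zero (i : Fin l) : Rel A q (fPhi i 0 * fPsi i 0) 1
  /-- `ψ_{i0} φ_{i0} = 1` -/
  | psi_phi_zero (i : Fin l) : Rel A q (fPsi i 0 * fPhi i 0) 1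
  /-- `[φ_i(z), φ_j(w)] = 0` -/
  | phi_phi (i j : Fin l) (m n : ℤ) : Rel A q (fPhi i m * fPhi j n) (fPhi j n * fPhi i m)
  /-- `[ψ_i(z), ψ_j(w)] = 0` -/
  | psi_psi (i j : Fin l) (m n : ℤ) : Rel A q (fPsi i m * fPsi j n) (fPsi j n * fPsi i m)
  /-- `φ_i(z) ψ_j(w) φ_i(z)⁻¹ ψ_j(w)⁻¹ = g_{ij}(z w⁻¹ γ⁻¹) / g_{ij}(z w⁻¹ γ)`, that is,
  `φ_i(z) ψ_j(w) = (g_{ij}(z w⁻¹ γ⁻¹) / g_{ij}(z w⁻¹ γ)) ψ_j(w) φ_i(z)`;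
  coefficient of `z^m w^{-n}` -/
  | phi_psi (i j : Fin l) (m n : ℕ) :
      Rel A q (fPhi i (-(m : ℤ)) * fPsi j n)
        (∑ k ∈ Finset.range (m + 1),
          gRatio A q i j k * (fPsi j ((n : ℤ) - k) * fPhi i (-((m : ℤ) - k))))
  /-- `φ_i(z) X_j^ε(w) φ_i(z)⁻¹ = g_{ij}(z w⁻¹ γ^{-ε/2})^ε X_j^ε(w)`;
  coefficient of `z^m w^{-k}` after multiplication by `φ_i(z)` on the right -/
  | phi_X (ε : ℤˣ) (i j : Fin l) (m : ℕ) (k : ℤ) :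
      Rel A q (fPhi i (-(m : ℤ)) * fX ε j k)
        (∑ n ∈ Finset.range (m + 1), PowerSeries.coeff n (gPow A q i j ε) •
          (fGam l (-(ε : ℤ) * n) * (fX ε j (k - n) * fPhi i (-((m : ℤ) - n)))))
  /-- `ψ_i(z) X_j^ε(w) ψ_i(z)⁻¹ = g_{ij}(z⁻¹ w γ^{-ε/2})^{-ε} X_j^ε(w)`;
  coefficient of `z^{-m} w^{-k}` after multiplication by `ψ_i(z)` on the right -/
  | psi_X (ε : ℤˣ) (i j : Fin l) (m : ℕ) (k : ℤ) :
      Rel A q (fPsi i (m : ℤ) * fX ε j k)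
        (∑ n ∈ Finset.range (m + 1), PowerSeries.coeff n (gPow A q i j (-ε)) •
          (fGam l (-(ε : ℤ) * n) * (fX ε j (k + n) * fPsi i ((m : ℤ) - n))))
  /-- `(z - q^{ε A_{ij}} w) X_i^ε(z) X_j^ε(w) = (q^{ε A_{ij}} z - w) X_j^ε(w) X_i^ε(z)` -/
  | X_X (ε : ℤˣ) (i j : Fin l) (k m : ℤ) :
      Rel A q
        (fX ε i (k + 1) * fX ε j m - q ^ ((ε : ℤ) * A i j) • (fX ε i k * fX ε j (m + 1)))
        (q ^ ((ε : ℤ) * A i j) • (fX ε j m * fX ε i (k + 1)) - fX ε j (m + 1) * fX ε i k)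
  /-- `[X_i^+(z), X_j^-(w)] =
  δ_{ij} (δ(z w⁻¹ γ⁻¹) ψ_i(w γ^{1/2}) - δ(z w⁻¹ γ) φ_i(z γ^{1/2})) / (q - q⁻¹)` -/
  | Xp_Xm (i j : Fin l) (k m : ℤ) :
      Rel A q (fX 1 i k * fX (-1) j m - fX (-1) j m * fX 1 i k)
        (if i = j then
          (q - q⁻¹)⁻¹ • (fGam l (k - m) * fPsi i (k + m) - fGam l (m - k) * fPhi i (k + m))
        else 0)
  /-- Serre relation for `A_{ij} = 0`: `[X_i^ε(z), X_j^ε(w)] = 0` -/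
  | serre_zero (ε : ℤˣ) (i j : Fin l) (hij : A i j = 0) (k m : ℤ) :
      Rel A q (fX ε i k * fX ε j m) (fX ε j m * fX ε i k)
  /-- Serre relation for `A_{ij} = -1`: the symmetrization in `z₁, z₂` of
  `X_i(z₁) X_i(z₂) X_j(w) - (q + q⁻¹) X_i(z₁) X_j(w) X_i(z₂) + X_j(w) X_i(z₁) X_i(z₂)` is zero -/
  | serre_neg_one (ε : ℤˣ) (i j : Fin l) (hij : A i j = -1) (k₁ k₂ m : ℤ) :
      Rel A q
        ((fX ε i k₁ * fX ε i k₂ * fX ε j m - (q + q⁻¹) • (fX ε i k₁ * fX ε j m * fX ε i k₂)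
            + fX ε j m * fX ε i k₁ * fX ε i k₂) +
          (fX ε i k₂ * fX ε i k₁ * fX ε j m - (q + q⁻¹) • (fX ε i k₂ * fX ε j m * fX ε i k₁)
            + fX ε j m * fX ε i k₂ * fX ε i k₁))
        0

/-- The quantum affine algebra `U_q(ĝ)`, for the Cartan matrix `A` of `g`. -/
abbrev Uq (A : Matrix (Fin l) (Fin l) ℤ) (q : ℂ) : Type := RingQuot (Rel A q)

/-- The class in `U_q(ĝ)` of an element of the free algebra. -/
def toUq (A : Matrix (Fin l) (Fin l) ℤ) (q : ℂ) : Free l →ₐ[ℂ] Uq A q :=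
  RingQuot.mkAlgHom ℂ (Rel A q)

/-! ### Restricted modules of level `ℓ`

A `U_q(ĝ)`-module is a vector space `W` with an algebra homomorphism `ρ : U_q(ĝ) → End W`. -/

variable {W : Type*} [AddCommGroup W] [Module ℂ W] {A : Matrix (Fin l) (Fin l) ℤ} {q : ℂ}

/-- `a(x) ∈ E(W)` is the generating function `∑_k c_k x^{-k}`, where `c_k` acts on `W`
through `ρ`. -/
def IsGenFun (ρ : Uq A q →ₐ[ℂ] Module.End ℂ W) (c : ℤ → Free l) (a : E W) : Prop :=
  ∀ (w : W) (m : ℤ), (a w).coeff m = ρ (toUq A q (c (-m))) w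

/-- The module is restricted: `X_i^±(x), φ_i(x), ψ_i(x)`, acting on `W`, are elements
of `E(W)`. -/
def IsRestricted (ρ : Uq A q →ₐ[ℂ] Module.End ℂ W) : Prop :=
  ∀ i : Fin l, (∀ ε : ℤˣ, ∃ a : E W, IsGenFun ρ (fX ε i) a) ∧
    (∃ a : E W, IsGenFun ρ (fPhi i) a) ∧ (∃ a : E W, IsGenFun ρ (fPsi i) a)

/-- The module is of level `ℓ`: `γ^{±1/2}` acts on `W` as the scalar `q^{±ℓ/4}`. The powers of `q`
are formed with the value `L` of `log q`, that is, `q^c = exp(c L)`. -/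
def HasLevel (ρ : Uq A q →ₐ[ℂ] Module.End ℂ W) (L ℓ : ℂ) : Prop :=
  (∀ w : W, ρ (toUq A q (FreeAlgebra.ι ℂ Gen.gam)) w = Complex.exp (ℓ / 4 * L) • w) ∧
    (∀ w : W, ρ (toUq A q (FreeAlgebra.ι ℂ Gen.gamInv)) w = Complex.exp (-ℓ / 4 * L) • w)

/-- `S_W = {1_W, φ_i(x), ψ_i(x), X_i^±(x) | i = 1, …, l}`. -/
def genSet (ρ : Uq A q →ₐ[ℂ] Module.End ℂ W) : Set (E W) :=
  {oneE W} ∪ {a | ∃ i : Fin l,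
    IsGenFun ρ (fPhi i) a ∨ IsGenFun ρ (fPsi i) a ∨ ∃ ε : ℤˣ, IsGenFun ρ (fX ε i) a}

end Relations

/-- `Γ(q, ℓ) = {q^{m + n ℓ/4} | m, n ∈ ℤ}`, where `q^c = exp(c L)` for the value `L` of `log q`. -/
def gammaGroup (L ℓ : ℂ) : Subgroup ℂˣ where
  carrier := {α | ∃ m n : ℤ, (α : ℂ) = Complex.exp ((m + n * ℓ / 4) * L)}
  one_mem' := ⟨0, 0, by simp⟩
  mul_mem' := by
    rintro α β ⟨m, n, h⟩ ⟨m', n', h'⟩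
    refine ⟨m + m', n + n', ?_⟩
    rw [Units.val_mul, h, h', ← Complex.exp_add]
    congr 1
    push_cast
    ring
  inv_mem' := by
    rintro α ⟨m, n, h⟩
    refine ⟨-m, -n, ?_⟩
    rw [Units.val_inv_eq_inv_val, h, ← Complex.exp_neg]
    congr 1
    push_cast
    ring

/-- The subspaces `V` of `E(W)` that are closed and pseudo `Γ`-local, contain `S ∪ {1_W}` and are
stable under `R_α` for `α ∈ Γ`. -/
def stableClosedSubspaces {W : Type*} [AddCommGroup W] [Module ℂ W] (Γ : Subgroup ℂˣ)
    (S : Set (E W)) : Set (Submodule ℂ (E W)) :=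
  {V | IsClosedSubspace V ∧ PseudoLocal Γ (V : Set (E W)) ∧ S ∪ {oneE W} ⊆ V ∧
    ∀ α ∈ Γ, ∀ a ∈ V, scale α a ∈ V}

end NVA

end

noncomputable section

namespace NVA

open MvPolynomial (X C)

/-! ### Polynomials acting on formal series -/

/-! Everything rests on one property of a set of fields, `Exchange`: after multiplication by a
product of linear forms x_i and x_i - αx_j with α ∈ Γ, each product a(x₁)b(x₂) becomes a polynomial
combination of products b'(x₂)a'(x₁) in the opposite order. The generators have it because any two
Drinfeld currents commute up to such forms: g_ij is a quotient of two linear polynomials with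
coefficients in ±Γ, and the delta functions in [X⁺, X⁻] are annihilated by linear forms
(`exchange_genSet`).

The property yields both notions in the theorem. The given order bounds the exponents of x₂ from
below and the opposite order those of x₁, which is quasi compatibility (`Exchange.quasiCompatible`).
Dividing by the linear forms in C((x₂))((x₁)) gives pseudo Γ-locality (`Exchange.pseudoLocal`).

The property is inherited by linear spans, by R_α with α ∈ Γ and, as in Dong's lemma, by all
products a_n b (`Exchange.products`). For the last point, c(x₃) is moved past a(x₁)b(x₂) and x₁ = x₂
+ x₀ is substituted. A linear form then becomes εx₀ + δ(x₂, x₃) where δ is again a product of linear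
forms, or else δ = 0 and ε ≠ 0; in either case it can be removed one power of x₀ at a time. Hence
the span of the R_α-translates of S_W, enlarged by products again and again, has a union that is
closed, pseudo local and R_α-stable, and lies in every other such subspace (`iSup_stage_isLeast`).

For weak associativity (`Exchange.weak_assoc`) a product p of linear forms puts p·a(x₁)b(x₂)c(x₃)w
into W((x₁, x₂, x₃)). There the substitutions x₁ = x₀ + x₂ + x₃ and x₂ ↦ x₂ + x₃ may be made in
either order (`substOuter3_YSer`), which compares both iterates after multiplication by the
substituted p. A substituted form with a nonzero coefficient at x₃ cancels; the remaining ones are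
constant multiples of x₀, x₂ and x₀ + x₂, and only the last does not cancel (`linForms_cancel`).
This leaves exactly a power (x₀ + x₂)^l, with l independent of w. The quasi module identity is the
defining equation of Y_E, once negative powers of x₁ are cleared (`QuasiCompatible.quasi_assoc`).

Polynomials act on formal series by shifts, so that compatibility of a substitution with
multiplication has to be checked on the variables only; the lemma below is that reduction. Its
domain `D` is where the substitution involves finite sums and is therefore linear. -/

theorem act_intertwine {σ τ M M' : Type*} [AddCommGroup M] [Module ℂ M] [AddCommGroup M']
    [Module ℂ M'] (A : MvPolynomial σ ℂ →ₐ[ℂ] Module.End ℂ M)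
    (B : MvPolynomial τ ℂ →ₐ[ℂ] Module.End ℂ M') (s : MvPolynomial σ ℂ →ₐ[ℂ] MvPolynomial τ ℂ)
    (D : Submodule ℂ M) (φ : M → M')
    (hadd : ∀ F ∈ D, ∀ G ∈ D, φ (F + G) = φ F + φ G)
    (hsmul : ∀ (c : ℂ), ∀ F ∈ D, φ (c • F) = c • φ F)
    (hD : ∀ i, ∀ F ∈ D, A (X i) F ∈ D)
    (hX : ∀ i, ∀ F ∈ D, φ (A (X i) F) = B (s (X i)) (φ F)) (p : MvPolynomial σ ℂ) :
    ∀ F ∈ D, A p F ∈ D ∧ φ (A p F) = B (s p) (φ F) := by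
  induction p using MvPolynomial.induction_on with
  | C c =>
    intro F hF
    rw [← MvPolynomial.algebraMap_eq, AlgHom.commutes, AlgHom.commutes, AlgHom.commutes,
      Module.algebraMap_end_apply, Module.algebraMap_end_apply]
    exact ⟨D.smul_mem c hF, hsmul c F hF⟩
  | add p q hp hq =>
    intro F hF
    rw [map_add, map_add, map_add, LinearMap.add_apply, LinearMap.add_apply,
      hadd _ (hp F hF).1 _ (hq F hF).1, (hp F hF).2, (hq F hF).2]
    exact ⟨D.add_mem (hp F hF).1 (hq F hF).1, rfl⟩
  | mul_X p i hp =>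
    intro F hF
    have h := hp _ (hD i F hF)
    rw [map_mul, map_mul, map_mul, Module.End.mul_apply, Module.End.mul_apply, h.2, hX i F hF]
    exact ⟨h.1, rfl⟩

theorem act_mem {σ M : Type*} [AddCommGroup M] [Module ℂ M]
    (A : MvPolynomial σ ℂ →ₐ[ℂ] Module.End ℂ M) (D : Submodule ℂ M)
    (hD : ∀ i, ∀ F ∈ D, A (X i) F ∈ D) (p : MvPolynomial σ ℂ) {F : M} (hF : F ∈ D) : A p F ∈ D :=
  (act_intertwine A A (AlgHom.id ℂ _) D id (fun _ _ _ _ => rfl) (fun _ _ _ => rfl) hD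
    (fun _ _ _ => rfl) p F hF).1

theorem act_natural {σ M M' : Type*} [AddCommGroup M] [Module ℂ M] [AddCommGroup M']
    [Module ℂ M'] (A : MvPolynomial σ ℂ →ₐ[ℂ] Module.End ℂ M)
    (B : MvPolynomial σ ℂ →ₐ[ℂ] Module.End ℂ M') (φ : M →ₗ[ℂ] M')
    (hX : ∀ i F, φ (A (X i) F) = B (X i) (φ F)) (p : MvPolynomial σ ℂ) (F : M) :
    φ (A p F) = B p (φ F) :=
  (act_intertwine A B (AlgHom.id ℂ _) ⊤ φ (fun _ _ _ _ => map_add φ _ _)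
    (fun _ _ _ => map_smul φ _ _) (fun _ _ _ => trivial) (fun i F _ => hX i F) p F trivial).2

section Act

variable {W W' : Type*} [AddCommGroup W] [Module ℂ W] [AddCommGroup W'] [Module ℂ W']

/-- Multiplication by `x₁ ^ i * x₂ ^ j`. -/
def shift2 (i j : ℤ) : Module.End ℂ (ℤ → ℤ → W) where
  toFun F := fun m n => F (m - i) (n - j)
  map_add' _ _ := rfl
  map_smul' _ _ := rfl

/-- The action of polynomials in two variables on formal series in two variables. -/
def act2 : MvPolynomial (Fin 2) ℂ →ₐ[ℂ] Module.End ℂ (ℤ → ℤ → W) :=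
  AddMonoidAlgebra.lift ℂ _ _
    { toFun := fun d => shift2 (d.toAdd 0) (d.toAdd 1)
      map_one' := by ext F m n; simp [shift2]
      map_mul' := fun d e => by
        ext F m n
        simp only [shift2, toAdd_mul, Finsupp.add_apply, Nat.cast_add, LinearMap.coe_mk,
          AddHom.coe_mk, Module.End.mul_apply]
        congr 1 <;> ring }

theorem act2_apply (p : MvPolynomial (Fin 2) ℂ) (F : ℤ → ℤ → W) : act2 p F = polyMul p F := by
  ext m n
  rw [act2, AddMonoidAlgebra.lift_apply, MvPolynomial.sum_def]
  simp [polyMul, shift2]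

@[simp] theorem act2_X0 (F : ℤ → ℤ → W) (m n : ℤ) : act2 (X 0) F m n = F (m - 1) n := by
  rw [X, MvPolynomial.monomial, act2]
  simp [shift2]

@[simp] theorem act2_X1 (F : ℤ → ℤ → W) (m n : ℤ) : act2 (X 1) F m n = F m (n - 1) := by
  rw [X, MvPolynomial.monomial, act2]
  simp [shift2]

/-- Multiplication by `x₁ ^ i * x₂ ^ j * x₃ ^ k`. -/
def shift3 (i j k : ℤ) : Module.End ℂ (ℤ → ℤ → ℤ → W) where
  toFun F := fun m n t => F (m - i) (n - j) (t - k)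
  map_add' _ _ := rfl
  map_smul' _ _ := rfl

/-- The action of polynomials in three variables on formal series in three variables. -/
def act3 : MvPolynomial (Fin 3) ℂ →ₐ[ℂ] Module.End ℂ (ℤ → ℤ → ℤ → W) :=
  AddMonoidAlgebra.lift ℂ _ _
    { toFun := fun d => shift3 (d.toAdd 0) (d.toAdd 1) (d.toAdd 2)
      map_one' := by ext F m n t; simp [shift3]
      map_mul' := fun d e => by
        ext F m n t
        simp only [shift3, toAdd_mul, Finsupp.add_apply, Nat.cast_add, LinearMap.coe_mk,
          AddHom.coe_mk, Module.End.mul_apply]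
        congr 1 <;> ring }

@[simp] theorem act3_X0 (F : ℤ → ℤ → ℤ → W) (m n t : ℤ) :
    act3 (X 0) F m n t = F (m - 1) n t := by
  rw [X, MvPolynomial.monomial, act3]
  simp [shift3]

@[simp] theorem act3_X1 (F : ℤ → ℤ → ℤ → W) (m n t : ℤ) :
    act3 (X 1) F m n t = F m (n - 1) t := by
  rw [X, MvPolynomial.monomial, act3]
  simp [shift3]

@[simp] theorem act3_X2 (F : ℤ → ℤ → ℤ → W) (m n t : ℤ) :
    act3 (X 2) F m n t = F m n (t - 1) := by
  rw [X, MvPolynomial.monomial, act3]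
  simp [shift3]

theorem act2_C (c : ℂ) (F : ℤ → ℤ → W) : act2 (C c) F = c • F := by
  rw [← MvPolynomial.algebraMap_eq, AlgHom.commutes, Module.algebraMap_end_apply]

theorem act3_C (c : ℂ) (F : ℤ → ℤ → ℤ → W) : act3 (C c) F = c • F := by
  rw [← MvPolynomial.algebraMap_eq, AlgHom.commutes, Module.algebraMap_end_apply]

theorem act2_mul (p q : MvPolynomial (Fin 2) ℂ) (F : ℤ → ℤ → W) :
    act2 (p * q) F = act2 p (act2 q F) := by rw [map_mul, Module.End.mul_apply]

theorem act3_mul (p q : MvPolynomial (Fin 3) ℂ) (F : ℤ → ℤ → ℤ → W) :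
    act3 (p * q) F = act3 p (act3 q F) := by rw [map_mul, Module.End.mul_apply]

theorem act2_comm (p q : MvPolynomial (Fin 2) ℂ) (F : ℤ → ℤ → W) :
    act2 p (act2 q F) = act2 q (act2 p F) := by rw [← act2_mul, mul_comm, act2_mul]

theorem act3_comm (p q : MvPolynomial (Fin 3) ℂ) (F : ℤ → ℤ → ℤ → W) :
    act3 p (act3 q F) = act3 q (act3 p F) := by rw [← act3_mul, mul_comm, act3_mul]

/-- Apply a linear map to all coefficients. -/
def post2 (g : W →ₗ[ℂ] W') : (ℤ → ℤ → W) →ₗ[ℂ] (ℤ → ℤ → W') where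
  toFun F := fun m n => g (F m n)
  map_add' _ _ := by ext; simp
  map_smul' _ _ := by ext; simp

@[simp] theorem post2_apply (g : W →ₗ[ℂ] W') (F : ℤ → ℤ → W) (m n : ℤ) :
    post2 g F m n = g (F m n) := rfl

/-- Apply a linear map to all coefficients. -/
def post3 (g : W →ₗ[ℂ] W') : (ℤ → ℤ → ℤ → W) →ₗ[ℂ] (ℤ → ℤ → ℤ → W') where
  toFun F := fun m n t => g (F m n t)
  map_add' _ _ := by ext; simp
  map_smul' _ _ := by ext; simp

@[simp] theorem post3_apply (g : W →ₗ[ℂ] W') (F : ℤ → ℤ → ℤ → W) (m n t : ℤ) :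
    post3 g F m n t = g (F m n t) := rfl

theorem post2_act (g : W →ₗ[ℂ] W') (p : MvPolynomial (Fin 2) ℂ) (F : ℤ → ℤ → W) :
    post2 g (act2 p F) = act2 p (post2 g F) :=
  act_natural act2 act2 (post2 g)
    (fun i F => by fin_cases i <;> (ext m n; simp)) p F

theorem post3_act (g : W →ₗ[ℂ] W') (p : MvPolynomial (Fin 3) ℂ) (F : ℤ → ℤ → ℤ → W) :
    post3 g (act3 p F) = act3 p (post3 g F) :=
  act_natural act3 act3 (post3 g)
    (fun i F => by fin_cases i <;> (ext m n t; simp)) p F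

end Act

/-! ### The space `W((y))((x))` and the action of `C((y))((x))` -/

section Laurent

variable {W W' : Type*} [AddCommGroup W] [Module ℂ W] [AddCommGroup W'] [Module ℂ W']

/-- `W((y))((x))`, where `F m n` is the coefficient of `x ^ m * y ^ n`. -/
def iterLaurent (W : Type*) [AddCommGroup W] [Module ℂ W] : Submodule ℂ (ℤ → ℤ → W) where
  carrier := {F | (∃ N, ∀ m < N, ∀ n, F m n = 0) ∧ ∀ m, ∃ N, ∀ n < N, F m n = 0}
  zero_mem' := ⟨⟨0, fun _ _ _ => rfl⟩, fun _ => ⟨0, fun _ _ => rfl⟩⟩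
  add_mem' := by
    rintro F G ⟨⟨N, hN⟩, hF⟩ ⟨⟨N', hN'⟩, hG⟩
    refine ⟨⟨min N N', fun m hm n => ?_⟩, fun m => ?_⟩
    · simp [hN m (by omega) n, hN' m (by omega) n]
    · obtain ⟨K, hK⟩ := hF m
      obtain ⟨K', hK'⟩ := hG m
      exact ⟨min K K', fun n hn => by simp [hK n (by omega), hK' n (by omega)]⟩
  smul_mem' := by
    rintro c F ⟨⟨N, hN⟩, hF⟩
    refine ⟨⟨N, fun m hm n => by simp [hN m hm n]⟩, fun m => ?_⟩
    obtain ⟨K, hK⟩ := hF m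
    exact ⟨K, fun n hn => by simp [hK n hn]⟩

/-- `W((y))((x))` as a module over `C((y))((x))`. -/
abbrev IterMod (W : Type*) [AddCommGroup W] [Module ℂ W] : Type _ :=
  HahnModule ℤ (LaurentSeries ℂ) (HahnModule ℤ ℂ W)

/-- The coefficient of `x ^ m * y ^ n`. -/
def IterMod.coef (F : IterMod W) (m n : ℤ) : W :=
  ((HahnModule.of ℂ).symm (((HahnModule.of (LaurentSeries ℂ)).symm F).coeff m)).coeff n

theorem IterMod.coef_mem (F : IterMod W) : F.coef ∈ iterLaurent W := by
  refine ⟨?_, fun m => ?_⟩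
  · refine ⟨((HahnModule.of (LaurentSeries ℂ)).symm F).order, fun m hm n => ?_⟩
    rw [IterMod.coef, HahnSeries.coeff_eq_zero_of_lt_order hm]
    simp
  · refine ⟨((HahnModule.of ℂ).symm (((HahnModule.of (LaurentSeries ℂ)).symm F).coeff m)).order,
      fun n hn => ?_⟩
    rw [IterMod.coef, HahnSeries.coeff_eq_zero_of_lt_order hn]

/-- Gives access to Mathlib's module structure over C((y))((x)): the laws for `laurentMul` on
`iterLaurent` are transported from the module axioms through this lift. -/
theorem exists_iterMod {F : ℤ → ℤ → W} (hF : F ∈ iterLaurent W) :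
    ∃ G : IterMod W, G.coef = F := by
  obtain ⟨⟨N, hN⟩, hF⟩ := hF
  choose K hK using hF
  let row (m : ℤ) : HahnModule ℤ ℂ W := HahnModule.of ℂ
    (HahnSeries.ofSuppBddBelow (F m) ⟨K m, fun n hn => not_lt.1 fun h => hn (hK m n h)⟩)
  have hrow : ∀ m < N, row m = 0 := by
    intro m hm
    refine HahnModule.ext _ _ ?_
    ext n
    exact hN m hm n
  refine ⟨HahnModule.of _ (HahnSeries.ofSuppBddBelow row
    ⟨N, fun m hm => not_lt.1 fun h => hm (hrow m h)⟩), ?_⟩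
  rfl

/-- The antidiagonal in the general formula depends on both supports. Here any finite set that
contains the contributing first exponents may be used, which lets several rows share one index set.
-/
theorem coeff_smul_eq_sum {R V : Type*} [Semiring R] [AddCommMonoid V] [Module R V]
    (x : HahnSeries ℤ R) (y : HahnModule ℤ R V) (a : ℤ) (s : Finset ℤ)
    (hs : ∀ i, i ∉ s → x.coeff i = 0 ∨ ((HahnModule.of R).symm y).coeff (a - i) = 0) :
    ((HahnModule.of R).symm (x • y)).coeff a =
      ∑ i ∈ s, x.coeff i • ((HahnModule.of R).symm y).coeff (a - i) := by
  rw [HahnModule.coeff_smul]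
  refine Finset.sum_of_injOn (fun ij => ij.1) ?_ ?_ ?_ ?_
  · rintro ⟨i, j⟩ h ⟨i', j'⟩ h' e
    simp only [Finset.mem_coe, Finset.mem_vaddAntidiagonal, vadd_eq_add] at h h'
    ext <;> grind
  · rintro ⟨i, j⟩ h
    simp only [Finset.mem_coe, Finset.mem_vaddAntidiagonal, vadd_eq_add,
      HahnSeries.mem_support] at h
    by_contra hi
    rcases hs i hi with h0 | h0
    · exact h.1 h0
    · exact h.2.1 (by rwa [← h.2.2, add_sub_cancel_left] at h0)
  · intro i hi h
    by_contra h0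
    refine h ⟨(i, a - i), ?_, rfl⟩
    simp only [Finset.mem_coe, Finset.mem_vaddAntidiagonal, vadd_eq_add,
      HahnSeries.mem_support]
    exact ⟨fun h => h0 (by rw [h, zero_smul]), fun h => h0 (by rw [h, smul_zero]), by omega⟩
  · rintro ⟨i, j⟩ h
    simp only [Finset.mem_vaddAntidiagonal, vadd_eq_add] at h
    rw [← h.2.2, add_sub_cancel_left]

theorem exists_finset_coeff {R V : Type*} [Semiring R] [AddCommMonoid V] [Module R V]
    (x : HahnSeries ℤ R) (y : HahnModule ℤ R V) (a : ℤ) :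
    ∃ N M : ℤ, ∀ i, i ∉ Finset.Icc N M →
      x.coeff i = 0 ∨ ((HahnModule.of R).symm y).coeff (a - i) = 0 := by
  refine ⟨x.order, a - ((HahnModule.of R).symm y).order, fun i hi => ?_⟩
  rw [Finset.mem_Icc, not_and_or, not_le, not_le] at hi
  rcases hi with hi | hi
  · exact Or.inl (HahnSeries.coeff_eq_zero_of_lt_order hi)
  · exact Or.inr (HahnSeries.coeff_eq_zero_of_lt_order (by omega))

theorem IterMod.coef_smul (f : Laurent2) (G : IterMod W) : (f • G).coef = laurentMul f G.coef := by
  ext m n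
  have key : ∀ (s : Finset ℤ) (g : ℤ → HahnModule ℤ ℂ W),
      ((HahnModule.of ℂ).symm (∑ x ∈ s, g x)).coeff n =
        ∑ x ∈ s, ((HahnModule.of ℂ).symm (g x)).coeff n := by
    intro s g
    classical
    induction s using Finset.induction_on with
    | empty => simp
    | insert a s ha ih => rw [Finset.sum_insert ha, Finset.sum_insert ha, ← ih]; simp
  obtain ⟨N, M, hNM⟩ := exists_finset_coeff f G m
  have hrow : ∀ i : ℤ, ∃ t : Finset ℤ, ∀ j, j ∉ t →
      (f.coeff i).coeff j = 0 ∨ G.coef (m - i) (n - j) = 0 := fun i => by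
    obtain ⟨N', M', h⟩ := exists_finset_coeff (f.coeff i)
      (((HahnModule.of (LaurentSeries ℂ)).symm G).coeff (m - i)) n
    exact ⟨_, h⟩
  choose t ht using hrow
  rw [IterMod.coef, coeff_smul_eq_sum f G m _ hNM, key]
  -- With the union of all `t i` as index set for every row, the iterated sum is a sum over one
  -- rectangle, which can be compared with the `finsum` over pairs.
  have hinner : ∀ i ∈ Finset.Icc N M, ((HahnModule.of ℂ).symm
      (f.coeff i • ((HahnModule.of (LaurentSeries ℂ)).symm G).coeff (m - i))).coeff n =
      ∑ j ∈ (Finset.Icc N M).biUnion t, f.coef i j • G.coef (m - i) (n - j) := by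
    intro i hi
    refine coeff_smul_eq_sum _ _ n _ fun j hj => ht i j fun h => hj ?_
    exact Finset.mem_biUnion.2 ⟨i, hi, h⟩
  rw [Finset.sum_congr rfl hinner, ← Finset.sum_product', laurentMul]
  refine (finsum_eq_sum_of_support_subset _ fun ij hij => ?_).symm
  rw [Function.mem_support] at hij
  have h1 : ij.1 ∈ Finset.Icc N M := by
    by_contra h
    refine hij ?_
    rcases hNM _ h with h0 | h0
    · rw [Laurent2.coef, h0, HahnSeries.coeff_zero, zero_smul]
    · rw [IterMod.coef, h0]
      simp
  have h2 : ij.2 ∈ t ij.1 := by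
    by_contra h
    refine hij ?_
    rcases ht _ _ h with h0 | h0
    · rw [Laurent2.coef, h0, zero_smul]
    · rw [h0, smul_zero]
  simp only [Finset.coe_product, Set.mem_prod, Finset.mem_coe]
  exact ⟨h1, Finset.mem_biUnion.2 ⟨_, h1, h2⟩⟩

theorem IterMod.coef_add (F G : IterMod W) : (F + G).coef = F.coef + G.coef := by
  ext m n
  simp [IterMod.coef]

theorem hahnModule_mul_smul {R V : Type*} [Semiring R] [AddCommMonoid V] [Module R V]
    (f g : HahnSeries ℤ R) (G : HahnModule ℤ R V) : (f * g) • G = f • (g • G) := mul_smul f g G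

theorem hahnModule_one_smul {R V : Type*} [Semiring R] [AddCommMonoid V] [Module R V]
    (G : HahnModule ℤ R V) : (1 : HahnSeries ℤ R) • G = G := one_smul _ G

theorem hahnModule_add_smul {R V : Type*} [Semiring R] [AddCommMonoid V] [Module R V]
    (f g : HahnSeries ℤ R) (G : HahnModule ℤ R V) : (f + g) • G = f • G + g • G := add_smul f g G

theorem laurentMul_mem (f : Laurent2) {F : ℤ → ℤ → W} (hF : F ∈ iterLaurent W) :
    laurentMul f F ∈ iterLaurent W := by
  obtain ⟨G, rfl⟩ := exists_iterMod hF
  rw [← IterMod.coef_smul]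
  exact IterMod.coef_mem _

theorem laurentMul_mul (f g : Laurent2) {F : ℤ → ℤ → W} (hF : F ∈ iterLaurent W) :
    laurentMul (f * g) F = laurentMul f (laurentMul g F) := by
  obtain ⟨G, rfl⟩ := exists_iterMod hF
  rw [← IterMod.coef_smul, ← IterMod.coef_smul, ← IterMod.coef_smul]
  exact congrArg IterMod.coef (hahnModule_mul_smul f g G)

theorem laurentMul_one {F : ℤ → ℤ → W} (hF : F ∈ iterLaurent W) : laurentMul 1 F = F := by
  obtain ⟨G, rfl⟩ := exists_iterMod hF
  rw [← IterMod.coef_smul]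
  exact congrArg IterMod.coef (hahnModule_one_smul G)

theorem add_laurentMul (f g : Laurent2) {F : ℤ → ℤ → W} (hF : F ∈ iterLaurent W) :
    laurentMul (f + g) F = laurentMul f F + laurentMul g F := by
  obtain ⟨F, rfl⟩ := exists_iterMod hF
  rw [← IterMod.coef_smul, ← IterMod.coef_smul, ← IterMod.coef_smul,
    ← IterMod.coef_add]
  exact congrArg IterMod.coef (hahnModule_add_smul f g F)

/-- The inclusion of `C[x, y]` into `C((y))((x))`. -/
def polyLaurent : MvPolynomial (Fin 2) ℂ →+* Laurent2 :=
  MvPolynomial.eval₂Hom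
    ((HahnSeries.C : LaurentSeries ℂ →+* Laurent2).comp (HahnSeries.C : ℂ →+* LaurentSeries ℂ))
    ![HahnSeries.single (1 : ℤ) (1 : LaurentSeries ℂ),
      HahnSeries.C (HahnSeries.single (1 : ℤ) (1 : ℂ))]

theorem laurentMul_single (i j : ℤ) (c : ℂ) (F : ℤ → ℤ → W) :
    laurentMul (HahnSeries.single i (HahnSeries.single j c)) F = c • shift2 i j F := by
  ext m n
  rw [laurentMul, finsum_eq_single _ (i, j)]
  · simp [Laurent2.coef, shift2]
  · rintro ⟨i', j'⟩ h
    rw [Laurent2.coef]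
    rcases eq_or_ne i' i with rfl | h'
    · rw [HahnSeries.coeff_single_same, HahnSeries.coeff_single_of_ne, zero_smul]
      rintro rfl
      exact h rfl
    · rw [HahnSeries.coeff_single_of_ne h', HahnSeries.coeff_zero, zero_smul]

theorem laurentMul_polyLaurent (p : MvPolynomial (Fin 2) ℂ) {F : ℤ → ℤ → W}
    (hF : F ∈ iterLaurent W) : laurentMul (polyLaurent p) F = act2 p F := by
  induction p using MvPolynomial.induction_on generalizing F with
  | C c =>
    have : polyLaurent (C c) = HahnSeries.single 0 (HahnSeries.single 0 c) := by
      simp [polyLaurent]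
    rw [this, laurentMul_single, act2_C]
    ext m n
    simp [shift2]
  | add p q hp hq => rw [map_add, add_laurentMul _ _ hF, hp hF, hq hF, map_add]; rfl
  | mul_X p i hp =>
    have h : laurentMul (polyLaurent (X i)) F = act2 (X i) F := by
      have : polyLaurent (X i) =
          HahnSeries.single ((if i = 0 then 1 else 0 : ℤ))
            (HahnSeries.single (if i = 0 then 0 else 1 : ℤ) 1) := by
        fin_cases i <;> simp [polyLaurent]
      rw [this, laurentMul_single]
      ext m n
      fin_cases i <;> simp [shift2]
    rw [map_mul, laurentMul_mul _ _ hF, h, hp, act2_mul]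
    rw [← h]
    exact laurentMul_mem _ hF

/-- Acting on the constant series 1 ∈ C((y))((x)) displays the coefficients of a polynomial. -/
theorem polyLaurent_injective : Function.Injective polyLaurent := by
  intro p q h
  have h1 : ∀ m n, act2 p (fun m n : ℤ => if m = 0 ∧ n = 0 then (1 : ℂ) else 0) m n =
      act2 q (fun m n : ℤ => if m = 0 ∧ n = 0 then (1 : ℂ) else 0) m n := by
    intro m n
    have hF : (fun m n : ℤ => if m = 0 ∧ n = 0 then (1 : ℂ) else 0) ∈ iterLaurent ℂ :=
      ⟨⟨0, fun m hm n => if_neg (by omega)⟩, fun m => ⟨0, fun n hn => if_neg (by omega)⟩⟩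
    rw [← laurentMul_polyLaurent _ hF, ← laurentMul_polyLaurent _ hF, h]
  have h2 : ∀ (p : MvPolynomial (Fin 2) ℂ) (d : Fin 2 →₀ ℕ),
      act2 p (fun m n : ℤ => if m = 0 ∧ n = 0 then (1 : ℂ) else 0) (d 0) (d 1) = p.coeff d := by
    intro p d
    rw [act2_apply, polyMul, Finset.sum_eq_single d]
    · simp
    · intro e _ he
      rw [if_neg, smul_zero]
      rintro ⟨h0, h1⟩
      refine he ?_
      ext i
      fin_cases i
      · simp; omega
      · simp; omega
    · intro hd
      rw [MvPolynomial.notMem_support_iff.1 hd, zero_smul]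
  ext d
  rw [← h2, ← h2, h1]

end Laurent

/-! ### Substitutions -/

section Subst

variable {W W' : Type*} [AddCommGroup W] [Module ℂ W] [AddCommGroup W'] [Module ℂ W']

/-- `W((x₁, x₂))` -/
def bounded2 (W : Type*) [AddCommGroup W] [Module ℂ W] : Submodule ℂ (ℤ → ℤ → W) where
  carrier := {F | ∃ N, ∀ m n, (m < N ∨ n < N) → F m n = 0}
  zero_mem' := ⟨0, fun _ _ _ => rfl⟩
  add_mem' := by
    rintro F G ⟨N, hN⟩ ⟨N', hN'⟩
    exact ⟨min N N', fun m n h => by simp [hN m n (by omega), hN' m n (by omega)]⟩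
  smul_mem' := by
    rintro c F ⟨N, hN⟩
    exact ⟨N, fun m n h => by simp [hN m n h]⟩

theorem bounded2_X (i : Fin 2) (F : ℤ → ℤ → W) (hF : F ∈ bounded2 W) :
    act2 (X i) F ∈ bounded2 W := by
  obtain ⟨N, hN⟩ := hF
  refine ⟨N, fun m n h => ?_⟩
  fin_cases i
  · simpa using hN (m - 1) n (by omega)
  · simpa using hN m (n - 1) (by omega)

theorem bounded2_act (p : MvPolynomial (Fin 2) ℂ) {F : ℤ → ℤ → W} (hF : F ∈ bounded2 W) :
    act2 p F ∈ bounded2 W := act_mem act2 _ bounded2_X p hF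

theorem iterLaurent_X (i : Fin 2) (F : ℤ → ℤ → W) (hF : F ∈ iterLaurent W) :
    act2 (X i) F ∈ iterLaurent W := by
  rw [← laurentMul_polyLaurent _ hF]
  exact laurentMul_mem _ hF

theorem iterLaurent_act (p : MvPolynomial (Fin 2) ℂ) {F : ℤ → ℤ → W} (hF : F ∈ iterLaurent W) :
    act2 p F ∈ iterLaurent W := act_mem act2 _ iterLaurent_X p hF

/-- The substitution `x₁ ↦ x₀ + x`, as an algebra homomorphism. -/
def shiftHom : MvPolynomial (Fin 2) ℂ →ₐ[ℂ] MvPolynomial (Fin 2) ℂ :=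
  MvPolynomial.aeval ![X 0 + X 1, X 1]

theorem shiftHom_injective : Function.Injective shiftHom := by
  have h : Function.LeftInverse
      (MvPolynomial.aeval ![X 0 - X 1, X 1] : MvPolynomial (Fin 2) ℂ →ₐ[ℂ] _) shiftHom := by
    intro p
    have : (MvPolynomial.aeval ![X 0 - X 1, X 1]).comp shiftHom =
        AlgHom.id ℂ (MvPolynomial (Fin 2) ℂ) := by
      refine MvPolynomial.algHom_ext fun i => ?_
      fin_cases i <;> simp [shiftHom]
    exact DFunLike.congr_fun this p
  exact h.injective

theorem shiftLaurent_eq (p : MvPolynomial (Fin 2) ℂ) :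
    shiftLaurent p = polyLaurent (shiftHom p) := by
  have : MvPolynomial.eval₂Hom
      ((HahnSeries.C : LaurentSeries ℂ →+* Laurent2).comp (HahnSeries.C : ℂ →+* LaurentSeries ℂ))
      ![HahnSeries.single (1 : ℤ) (1 : LaurentSeries ℂ) +
        HahnSeries.C (HahnSeries.single (1 : ℤ) (1 : ℂ)),
      HahnSeries.C (HahnSeries.single (1 : ℤ) (1 : ℂ))] =
      polyLaurent.comp (shiftHom : MvPolynomial (Fin 2) ℂ →+* MvPolynomial (Fin 2) ℂ) := by
    refine MvPolynomial.ringHom_ext (fun c => ?_) fun i => ?_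
    · simp [shiftHom, polyLaurent]
    · fin_cases i <;> simp [shiftHom, polyLaurent]
  exact DFunLike.congr_fun this p

theorem shiftLaurent_ne_zero {p : MvPolynomial (Fin 2) ℂ} (hp : p ≠ 0) : shiftLaurent p ≠ 0 := by
  rw [shiftLaurent_eq]
  exact fun h => hp (shiftHom_injective (polyLaurent_injective (by simpa using h)))

theorem laurent2_inv_mul_cancel {f : Laurent2} (hf : f ≠ 0) : f⁻¹ * f = 1 :=
  inv_mul_cancel₀ (G₀ := Laurent2) hf

/-- Two elements of `W((y))((x))` agree if they do so after multiplication by a nonzero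
polynomial. -/
theorem act2_cancel {p : MvPolynomial (Fin 2) ℂ} (hp : p ≠ 0) {F G : ℤ → ℤ → W}
    (hF : F ∈ iterLaurent W) (hG : G ∈ iterLaurent W) (h : act2 p F = act2 p G) : F = G := by
  have hp' : polyLaurent p ≠ 0 := fun h => hp (polyLaurent_injective (by simpa using h))
  have e : (polyLaurent p)⁻¹ * polyLaurent p = 1 := laurent2_inv_mul_cancel hp'
  have key : ∀ F ∈ iterLaurent W, laurentMul (polyLaurent p)⁻¹ (act2 p F) = F := by
    intro F hF
    rw [← laurentMul_polyLaurent _ hF, ← laurentMul_mul _ _ hF, e]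
    exact laurentMul_one hF
  rw [← key F hF, h, key G hG]

theorem substInner_finite {F : ℤ → ℤ → W} (hF : F ∈ bounded2 W) (i : ℕ) (s : ℤ) :
    (Function.support fun m : ℤ => Ring.choose m i • F m (s + i - m)).Finite := by
  obtain ⟨N, hN⟩ := hF
  refine (Set.finite_Icc N (s + i - N)).subset fun m hm => ?_
  by_contra h
  rw [Set.mem_Icc, not_and_or, not_le, not_le] at h
  exact hm (by simp only; rw [hN _ _ (by omega), smul_zero])

theorem substInner_natCast (F : ℤ → ℤ → W) (i : ℕ) (s : ℤ) :
    substInner F i s = ∑ᶠ m : ℤ, Ring.choose m i • F m (s + i - m) := by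
  simp [substInner]

theorem substInner_neg (F : ℤ → ℤ → W) {i : ℤ} (hi : i < 0) (s : ℤ) : substInner F i s = 0 := by
  simp [substInner, hi]

theorem substInner_add {F G : ℤ → ℤ → W} (hF : F ∈ bounded2 W) (hG : G ∈ bounded2 W) :
    substInner (F + G) = substInner F + substInner G := by
  ext i s
  rcases lt_or_ge i 0 with hi | hi
  · simp [substInner_neg _ hi]
  · lift i to ℕ using hi
    rw [Pi.add_apply, Pi.add_apply]
    simp_rw [substInner_natCast]
    rw [← finsum_add_distrib (substInner_finite hF i s) (substInner_finite hG i s)]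
    simp

theorem substInner_smul (c : ℂ) (F : ℤ → ℤ → W) : substInner (c • F) = c • substInner F := by
  ext i s
  rcases lt_or_ge i 0 with hi | hi
  · simp [substInner_neg _ hi]
  · lift i to ℕ using hi
    rw [Pi.smul_apply, Pi.smul_apply]
    simp_rw [substInner_natCast]
    rw [smul_finsum]
    exact finsum_congr fun m => smul_comm _ _ _

theorem substInner_mem {F : ℤ → ℤ → W} (hF : F ∈ bounded2 W) : substInner F ∈ iterLaurent W := by
  obtain ⟨N, hN⟩ := hF
  refine ⟨⟨0, fun i hi s => substInner_neg _ hi s⟩, fun i => ?_⟩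
  rcases lt_or_ge i 0 with hi | hi
  · exact ⟨0, fun s _ => substInner_neg _ hi s⟩
  · lift i to ℕ using hi
    refine ⟨2 * N - i, fun s hs => ?_⟩
    rw [substInner_natCast]
    refine finsum_eq_zero_of_forall_eq_zero fun m => ?_
    rw [hN _ _ (by omega), smul_zero]

/-- For x₁ this is Pascal's rule binom(m+1, i+1) = binom(m, i) + binom(m, i+1), after the summation
index is shifted by one. -/
theorem substInner_X (j : Fin 2) (F : ℤ → ℤ → W) (hF : F ∈ bounded2 W) :
    substInner (act2 (X j) F) = act2 (shiftHom (X j)) (substInner F) := by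
  fin_cases j
  · have h : shiftHom (X ((fun i => i) (⟨0, by omega⟩ : Fin 2))) = X 0 + X 1 := by
      simp [shiftHom]
    rw [h, map_add]
    ext i s
    rw [LinearMap.add_apply, Pi.add_apply, Pi.add_apply, act2_X0, act2_X1]
    rcases lt_or_ge i 0 with hi | hi
    · simp [substInner_neg _ hi, substInner_neg _ (by omega : i - 1 < 0)]
    · lift i to ℕ using hi
      have h1 : substInner (act2 (X 0) F) i s =
          ∑ᶠ m : ℤ, Ring.choose (m + 1) i • F m (s + i - 1 - m) := by
        rw [substInner_natCast, ← finsum_comp_equiv (Equiv.addRight (1 : ℤ))]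
        refine finsum_congr fun m => ?_
        simp only [Equiv.coe_addRight, act2_X0]
        congr 2 <;> ring
      refine h1.trans ?_
      have h2 : substInner F i (s - 1) = ∑ᶠ m : ℤ, Ring.choose m i • F m (s + i - 1 - m) := by
        rw [substInner_natCast]
        refine finsum_congr fun m => ?_
        congr 2; ring
      rw [h2]
      -- For i = 0 the term with x₀^{-1} is zero and the binomial coefficients equal 1; Pascal's
      -- rule enters only for i > 0.
      rcases i with _ | i
      · rw [substInner_neg _ (by norm_num)]
        simp
      · have h3 : ((i + 1 : ℕ) : ℤ) - 1 = i := by push_cast; ring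
        rw [h3, substInner_natCast, ← finsum_add_distrib (substInner_finite hF i s)]
        · refine finsum_congr fun m => ?_
          rw [Ring.choose_succ_succ, add_smul]
          congr 3
          push_cast
          ring
        · have h4 := substInner_finite hF (i + 1) (s - 1)
          rwa [show s - 1 + ((i + 1 : ℕ) : ℤ) = s + ((i + 1 : ℕ) : ℤ) - 1 by ring] at h4
  · have h : shiftHom (X ((fun i => i) (⟨1, by omega⟩ : Fin 2))) = X 1 := by
      simp [shiftHom]
    rw [h]
    ext i s
    rw [act2_X1]
    rcases lt_or_ge i 0 with hi | hi
    · simp [substInner_neg _ hi]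
    · lift i to ℕ using hi
      rw [substInner_natCast, substInner_natCast]
      refine finsum_congr fun m => ?_
      change _ • act2 (X 1) F _ _ = _
      rw [act2_X1]
      congr 2; ring

theorem substInner_act (p : MvPolynomial (Fin 2) ℂ) {F : ℤ → ℤ → W} (hF : F ∈ bounded2 W) :
    substInner (act2 p F) = act2 (shiftHom p) (substInner F) :=
  (act_intertwine act2 act2 shiftHom (bounded2 W) substInner (fun _ hF _ hG => substInner_add hF hG)
    (fun c F _ => substInner_smul c F) bounded2_X substInner_X p F hF).2

theorem substInner_post (g : W →ₗ[ℂ] W') {F : ℤ → ℤ → W} (hF : F ∈ bounded2 W) :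
    substInner (post2 g F) = post2 g (substInner F) := by
  ext i s
  rw [post2_apply]
  rcases lt_or_ge i 0 with hi | hi
  · simp [substInner_neg _ hi]
  · lift i to ℕ using hi
    rw [substInner_natCast, substInner_natCast]
    have := (g : W →+ W').map_finsum (substInner_finite hF i s)
    simp only [AddMonoidHom.coe_coe, map_zsmul] at this
    rw [this]
    rfl

theorem iterLaurent_post (g : W →ₗ[ℂ] W') {F : ℤ → ℤ → W} (hF : F ∈ iterLaurent W) :
    post2 g F ∈ iterLaurent W' := by
  obtain ⟨⟨N, hN⟩, h⟩ := hF
  refine ⟨⟨N, fun m hm n => by simp [hN m hm n]⟩, fun m => ?_⟩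
  obtain ⟨K, hK⟩ := h m
  exact ⟨K, fun n hn => by simp [hK n hn]⟩

theorem bounded2_post (g : W →ₗ[ℂ] W') {F : ℤ → ℤ → W} (hF : F ∈ bounded2 W) :
    post2 g F ∈ bounded2 W' := by
  obtain ⟨N, hN⟩ := hF
  exact ⟨N, fun m n h => by simp [hN m n h]⟩

/-! ### The substitution `x₁ = x₀ + x₂` in nonnegative powers of `x₂` -/

/-- The series whose exponents in the second variable are bounded below. -/
def boundedSnd (W : Type*) [AddCommGroup W] [Module ℂ W] : Submodule ℂ (ℤ → ℤ → W) where
  carrier := {F | ∃ N, ∀ m n, n < N → F m n = 0}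
  zero_mem' := ⟨0, fun _ _ _ => rfl⟩
  add_mem' := by
    rintro F G ⟨N, hN⟩ ⟨N', hN'⟩
    exact ⟨min N N', fun m n h => by simp [hN m n (by omega), hN' m n (by omega)]⟩
  smul_mem' := by
    rintro c F ⟨N, hN⟩
    exact ⟨N, fun m n h => by simp [hN m n h]⟩

theorem boundedSnd_X (i : Fin 2) (F : ℤ → ℤ → W) (hF : F ∈ boundedSnd W) :
    act2 (X i) F ∈ boundedSnd W := by
  obtain ⟨N, hN⟩ := hF
  refine ⟨N, fun m n h => ?_⟩
  fin_cases i
  · simpa using hN (m - 1) n (by omega)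
  · simpa using hN m (n - 1) (by omega)

theorem substOuter_finite {F : ℤ → ℤ → W} (hF : F ∈ boundedSnd W) (i s : ℤ) :
    (Function.support fun j : ℕ =>
      Ring.choose (i + (j : ℤ)) j • F (i + (j : ℤ)) (s - (j : ℤ))).Finite := by
  obtain ⟨N, hN⟩ := hF
  refine (Set.finite_Iic (s - N).toNat).subset fun j hj => ?_
  by_contra h
  rw [Set.mem_Iic, not_le] at h
  exact hj (by simp only; rw [hN _ _ (by omega), smul_zero])

theorem substOuter_add {F G : ℤ → ℤ → W} (hF : F ∈ boundedSnd W) (hG : G ∈ boundedSnd W) :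
    substOuter (F + G) = substOuter F + substOuter G := by
  ext i s
  simp only [Pi.add_apply, substOuter]
  rw [← finsum_add_distrib (substOuter_finite hF i s) (substOuter_finite hG i s)]
  simp

theorem substOuter_smul (c : ℂ) (F : ℤ → ℤ → W) : substOuter (c • F) = c • substOuter F := by
  ext i s
  simp only [Pi.smul_apply, substOuter]
  rw [smul_finsum]
  exact finsum_congr fun m => smul_comm _ _ _

theorem substOuter_X (j : Fin 2) (F : ℤ → ℤ → W) (hF : F ∈ boundedSnd W) :
    substOuter (act2 (X j) F) = act2 (shiftHom (X j)) (substOuter F) := by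
  fin_cases j
  · have h : shiftHom (X ((fun i => i) (⟨0, by omega⟩ : Fin 2))) = X 0 + X 1 := by
      simp [shiftHom]
    rw [h, map_add]
    ext i s
    rw [LinearMap.add_apply, Pi.add_apply, Pi.add_apply, act2_X0, act2_X1]
    change substOuter (act2 (X 0) F) i s = _
    obtain ⟨N, hN⟩ := hF
    -- All three sums are cut off at the same length, so that Pascal's rule can be applied term by
    -- term.
    have hsum : ∀ (a b : ℤ) (g : ℕ → ℤ), b ≤ s →
        (∑ᶠ j : ℕ, g j • F (a + j) (b - j)) =
          ∑ j ∈ Finset.range ((s - N).toNat + 1), g j • F (a + j) (b - j) := by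
      intro a b g hb
      refine finsum_eq_sum_of_support_subset _ fun j hj => ?_
      by_contra h
      rw [Finset.mem_coe, Finset.mem_range, not_lt] at h
      exact hj (by simp only; rw [hN _ _ (by omega), smul_zero])
    have h1 : substOuter (act2 (X 0) F) i s =
        ∑ j ∈ Finset.range ((s - N).toNat + 1),
          Ring.choose (i + (j : ℤ)) j • F (i - 1 + j) (s - j) := by
      rw [← hsum _ _ _ le_rfl]
      refine finsum_congr fun j => ?_
      rw [act2_X0]
      congr 2; ring
    have h2 : substOuter F (i - 1) s = ∑ j ∈ Finset.range ((s - N).toNat + 1),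
          Ring.choose (i - 1 + (j : ℤ)) j • F (i - 1 + j) (s - j) := hsum _ _ _ le_rfl
    have h3 : substOuter F i (s - 1) = ∑ j ∈ Finset.range ((s - N).toNat + 1),
          Ring.choose (i + (j : ℤ)) j • F (i + j) (s - 1 - j) := hsum _ _ _ (by omega)
    -- The last term of the third sum lies below the bound N; without it the sums align after the
    -- first term of the other two is split off.
    have h4 : F (i + ((s - N).toNat : ℕ)) (s - 1 - ((s - N).toNat : ℕ)) = 0 := hN _ _ (by omega)
    rw [h1, h2, h3, Finset.sum_range_succ' _ (s - N).toNat, Finset.sum_range_succ' _ (s - N).toNat,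
      Finset.sum_range_succ (fun j : ℕ => Ring.choose (i + (j : ℤ)) j • F (i + j) (s - 1 - j)), h4,
      smul_zero, add_zero, add_right_comm, ← Finset.sum_add_distrib]
    congr 1
    · refine Finset.sum_congr rfl fun j _ => ?_
      have e1 : i + ((j + 1 : ℕ) : ℤ) = (i + j) + 1 := by push_cast; ring
      have e2 : i - 1 + ((j + 1 : ℕ) : ℤ) = i + j := by push_cast; ring
      have e3 : s - ((j + 1 : ℕ) : ℤ) = s - 1 - j := by push_cast; ring
      rw [e1, e2, e3, Ring.choose_succ_succ, add_smul, add_comm]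
    · simp
  · have h : shiftHom (X ((fun i => i) (⟨1, by omega⟩ : Fin 2))) = X 1 := by
      simp [shiftHom]
    rw [h]
    ext i s
    rw [act2_X1]
    refine finsum_congr fun m => ?_
    change _ • act2 (X 1) F _ _ = _
    rw [act2_X1]
    congr 2; ring

theorem substOuter_act (p : MvPolynomial (Fin 2) ℂ) {F : ℤ → ℤ → W} (hF : F ∈ boundedSnd W) :
    substOuter (act2 p F) = act2 (shiftHom p) (substOuter F) :=
  (act_intertwine act2 act2 shiftHom (boundedSnd W) substOuter (fun _ hF _ hG => substOuter_add hF hG)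
    (fun c F _ => substOuter_smul c F) boundedSnd_X substOuter_X p F hF).2

theorem substOuter_post (g : W →ₗ[ℂ] W') {F : ℤ → ℤ → W} (hF : F ∈ boundedSnd W) :
    substOuter (post2 g F) = post2 g (substOuter F) := by
  ext i s
  have := (g : W →+ W').map_finsum (substOuter_finite hF i s)
  simp only [AddMonoidHom.coe_coe, map_zsmul] at this
  rw [post2_apply, substOuter, substOuter, this]
  rfl

/-- If there are no negative powers of `x₁`, the two expansions of the substitution agree. -/
theorem substOuter_eq_substInner {F : ℤ → ℤ → W} (hF : ∀ m n, m < 0 → F m n = 0) :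
    substOuter F = substInner F := by
  ext i s
  rcases lt_or_ge i 0 with hi | hi
  · rw [substInner_neg _ hi]
    refine finsum_eq_zero_of_forall_eq_zero fun j => ?_
    rcases lt_or_ge (i + j) 0 with h | h
    · rw [hF _ _ h, smul_zero]
    · obtain ⟨k, hk⟩ := Int.eq_ofNat_of_zero_le h
      rw [hk, Ring.choose_natCast, Nat.choose_eq_zero_of_lt (by omega)]
      simp
  · lift i to ℕ using hi
    rw [substInner_natCast, substOuter]
    -- Put m = i + j and use binom(i+j, j) = binom(i+j, i). The exponents m < i outside the range
    -- contribute nothing: F vanishes for m < 0, and binom(m, i) = 0 for 0 ≤ m < i.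
    have hinj : Function.Injective fun j : ℕ => (i : ℤ) + j := fun a b h => by simpa using h
    rw [← finsum_mem_univ (fun m : ℤ => Ring.choose m i • F m (s + i - m)),
      finsum_mem_inter_support_eq _ Set.univ
      (Set.range fun j : ℕ => (i : ℤ) + j), finsum_mem_range hinj]
    · refine finsum_congr fun j => ?_
      have e : s + (i : ℤ) - (i + j) = s - j := by ring
      rw [e, ← Nat.cast_add, Ring.choose_natCast, Ring.choose_natCast,
        Nat.choose_symm_add]
    · rw [Set.univ_inter, eq_comm, Set.inter_eq_right]
      intro m hm
      by_contra h
      refine hm ?_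
      simp only
      rcases lt_or_ge m 0 with hm0 | hm0
      · rw [hF _ _ hm0, smul_zero]
      · lift m to ℕ using hm0
        rw [Ring.choose_natCast, Nat.choose_eq_zero_of_lt]
        · simp
        · by_contra h'
          exact h ⟨m - i, by simp only; omega⟩

end Subst

/-! ### The series `Y_E` of a series that a polynomial makes bounded -/

section YSer

variable {W W' : Type*} [AddCommGroup W] [Module ℂ W] [AddCommGroup W'] [Module ℂ W']

/-- The series `F(x₁, x)` such that `p F ∈ W((x₁, x))` for some polynomial `p ≠ 0`. -/
def clearable (W : Type*) [AddCommGroup W] [Module ℂ W] : Submodule ℂ (ℤ → ℤ → W) where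
  carrier := {F | ∃ p : MvPolynomial (Fin 2) ℂ, p ≠ 0 ∧ act2 p F ∈ bounded2 W}
  zero_mem' := ⟨1, one_ne_zero, by rw [map_zero]; exact zero_mem _⟩
  add_mem' := by
    rintro F G ⟨p, hp, hF⟩ ⟨q, hq, hG⟩
    refine ⟨p * q, mul_ne_zero hp hq, ?_⟩
    rw [map_add, act2_mul p q G, mul_comm, act2_mul]
    exact add_mem (bounded2_act _ hF) (bounded2_act _ hG)
  smul_mem' := by
    rintro c F ⟨p, hp, hF⟩
    refine ⟨p, hp, ?_⟩
    rw [map_smul]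
    exact Submodule.smul_mem _ _ hF

theorem clearable_X (i : Fin 2) (F : ℤ → ℤ → W) (hF : F ∈ clearable W) :
    act2 (X i) F ∈ clearable W := by
  obtain ⟨p, hp, hF⟩ := hF
  exact ⟨p, hp, by rw [act2_comm]; exact bounded2_act _ hF⟩

theorem clearable_post (g : W →ₗ[ℂ] W') {F : ℤ → ℤ → W} (hF : F ∈ clearable W) :
    post2 g F ∈ clearable W' := by
  obtain ⟨p, hp, hF⟩ := hF
  exact ⟨p, hp, by rw [← post2_act]; exact bounded2_post g hF⟩

open Classical in
/-- The series `Y(x₀, x)` with `p(x₀ + x, x) Y(x₀, x) = (p(x₁, x) F(x₁, x))|_{x₁ = x + x₀}`. -/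
def YSer (F : ℤ → ℤ → W) : ℤ → ℤ → W :=
  if h : F ∈ clearable W then
    laurentMul (shiftLaurent h.choose)⁻¹ (substInner (act2 h.choose F))
  else 0

theorem inv_shiftLaurent_spec {p : MvPolynomial (Fin 2) ℂ} (hp : p ≠ 0) {F : ℤ → ℤ → W}
    (hF : F ∈ iterLaurent W) : laurentMul (shiftLaurent p)⁻¹ F ∈ iterLaurent W ∧
      act2 (shiftHom p) (laurentMul (shiftLaurent p)⁻¹ F) = F := by
  have h := laurentMul_mem (shiftLaurent p)⁻¹ hF
  refine ⟨h, ?_⟩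
  have e : shiftLaurent p * (shiftLaurent p)⁻¹ = 1 :=
    mul_inv_cancel₀ (G₀ := Laurent2) (shiftLaurent_ne_zero hp)
  rw [← laurentMul_polyLaurent _ h, ← shiftLaurent_eq, ← laurentMul_mul _ _ hF, e]
  exact laurentMul_one hF

theorem YSer_mem (F : ℤ → ℤ → W) : YSer F ∈ iterLaurent W := by
  unfold YSer
  split_ifs with h
  · exact (inv_shiftLaurent_spec h.choose_spec.1 (substInner_mem h.choose_spec.2)).1
  · exact zero_mem _

theorem shiftHom_ne_zero {p : MvPolynomial (Fin 2) ℂ} (hp : p ≠ 0) : shiftHom p ≠ 0 :=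
  fun h => hp (shiftHom_injective (by rw [h, map_zero]))

/-- The polynomial chosen in the definition does not matter: after cross multiplication both sides
are the substitution applied to the product of the two polynomials with F, and nonzero polynomials
cancel in W((x))((x₀)). -/
theorem YSer_spec {p : MvPolynomial (Fin 2) ℂ} {F : ℤ → ℤ → W}
    (hF : act2 p F ∈ bounded2 W) (hp : p ≠ 0) :
    act2 (shiftHom p) (YSer F) = substInner (act2 p F) := by
  have h : F ∈ clearable W := ⟨p, hp, hF⟩
  have hY : act2 (shiftHom h.choose) (YSer F) = substInner (act2 h.choose F) := by
    rw [YSer, dif_pos h]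
    exact (inv_shiftLaurent_spec h.choose_spec.1 (substInner_mem h.choose_spec.2)).2
  refine act2_cancel (shiftHom_ne_zero h.choose_spec.1) (iterLaurent_act _ (YSer_mem F))
    (substInner_mem hF) ?_
  rw [act2_comm, hY, ← substInner_act _ h.choose_spec.2, ← substInner_act _ hF, act2_comm]

/-- The defining equation has one solution in W((x))((x₀)). Each later property of `YSer` is proved
by exhibiting a candidate and verifying this equation. -/
theorem YSer_unique {p : MvPolynomial (Fin 2) ℂ} {F Y : ℤ → ℤ → W}
    (hF : act2 p F ∈ bounded2 W) (hp : p ≠ 0) (hY : Y ∈ iterLaurent W)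
    (h : act2 (shiftHom p) Y = substInner (act2 p F)) : YSer F = Y :=
  act2_cancel (shiftHom_ne_zero hp) (YSer_mem F) hY ((YSer_spec hF hp).trans h.symm)

theorem YSer_eq {p : MvPolynomial (Fin 2) ℂ} {F : ℤ → ℤ → W}
    (hF : act2 p F ∈ bounded2 W) (hp : p ≠ 0) :
    YSer F = laurentMul (shiftLaurent p)⁻¹ (substInner (act2 p F)) :=
  YSer_unique hF hp (inv_shiftLaurent_spec hp (substInner_mem hF)).1
    (inv_shiftLaurent_spec hp (substInner_mem hF)).2

theorem YSer_add {F G : ℤ → ℤ → W} (hF : F ∈ clearable W) (hG : G ∈ clearable W) :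
    YSer (F + G) = YSer F + YSer G := by
  obtain ⟨p, hp, hF⟩ := hF
  obtain ⟨q, hq, hG⟩ := hG
  have hF' : act2 (p * q) F ∈ bounded2 W := by
    rw [mul_comm, act2_mul]
    exact bounded2_act _ hF
  have hG' : act2 (p * q) G ∈ bounded2 W := by
    rw [act2_mul]
    exact bounded2_act _ hG
  have hpq := mul_ne_zero hp hq
  refine YSer_unique (p := p * q) (by rw [map_add]; exact add_mem hF' hG') hpq
    (add_mem (YSer_mem F) (YSer_mem G)) ?_
  rw [map_add, YSer_spec hF' hpq, YSer_spec hG' hpq, map_add, substInner_add hF' hG']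

theorem YSer_smul (c : ℂ) {F : ℤ → ℤ → W} (hF : F ∈ clearable W) :
    YSer (c • F) = c • YSer F := by
  obtain ⟨p, hp, hF⟩ := hF
  refine YSer_unique (p := p) (by rw [map_smul]; exact Submodule.smul_mem _ _ hF) hp
    (Submodule.smul_mem _ _ (YSer_mem F)) ?_
  rw [map_smul, YSer_spec hF hp, map_smul, substInner_smul]

theorem YSer_act (q : MvPolynomial (Fin 2) ℂ) {F : ℤ → ℤ → W} (hF : F ∈ clearable W) :
    YSer (act2 q F) = act2 (shiftHom q) (YSer F) := by
  obtain ⟨p, hp, hF⟩ := hF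
  refine YSer_unique (p := p) (by rw [act2_comm]; exact bounded2_act _ hF) hp
    (iterLaurent_act _ (YSer_mem F)) ?_
  rw [act2_comm, YSer_spec hF hp, act2_comm, substInner_act _ hF]

theorem YSer_of_bounded {F : ℤ → ℤ → W} (hF : F ∈ bounded2 W) : YSer F = substInner F := by
  have h : act2 1 F = F := by rw [map_one, Module.End.one_apply]
  refine YSer_unique (p := 1) (by rwa [h]) one_ne_zero (substInner_mem hF) ?_
  rw [map_one, map_one, Module.End.one_apply, Module.End.one_apply]

theorem YSer_post (g : W →ₗ[ℂ] W') {F : ℤ → ℤ → W} (hF : F ∈ clearable W) :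
    YSer (post2 g F) = post2 g (YSer F) := by
  obtain ⟨p, hp, hF⟩ := hF
  refine YSer_unique (p := p) (by rw [← post2_act]; exact bounded2_post g hF) hp
    (iterLaurent_post g (YSer_mem F)) ?_
  rw [← post2_act, YSer_spec hF hp, ← substInner_post g hF, post2_act]

/-- The bound is the x₀-order of p(x₀ + x, x)⁻¹, since the substituted factor has no negative powers
of x₀. It depends on p alone; with a p common to all vectors this becomes a_n b = 0 for n large. -/
theorem YSer_truncated {p : MvPolynomial (Fin 2) ℂ} (hp : p ≠ 0) : ∃ K : ℤ, ∀ F : ℤ → ℤ → W,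
    act2 p F ∈ bounded2 W → ∀ i < K, ∀ s, YSer F i s = 0 := by
  refine ⟨((shiftLaurent p)⁻¹ : Laurent2).order, fun F hF i hi s => ?_⟩
  rw [YSer_eq hF hp, laurentMul]
  refine finsum_eq_zero_of_forall_eq_zero fun ij => ?_
  rcases lt_or_ge (i - ij.1) 0 with h | h
  · rw [substInner_neg _ h, smul_zero]
  · have h0 : ((shiftLaurent p)⁻¹ : Laurent2).coeff ij.1 = 0 :=
      HahnSeries.coeff_eq_zero_of_lt_order (by omega)
    rw [Laurent2.coef, h0, HahnSeries.coeff_zero, zero_smul]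

/-- The substitution `F(α x₁, β x₂)`. -/
def scale2 (α β : ℂˣ) : (ℤ → ℤ → W) →ₗ[ℂ] (ℤ → ℤ → W) where
  toFun F := fun m n => ((α ^ m * β ^ n : ℂˣ) : ℂ) • F m n
  map_add' _ _ := by ext; simp
  map_smul' c _ := by
    ext m n
    simp only [Pi.smul_apply, RingHom.id_apply]
    exact smul_comm _ _ _

/-- The substitution `p(α x₁, β x₂)`. -/
def scaleHom (α β : ℂˣ) : MvPolynomial (Fin 2) ℂ →ₐ[ℂ] MvPolynomial (Fin 2) ℂ :=
  MvPolynomial.aeval ![C (α : ℂ) * X 0, C (β : ℂ) * X 1]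

theorem scale2_act (α β : ℂˣ) (p : MvPolynomial (Fin 2) ℂ) (F : ℤ → ℤ → W) :
    scale2 α β (act2 p F) = act2 (scaleHom α β p) (scale2 α β F) := by
  refine (act_intertwine act2 act2 (scaleHom α β) (⊤ : Submodule ℂ (ℤ → ℤ → W)) (scale2 α β)
    (fun _ _ _ _ => map_add _ _ _) (fun _ _ _ => map_smul _ _ _) (fun _ _ _ => trivial)
    (fun i F _ => ?_) p F trivial).2
  ext m n
  fin_cases i
  · have h : scaleHom α β (X ((fun i => i) (⟨0, by omega⟩ : Fin 2))) = C (α : ℂ) * X 0 := by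
      simp [scaleHom]
    rw [h, act2_mul, act2_C]
    simp only [scale2, LinearMap.coe_mk, AddHom.coe_mk, Pi.smul_apply, act2_X0, smul_smul]
    change _ • act2 (X 0) F m n = _
    rw [act2_X0, ← Units.val_mul]
    congr 2
    rw [zpow_sub_one]
    group
  · have h : scaleHom α β (X ((fun i => i) (⟨1, by omega⟩ : Fin 2))) = C (β : ℂ) * X 1 := by
      simp [scaleHom]
    rw [h, act2_mul, act2_C]
    simp only [scale2, LinearMap.coe_mk, AddHom.coe_mk, Pi.smul_apply, act2_X1, smul_smul]
    change _ • act2 (X 1) F m n = _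
    rw [act2_X1, ← Units.val_mul]
    congr 2
    rw [zpow_sub_one, mul_left_comm]
    congr 1
    group

theorem scaleHom_injective (α β : ℂˣ) : Function.Injective (scaleHom α β) := by
  have h : Function.LeftInverse (scaleHom α⁻¹ β⁻¹) (scaleHom α β) := by
    intro p
    have : (scaleHom α⁻¹ β⁻¹).comp (scaleHom α β) = AlgHom.id ℂ (MvPolynomial (Fin 2) ℂ) := by
      refine MvPolynomial.algHom_ext fun i => ?_
      fin_cases i
      · simp [scaleHom]
        rw [← mul_assoc, ← MvPolynomial.C_mul]
        simp
      · simp [scaleHom]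
        rw [← mul_assoc, ← MvPolynomial.C_mul]
        simp
    exact DFunLike.congr_fun this p
  exact h.injective

theorem scaleHom_ne_zero (α β : ℂˣ) {p : MvPolynomial (Fin 2) ℂ} (hp : p ≠ 0) :
    scaleHom α β p ≠ 0 := fun h => hp (scaleHom_injective α β (by rw [h, map_zero]))

theorem bounded2_scale (α β : ℂˣ) {F : ℤ → ℤ → W} (hF : F ∈ bounded2 W) :
    scale2 α β F ∈ bounded2 W := by
  obtain ⟨N, hN⟩ := hF
  exact ⟨N, fun m n h => by simp [scale2, hN m n h]⟩

theorem iterLaurent_scale (α β : ℂˣ) {F : ℤ → ℤ → W} (hF : F ∈ iterLaurent W) :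
    scale2 α β F ∈ iterLaurent W := by
  obtain ⟨⟨N, hN⟩, h⟩ := hF
  refine ⟨⟨N, fun m hm n => by simp [scale2, hN m hm n]⟩, fun m => ?_⟩
  obtain ⟨K, hK⟩ := h m
  exact ⟨K, fun n hn => by simp [scale2, hK n hn]⟩

/-- The substitution preserves total degree, so it commutes with scaling provided that both
variables are scaled by the same α. -/
theorem substInner_scale (α : ℂˣ) (F : ℤ → ℤ → W) :
    substInner (scale2 α α F) = scale2 α α (substInner F) := by
  ext i s
  rcases lt_or_ge i 0 with hi | hi
  · simp [scale2, substInner_neg _ hi]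
  · lift i to ℕ using hi
    simp only [scale2, LinearMap.coe_mk, AddHom.coe_mk]
    rw [substInner_natCast, substInner_natCast, smul_finsum]
    refine finsum_congr fun m => ?_
    rw [smul_comm, ← zpow_add, ← zpow_add, add_sub_cancel, add_comm s]

theorem YSer_scale (α : ℂˣ) {F : ℤ → ℤ → W} (hF : F ∈ clearable W) :
    YSer (scale2 α α F) = scale2 α α (YSer F) := by
  obtain ⟨p, hp, hF⟩ := hF
  refine YSer_unique (p := scaleHom α α p) (by rw [← scale2_act]; exact bounded2_scale _ _ hF)
    (scaleHom_ne_zero α α hp) (iterLaurent_scale _ _ (YSer_mem F)) ?_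
  have h : shiftHom (scaleHom α α p) = scaleHom α α (shiftHom p) := by
    have : shiftHom.comp (scaleHom α α) = (scaleHom α α).comp shiftHom := by
      refine MvPolynomial.algHom_ext fun i => ?_
      fin_cases i <;> simp [scaleHom, shiftHom, mul_add]
    exact DFunLike.congr_fun this p
  rw [h, ← scale2_act, YSer_spec hF hp, ← substInner_scale, scale2_act]

end YSer

/-! ### The products `a(x)_n b(x)` -/

section Products

variable {W : Type*} [AddCommGroup W] [Module ℂ W]

theorem QuasiCompatible.exists_forall {a b : E W} (h : QuasiCompatible a b) :
    ∃ p : MvPolynomial (Fin 2) ℂ, p ≠ 0 ∧ ∀ w, act2 p (prodSeries a b w) ∈ bounded2 W := by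
  obtain ⟨p, hp, h⟩ := h
  refine ⟨p, hp, fun w => ?_⟩
  rw [act2_apply]
  exact h w

theorem QuasiCompatible.clearable {a b : E W} (h : QuasiCompatible a b) (w : W) :
    prodSeries a b w ∈ clearable W := by
  obtain ⟨p, hp, h⟩ := h.exists_forall
  exact ⟨p, hp, h w⟩

theorem prodSeries_add (a b : E W) (v w : W) :
    prodSeries a b (v + w) = prodSeries a b v + prodSeries a b w := by
  ext m n
  simp [prodSeries]

theorem prodSeries_smul (a b : E W) (c : ℂ) (w : W) :
    prodSeries a b (c • w) = c • prodSeries a b w := by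
  ext m n
  simp [prodSeries]

open Classical in
/-- The product `a(x)_n b(x)` of a quasi compatible pair. -/
def nprod (a b : E W) (n : ℤ) : E W :=
  if h : QuasiCompatible a b then
    { toFun := fun w => HahnSeries.ofSuppBddBelow (YSer (prodSeries a b w) (-n - 1)) (by
        obtain ⟨K, hK⟩ := (YSer_mem (prodSeries a b w)).2 (-n - 1)
        exact ⟨K, fun s hs => not_lt.1 fun h => hs (hK s h)⟩)
      map_add' := fun v w => by
        ext s
        simp only [prodSeries_add, YSer_add (h.clearable v) (h.clearable w)]
        rfl
      map_smul' := fun c w => by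
        ext s
        simp only [prodSeries_smul, YSer_smul c (h.clearable w)]
        rfl }
  else 0

theorem nprod_coeff {a b : E W} (h : QuasiCompatible a b) (n : ℤ) (w : W) (s : ℤ) :
    (nprod a b n w).coeff s = YSer (prodSeries a b w) (-n - 1) s := by
  rw [nprod, dif_pos h]
  rfl

theorem nprod_coeff' {a b : E W} (h : QuasiCompatible a b) (i : ℤ) (w : W) (s : ℤ) :
    (nprod a b (-i - 1) w).coeff s = YSer (prodSeries a b w) i s := by
  rw [nprod_coeff h]
  congr 1
  ring

theorem isNthProduct_nprod {a b : E W} (h : QuasiCompatible a b) (n : ℤ) :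
    IsNthProduct a b n (nprod a b n) := by
  refine ⟨h, fun p hp hcl w s => ?_⟩
  have hb : act2 p (prodSeries a b w) ∈ bounded2 W := by
    rw [act2_apply]
    exact hcl w
  rw [nprod_coeff h, YSer_eq hb hp, act2_apply]
  rfl

/-- Needed for minimality: the products that a closed subspace is known to contain are the values of
`nprod`. -/
theorem IsNthProduct.eq_nprod {a b c : E W} {n : ℤ} (h : IsNthProduct a b n c) :
    c = nprod a b n := by
  obtain ⟨p, hp, hcl⟩ := h.1
  ext w s
  exact (h.2 p hp hcl w s).trans ((isNthProduct_nprod h.1 n).2 p hp hcl w s).symm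

theorem nprod_truncated {a b : E W} (h : QuasiCompatible a b) :
    ∃ K : ℤ, ∀ i < K, nprod a b (-i - 1) = 0 := by
  obtain ⟨p, hp, hcl⟩ := h.exists_forall
  obtain ⟨K, hK⟩ := YSer_truncated (W := W) hp
  refine ⟨K, fun i hi => ?_⟩
  ext w s
  rw [nprod_coeff' h, hK _ (hcl w) i hi s]
  rfl

/-! ### Bilinearity of the products. -/

theorem prodSeries_add_left (a a' b : E W) (w : W) :
    prodSeries (a + a') b w = prodSeries a b w + prodSeries a' b w := by
  ext m n
  simp [prodSeries]

theorem prodSeries_add_right (a b b' : E W) (w : W) :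
    prodSeries a (b + b') w = prodSeries a b w + prodSeries a b' w := by
  ext m n
  simp [prodSeries]

theorem prodSeries_smul_left (a b : E W) (c : ℂ) (w : W) :
    prodSeries (c • a) b w = c • prodSeries a b w := by
  ext m n
  simp [prodSeries]

theorem prodSeries_smul_right (a b : E W) (c : ℂ) (w : W) :
    prodSeries a (c • b) w = c • prodSeries a b w := by
  ext m n
  simp [prodSeries]

theorem nprod_add_left {a a' b : E W} (h : QuasiCompatible a b) (h' : QuasiCompatible a' b)
    (h'' : QuasiCompatible (a + a') b) (n : ℤ) :
    nprod (a + a') b n = nprod a b n + nprod a' b n := by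
  ext w s
  rw [nprod_coeff h'', prodSeries_add_left, YSer_add (h.clearable w) (h'.clearable w)]
  simp [nprod_coeff h, nprod_coeff h']

theorem nprod_add_right {a b b' : E W} (h : QuasiCompatible a b) (h' : QuasiCompatible a b')
    (h'' : QuasiCompatible a (b + b')) (n : ℤ) :
    nprod a (b + b') n = nprod a b n + nprod a b' n := by
  ext w s
  rw [nprod_coeff h'', prodSeries_add_right, YSer_add (h.clearable w) (h'.clearable w)]
  simp [nprod_coeff h, nprod_coeff h']

theorem nprod_smul_left {a b : E W} {c : ℂ} (h : QuasiCompatible a b)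
    (h' : QuasiCompatible (c • a) b) (n : ℤ) : nprod (c • a) b n = c • nprod a b n := by
  ext w s
  rw [nprod_coeff h', prodSeries_smul_left, YSer_smul c (h.clearable w)]
  simp [nprod_coeff h]

theorem nprod_smul_right {a b : E W} {c : ℂ} (h : QuasiCompatible a b)
    (h' : QuasiCompatible a (c • b)) (n : ℤ) : nprod a (c • b) n = c • nprod a b n := by
  ext w s
  rw [nprod_coeff h', prodSeries_smul_right, YSer_smul c (h.clearable w)]
  simp [nprod_coeff h]

/-! ### Products with the vacuum 1_W. -/

@[simp] theorem oneE_coeff (w : W) (m : ℤ) : (oneE W w).coeff m = if m = 0 then w else 0 := by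
  change (HahnSeries.single (0 : ℤ) w).coeff m = _
  simp [HahnSeries.coeff_single]

theorem laurent_lower (F : LaurentSeries W) : ∃ N, ∀ m < N, F.coeff m = 0 :=
  ⟨F.order, fun _ hm => HahnSeries.coeff_eq_zero_of_lt_order hm⟩

theorem bounded2_one_left (b : E W) (w : W) : prodSeries (oneE W) b w ∈ bounded2 W := by
  obtain ⟨N, hN⟩ := laurent_lower (b w)
  refine ⟨min N 0, fun m n h => ?_⟩
  rw [prodSeries, oneE_coeff]
  split_ifs with hm
  · exact hN n (by omega)
  · rfl

theorem bounded2_one_right (a : E W) (w : W) : prodSeries a (oneE W) w ∈ bounded2 W := by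
  obtain ⟨N, hN⟩ := laurent_lower (a w)
  refine ⟨min N 0, fun m n h => ?_⟩
  rw [prodSeries, oneE_coeff]
  split_ifs with hn
  · exact hN m (by omega)
  · simp

theorem quasiCompatible_of_bounded {a b : E W} (h : ∀ w, prodSeries a b w ∈ bounded2 W) :
    QuasiCompatible a b := by
  refine ⟨1, one_ne_zero, fun w => ?_⟩
  rw [← act2_apply, map_one, Module.End.one_apply]
  exact h w

theorem nprod_one_left (b : E W) (i : ℤ) :
    nprod (oneE W) b (-i - 1) = if i = 0 then b else 0 := by
  ext w s
  rw [nprod_coeff' (quasiCompatible_of_bounded (bounded2_one_left b)),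
    YSer_of_bounded (bounded2_one_left b w)]
  rcases lt_or_ge i 0 with hi | hi
  · rw [substInner_neg _ hi, if_neg (by omega)]
    rfl
  · lift i to ℕ using hi
    -- Only x₁⁰ occurs in 1_W(x₁)b(x)w, and binom(0, i) = 0 for i > 0.
    rw [substInner_natCast, finsum_eq_single _ 0]
    · rcases Nat.eq_zero_or_pos i with rfl | hi
      · simp [prodSeries]
      · rw [Ring.choose_zero_pos ℤ hi, zero_smul, if_neg (by omega)]
        rfl
    · intro m hm
      simp [prodSeries, hm]

theorem nprod_one_right (a : E W) {i : ℤ} (hi : i < 0) : nprod a (oneE W) (-i - 1) = 0 := by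
  ext w s
  rw [nprod_coeff' (quasiCompatible_of_bounded (bounded2_one_right a)),
    YSer_of_bounded (bounded2_one_right a w), substInner_neg _ hi]
  rfl

/-- Besides the creation property, the equation a = a₋₁1_W makes the chain of `stage`s increasing.
-/
theorem nprod_one_right_zero (a : E W) : nprod a (oneE W) (-1) = a := by
  ext w s
  have := nprod_coeff' (quasiCompatible_of_bounded (bounded2_one_right a)) 0 w s
  rw [YSer_of_bounded (bounded2_one_right a w)] at this
  rw [neg_zero, zero_sub] at this
  rw [this, ← Nat.cast_zero, substInner_natCast, finsum_eq_single _ s]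
  · simp [prodSeries]
  · intro m hm
    have : ¬ s - m = 0 := by omega
    simp [prodSeries, this]

/-! ### Products and the operators R_α. -/

theorem prodSeries_scale (α β : ℂˣ) (a b : E W) (w : W) :
    prodSeries (scale α a) (scale β b) w = scale2 α β (prodSeries a b w) := by
  ext m n
  simp [prodSeries, scale, scale2, smul_smul, mul_comm]

theorem QuasiCompatible.scale {a b : E W} (h : QuasiCompatible a b) (α β : ℂˣ) :
    QuasiCompatible (scale α a) (scale β b) := by
  obtain ⟨p, hp, h⟩ := h.exists_forall
  refine ⟨scaleHom α β p, scaleHom_ne_zero α β hp, fun w => ?_⟩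
  rw [prodSeries_scale, ← act2_apply, ← scale2_act]
  exact bounded2_scale α β (h w)

/-- `YSer_scale` scales x₀ together with x. On the coefficient of x₀^{-n-1} this produces α^{-n-1},
which the factor α^{n+1} compensates. -/
theorem scale_nprod {a b : E W} (h : QuasiCompatible a b) (α : ℂˣ) (n : ℤ) :
    scale α (nprod a b n) =
      ((α ^ (n + 1) : ℂˣ) : ℂ) • nprod (scale α a) (scale α b) n := by
  ext w s
  change ((α ^ s : ℂˣ) : ℂ) • (nprod a b n w).coeff s =
    ((α ^ (n + 1) : ℂˣ) : ℂ) • (nprod (scale α a) (scale α b) n w).coeff s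
  rw [nprod_coeff h, nprod_coeff (h.scale α α), prodSeries_scale, YSer_scale α (h.clearable w)]
  simp only [scale2, LinearMap.coe_mk, AddHom.coe_mk, smul_smul]
  rw [← Units.val_mul, ← zpow_add, ← zpow_add]
  congr 3
  ring

end Products

/-! ### Localization of spans at products of linear forms -/

section LocSpan

variable {σ τ M M' : Type*} [AddCommGroup M] [Module ℂ M] [AddCommGroup M'] [Module ℂ M']

/-- The generators `c`, `x_i` and `x_i - α x_j`, `α ∈ Γ`, of `linForms`. -/
def linFormGens (σ : Type*) (Γ : Subgroup ℂˣ) : Set (MvPolynomial σ ℂ) :=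
  {d | (∃ c : ℂ, c ≠ 0 ∧ d = C c) ∨ (∃ i, d = X i) ∨
    ∃ i j, i ≠ j ∧ ∃ α ∈ Γ, d = X i - C ((α : ℂˣ) : ℂ) * X j}

/-- The multiplicative monoid generated by the nonzero constants, the variables and the linear
forms `x_i - α x_j`, `α ∈ Γ`. -/
def linForms (σ : Type*) (Γ : Subgroup ℂˣ) : Submonoid (MvPolynomial σ ℂ) :=
  Submonoid.closure (linFormGens σ Γ)

theorem linForms_C (Γ : Subgroup ℂˣ) {c : ℂ} (hc : c ≠ 0) : (C c : MvPolynomial σ ℂ) ∈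
    linForms σ Γ := Submonoid.subset_closure (Or.inl ⟨c, hc, rfl⟩)

theorem linForms_X (Γ : Subgroup ℂˣ) (i : σ) : X i ∈ linForms σ Γ :=
  Submonoid.subset_closure (Or.inr (Or.inl ⟨i, rfl⟩))

theorem linForms_sub {Γ : Subgroup ℂˣ} {i j : σ} (hij : i ≠ j) {α : ℂˣ} (hα : α ∈ Γ) :
    X i - C (α : ℂ) * X j ∈ linForms σ Γ :=
  Submonoid.subset_closure (Or.inr (Or.inr ⟨i, j, hij, α, hα, rfl⟩))

theorem linForms_ne_zero {Γ : Subgroup ℂˣ} {d : MvPolynomial σ ℂ} (hd : d ∈ linForms σ Γ) :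
    d ≠ 0 := by
  induction hd using Submonoid.closure_induction with
  | mem d hd =>
    rcases hd with ⟨c, hc, rfl⟩ | ⟨i, rfl⟩ | ⟨i, j, hij, α, -, rfl⟩
    · simpa using hc
    · exact MvPolynomial.X_ne_zero i
    · intro h
      classical
      have := congrArg (MvPolynomial.eval (Pi.single i 1)) h
      simp [hij.symm] at this
  | one => exact one_ne_zero
  | mul d e _ _ hd he => exact mul_ne_zero hd he

theorem linForms_rename {Γ : Subgroup ℂˣ} {f : σ → τ} (hf : Function.Injective f)
    {d : MvPolynomial σ ℂ} (hd : d ∈ linForms σ Γ) : MvPolynomial.rename f d ∈ linForms τ Γ := by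
  induction hd using Submonoid.closure_induction with
  | mem d hd =>
    rcases hd with ⟨c, hc, rfl⟩ | ⟨i, rfl⟩ | ⟨i, j, hij, α, hα, rfl⟩
    · simpa using linForms_C Γ hc
    · simpa using linForms_X Γ (f i)
    · simpa using linForms_sub (hf.ne hij) hα
  | one => simp
  | mul d e _ _ hd he => simpa using mul_mem hd he

/-- The submodule generated by `S` over the polynomials, which act through `A`. -/
def polySpan (A : MvPolynomial σ ℂ →ₐ[ℂ] Module.End ℂ M) (S : Set M) : Submodule ℂ M :=
  Submodule.span ℂ {G | ∃ f, ∃ F ∈ S, G = A f F}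

theorem polySpan_act (A : MvPolynomial σ ℂ →ₐ[ℂ] Module.End ℂ M) (S : Set M)
    (p : MvPolynomial σ ℂ) {F : M} (hF : F ∈ polySpan A S) : A p F ∈ polySpan A S := by
  induction hF using Submodule.span_induction with
  | mem F hF =>
    obtain ⟨f, F, hF, rfl⟩ := hF
    exact Submodule.subset_span ⟨p * f, F, hF, by rw [map_mul, Module.End.mul_apply]⟩
  | zero => rw [map_zero]; exact zero_mem _
  | add F G _ _ hF hG => rw [map_add]; exact add_mem hF hG
  | smul c F _ hF => rw [map_smul]; exact Submodule.smul_mem _ _ hF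

/-- The elements that some product of linear forms maps to the submodule generated by `S`. -/
def locSpan (A : MvPolynomial σ ℂ →ₐ[ℂ] Module.End ℂ M) (Γ : Subgroup ℂˣ) (S : Set M) :
    Submodule ℂ M where
  carrier := {F | ∃ d ∈ linForms σ Γ, A d F ∈ polySpan A S}
  zero_mem' := ⟨1, one_mem _, by rw [map_zero]; exact zero_mem _⟩
  add_mem' := by
    rintro F G ⟨d, hd, hF⟩ ⟨e, he, hG⟩
    refine ⟨d * e, mul_mem hd he, ?_⟩
    rw [map_add, map_mul]
    refine add_mem ?_ (polySpan_act A S d hG)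
    rw [← map_mul, mul_comm, map_mul]
    exact polySpan_act A S e hF
  smul_mem' := by
    rintro c F ⟨d, hd, hF⟩
    exact ⟨d, hd, by rw [map_smul]; exact Submodule.smul_mem _ _ hF⟩

variable {A : MvPolynomial σ ℂ →ₐ[ℂ] Module.End ℂ M} {Γ : Subgroup ℂˣ} {S T : Set M}

theorem polySpan_le_locSpan : polySpan A S ≤ locSpan A Γ S := fun F hF =>
  ⟨1, one_mem _, by rwa [map_one]⟩

theorem subset_locSpan {F : M} (hF : F ∈ S) : F ∈ locSpan A Γ S :=
  polySpan_le_locSpan (Submodule.subset_span ⟨1, F, hF, by rw [map_one]; rfl⟩)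

theorem locSpan_act (p : MvPolynomial σ ℂ) {F : M} (hF : F ∈ locSpan A Γ S) :
    A p F ∈ locSpan A Γ S := by
  obtain ⟨d, hd, hF⟩ := hF
  refine ⟨d, hd, ?_⟩
  rw [← Module.End.mul_apply, ← map_mul, mul_comm, map_mul]
  exact polySpan_act A S p hF

theorem locSpan_of_act {d : MvPolynomial σ ℂ} (hd : d ∈ linForms σ Γ) {F : M}
    (hF : A d F ∈ locSpan A Γ S) : F ∈ locSpan A Γ S := by
  obtain ⟨e, he, hF⟩ := hF
  exact ⟨e * d, mul_mem he hd, by rwa [map_mul]⟩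

/-- A submodule that is stable under polynomials and saturated for products of linear forms. -/
structure IsSaturated (A : MvPolynomial σ ℂ →ₐ[ℂ] Module.End ℂ M) (Γ : Subgroup ℂˣ)
    (N : Submodule ℂ M) : Prop where
  act : ∀ p, ∀ F ∈ N, A p F ∈ N
  of_act : ∀ d ∈ linForms σ Γ, ∀ F, A d F ∈ N → F ∈ N

theorem locSpan_isSaturated : IsSaturated A Γ (locSpan A Γ S) :=
  ⟨fun p _ hF => locSpan_act p hF, fun _ hd _ hF => locSpan_of_act hd hF⟩

/-- The transport principle for all exchange arguments: a linear map that intertwines the polynomial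
actions along `s` needs to be controlled on `S` only. Polynomial combinations are handled by
stability of `N`, the linear forms by its saturation. -/
theorem map_mem_of_mem_locSpan {B : MvPolynomial τ ℂ →ₐ[ℂ] Module.End ℂ M'}
    {N : Submodule ℂ M'} (hN : IsSaturated B Γ N)
    (φ : M →ₗ[ℂ] M') (s : MvPolynomial σ ℂ →ₐ[ℂ] MvPolynomial τ ℂ)
    (hs : ∀ d ∈ linForms σ Γ, s d ∈ linForms τ Γ)
    (hφ : ∀ i F, φ (A (X i) F) = B (s (X i)) (φ F))
    (hS : ∀ F ∈ S, φ F ∈ N) {F : M} (hF : F ∈ locSpan A Γ S) : φ F ∈ N := by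
  have key : ∀ p F, φ (A p F) = B (s p) (φ F) := fun p F =>
    act_natural A (B.comp s) φ hφ p F
  obtain ⟨d, hd, hF⟩ := hF
  refine hN.of_act _ (hs d hd) _ ?_
  rw [← key]
  generalize A d F = G at hF
  induction hF using Submodule.span_induction with
  | mem F hF =>
    obtain ⟨f, F, hF, rfl⟩ := hF
    rw [key]
    exact hN.act _ _ (hS F hF)
  | zero => rw [map_zero]; exact zero_mem _
  | add F G _ _ hF hG => rw [map_add]; exact add_mem hF hG
  | smul c F _ hF => rw [map_smul]; exact Submodule.smul_mem _ _ hF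

theorem mem_of_mem_locSpan {N : Submodule ℂ M} (hN : IsSaturated A Γ N) (hS : S ⊆ N)
    {F : M} (hF : F ∈ locSpan A Γ S) : F ∈ N :=
  map_mem_of_mem_locSpan hN LinearMap.id (AlgHom.id ℂ _) (fun _ h => h) (fun _ _ => rfl)
    hS hF

theorem locSpan_mono (h : S ⊆ T) : locSpan A Γ S ≤ locSpan A Γ T := fun _ hF =>
  mem_of_mem_locSpan locSpan_isSaturated (fun _ hG => subset_locSpan (h hG)) hF

end LocSpan

/-! ### Exchange relations -/

section Exchange

variable {W : Type*} [AddCommGroup W] [Module ℂ W]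

/-- The coefficient of `x ^ m` in `a(x)`. -/
def coeffEnd (a : E W) (m : ℤ) : Module.End ℂ W where
  toFun w := (a w).coeff m
  map_add' _ _ := by simp
  map_smul' _ _ := by simp

/-- The series `a(x₁) c(x₂)`. -/
def opProd (a c : E W) : ℤ → ℤ → Module.End ℂ W := fun m n => coeffEnd a m * coeffEnd c n

/-- The series `c(x₂) a(x₁)`. -/
def opProdRev (a c : E W) : ℤ → ℤ → Module.End ℂ W := fun m n => coeffEnd c n * coeffEnd a m

/-- The exchange of the variables. -/
def swap2 {M : Type*} [AddCommGroup M] [Module ℂ M] : (ℤ → ℤ → M) →ₗ[ℂ] (ℤ → ℤ → M) where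
  toFun F := fun m n => F n m
  map_add' _ _ := rfl
  map_smul' _ _ := rfl

/-- Up to products of linear forms, `a(x₁) c(x₂)` is a combination of series `c'(x₂) a'(x₁)`. -/
def Exchange (Γ : Subgroup ℂˣ) (A C : Set (E W)) : Prop :=
  ∀ a ∈ A, ∀ c ∈ C, opProd a c ∈ locSpan act2 Γ {F | ∃ a' ∈ A, ∃ c' ∈ C, F = opProdRev a' c'}

/-- Up to products of linear forms, `c(x₂) a(x₁)` is a combination of series `a'(x₁) c'(x₂)`. -/
def ExchangeRev (Γ : Subgroup ℂˣ) (A C : Set (E W)) : Prop :=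
  ∀ a ∈ A, ∀ c ∈ C, opProdRev a c ∈ locSpan act2 Γ {F | ∃ a' ∈ A, ∃ c' ∈ C, F = opProd a' c'}

theorem swap2_mem_locSpan {M : Type*} [AddCommGroup M] [Module ℂ M] {Γ : Subgroup ℂˣ}
    {S T : Set (ℤ → ℤ → M)} (hST : ∀ F ∈ S, swap2 F ∈ T) {F : ℤ → ℤ → M}
    (hF : F ∈ locSpan act2 Γ S) : swap2 F ∈ locSpan act2 Γ T := by
  refine map_mem_of_mem_locSpan locSpan_isSaturated swap2
    (MvPolynomial.rename (Equiv.swap 0 1))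
    (fun d hd => linForms_rename (Equiv.injective _) hd) (fun i F => ?_)
    (fun F hF => subset_locSpan (hST F hF)) hF
  ext m n
  rw [MvPolynomial.rename_X]
  fin_cases i
  · change act2 (X 0) F n m = act2 (X (Equiv.swap 0 1 0)) (swap2 F) m n
    rw [Equiv.swap_apply_left, act2_X0, act2_X1]
    rfl
  · change act2 (X 1) F n m = act2 (X (Equiv.swap 0 1 1)) (swap2 F) m n
    rw [Equiv.swap_apply_right, act2_X0, act2_X1]
    rfl

/-- Exchanging the names of x₁ and x₂ interchanges the roles of the two sets. In this way an
extension of the first set also yields one of the second. -/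
theorem Exchange.rev {Γ : Subgroup ℂˣ} {A C : Set (E W)} (h : Exchange Γ A C) :
    ExchangeRev Γ C A := by
  intro c hc a ha
  refine swap2_mem_locSpan ?_ (h a ha c hc)
  rintro _ ⟨a', ha', c', hc', rfl⟩
  exact ⟨c', hc', a', ha', rfl⟩

theorem ExchangeRev.rev {Γ : Subgroup ℂˣ} {A C : Set (E W)} (h : ExchangeRev Γ A C) :
    Exchange Γ C A := by
  intro c hc a ha
  refine swap2_mem_locSpan ?_ (h a ha c hc)
  rintro _ ⟨a', ha', c', hc', rfl⟩
  exact ⟨c', hc', a', ha', rfl⟩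

theorem coeffEnd_add (a b : E W) (m : ℤ) : coeffEnd (a + b) m = coeffEnd a m + coeffEnd b m := by
  ext w
  simp [coeffEnd]

theorem coeffEnd_smul (c : ℂ) (a : E W) (m : ℤ) : coeffEnd (c • a) m = c • coeffEnd a m := by
  ext w
  simp [coeffEnd]

/-- `a ↦ a(x₁) c(x₂)` -/
def opProdLeft (c : E W) : E W →ₗ[ℂ] (ℤ → ℤ → Module.End ℂ W) where
  toFun a := opProd a c
  map_add' a b := by ext m n; simp [opProd, coeffEnd_add, add_mul]
  map_smul' r a := by ext m n; simp [opProd, coeffEnd_smul]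

/-- `c ↦ a(x₁) c(x₂)` -/
def opProdRight (a : E W) : E W →ₗ[ℂ] (ℤ → ℤ → Module.End ℂ W) where
  toFun c := opProd a c
  map_add' a b := by ext m n; simp [opProd, coeffEnd_add, mul_add]
  map_smul' r a := by ext m n; simp [opProd, coeffEnd_smul]

/-- The products are bilinear in the two fields and `locSpan` is a subspace, so one argument is
extended after the other. -/
theorem Exchange.span {Γ : Subgroup ℂˣ} {A C : Set (E W)} (h : Exchange Γ A C) :
    Exchange Γ (Submodule.span ℂ A : Set (E W)) (Submodule.span ℂ C : Set (E W)) := by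
  set N := locSpan act2 Γ {F | ∃ a' ∈ (Submodule.span ℂ A : Set (E W)),
    ∃ c' ∈ (Submodule.span ℂ C : Set (E W)), F = opProdRev a' c'} with hN
  have h1 : ∀ a ∈ A, ∀ c ∈ C, opProd a c ∈ N := by
    intro a ha c hc
    refine locSpan_mono ?_ (h a ha c hc)
    rintro _ ⟨a', ha', c', hc', rfl⟩
    exact ⟨a', Submodule.subset_span ha', c', Submodule.subset_span hc', rfl⟩
  have h2 : ∀ c ∈ C, Submodule.span ℂ A ≤ N.comap (opProdLeft c) := fun c hc =>
    Submodule.span_le.2 fun a ha => h1 a ha c hc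
  have h3 : ∀ a ∈ Submodule.span ℂ A, Submodule.span ℂ C ≤ N.comap (opProdRight a) :=
    fun a ha => Submodule.span_le.2 fun c hc => h2 c hc ha
  exact fun a ha c hc => h3 a ha hc

/-! ### Series with three factors -/

/-- The series `a(x₁) b(x₂) c(x₃)`. -/
def opTriple (a b c : E W) : ℤ → ℤ → ℤ → Module.End ℂ W :=
  fun m n t => coeffEnd a m * coeffEnd b n * coeffEnd c t

/-- The series `c(x₃) a(x₁) b(x₂)`. -/
def opTripleRot (a b c : E W) : ℤ → ℤ → ℤ → Module.End ℂ W :=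
  fun m n t => coeffEnd c t * coeffEnd a m * coeffEnd b n

/-- Multiplication of a series in `x₂, x₃` by `a(x₁)` from the left. -/
def mulLeft3 (a : E W) :
    (ℤ → ℤ → Module.End ℂ W) →ₗ[ℂ] (ℤ → ℤ → ℤ → Module.End ℂ W) where
  toFun F := fun m n t => coeffEnd a m * F n t
  map_add' _ _ := by ext; simp [mul_add]
  map_smul' _ _ := by ext; simp

/-- Multiplication of a series in `x₁, x₃` by `b(x₂)` from the right. -/
def mulRight3 (b : E W) :
    (ℤ → ℤ → Module.End ℂ W) →ₗ[ℂ] (ℤ → ℤ → ℤ → Module.End ℂ W) where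
  toFun F := fun m n t => F m t * coeffEnd b n
  map_add' _ _ := by ext; simp [add_mul]
  map_smul' _ _ := by ext; simp

/-- Multiplication of a series in `x₁, x₂` by `c(x₃)` from the left. -/
def mulThird3 (c : E W) :
    (ℤ → ℤ → Module.End ℂ W) →ₗ[ℂ] (ℤ → ℤ → ℤ → Module.End ℂ W) where
  toFun F := fun m n t => coeffEnd c t * F m n
  map_add' _ _ := by ext; simp [mul_add]
  map_smul' _ _ := by ext; simp

theorem injective_vec2 {α : Type*} {a b : α} (h : a ≠ b) : Function.Injective ![a, b] := by
  intro i j hij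
  fin_cases i <;> fin_cases j <;> simp_all [eq_comm]

/-- Multiplying by an operator that involves only x₁ does not disturb forms in x₂, x₃; renamed
injectively, these remain linear forms in three variables. -/
theorem mulLeft3_mem {Γ : Subgroup ℂˣ} (a : E W) {S : Set (ℤ → ℤ → Module.End ℂ W)}
    {N : Submodule ℂ (ℤ → ℤ → ℤ → Module.End ℂ W)} (hN : IsSaturated act3 Γ N)
    (hST : ∀ F ∈ S, mulLeft3 a F ∈ N) {F : ℤ → ℤ → Module.End ℂ W}
    (hF : F ∈ locSpan act2 Γ S) : mulLeft3 a F ∈ N := by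
  refine map_mem_of_mem_locSpan hN (mulLeft3 a) (MvPolynomial.rename ![1, 2])
    (fun d hd => linForms_rename (injective_vec2 (by decide)) hd) (fun i F => ?_) hST hF
  ext m n t : 3
  rw [MvPolynomial.rename_X]
  fin_cases i
  · exact (congrArg (coeffEnd a m * ·) (act2_X0 F n t)).trans (act3_X1 (mulLeft3 a F) m n t).symm
  · exact (congrArg (coeffEnd a m * ·) (act2_X1 F n t)).trans (act3_X2 (mulLeft3 a F) m n t).symm

theorem mulRight3_mem {Γ : Subgroup ℂˣ} (b : E W) {S : Set (ℤ → ℤ → Module.End ℂ W)}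
    {N : Submodule ℂ (ℤ → ℤ → ℤ → Module.End ℂ W)} (hN : IsSaturated act3 Γ N)
    (hST : ∀ F ∈ S, mulRight3 b F ∈ N) {F : ℤ → ℤ → Module.End ℂ W}
    (hF : F ∈ locSpan act2 Γ S) : mulRight3 b F ∈ N := by
  refine map_mem_of_mem_locSpan hN (mulRight3 b) (MvPolynomial.rename ![0, 2])
    (fun d hd => linForms_rename (injective_vec2 (by decide)) hd) (fun i F => ?_) hST hF
  ext m n t : 3
  rw [MvPolynomial.rename_X]
  fin_cases i
  · exact (congrArg (· * coeffEnd b n) (act2_X0 F m t)).trans (act3_X0 (mulRight3 b F) m n t).symm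
  · exact (congrArg (· * coeffEnd b n) (act2_X1 F m t)).trans (act3_X2 (mulRight3 b F) m n t).symm

theorem mulThird3_mem {Γ : Subgroup ℂˣ} (c : E W) {S : Set (ℤ → ℤ → Module.End ℂ W)}
    {N : Submodule ℂ (ℤ → ℤ → ℤ → Module.End ℂ W)} (hN : IsSaturated act3 Γ N)
    (hST : ∀ F ∈ S, mulThird3 c F ∈ N) {F : ℤ → ℤ → Module.End ℂ W}
    (hF : F ∈ locSpan act2 Γ S) : mulThird3 c F ∈ N := by
  refine map_mem_of_mem_locSpan hN (mulThird3 c) (MvPolynomial.rename ![0, 1])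
    (fun d hd => linForms_rename (injective_vec2 (by decide)) hd) (fun i F => ?_) hST hF
  ext m n t : 3
  rw [MvPolynomial.rename_X]
  fin_cases i
  · exact (congrArg (coeffEnd c t * ·) (act2_X0 F m n)).trans (act3_X0 (mulThird3 c F) m n t).symm
  · exact (congrArg (coeffEnd c t * ·) (act2_X1 F m n)).trans (act3_X1 (mulThird3 c F) m n t).symm

/-- The field in x₃ passes to the left one factor at a time: a b c → a c' b' → c'' a' b'. -/
theorem Exchange.triple {Γ : Subgroup ℂˣ} {A C : Set (E W)} (h : Exchange Γ A C) {a b c : E W}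
    (ha : a ∈ A) (hb : b ∈ A) (hc : c ∈ C) : opTriple a b c ∈ locSpan act3 Γ
      {F | ∃ a' ∈ A, ∃ b' ∈ A, ∃ c' ∈ C, F = opTripleRot a' b' c'} := by
  have h1 : opTriple a b c = mulLeft3 a (opProd b c) := by
    ext m n t : 3
    exact mul_assoc _ _ _
  rw [h1]
  refine mulLeft3_mem a locSpan_isSaturated ?_ (h b hb c hc)
  rintro _ ⟨b', hb', c', hc', rfl⟩
  have h2 : mulLeft3 a (opProdRev b' c') = mulRight3 b' (opProd a c') := by
    ext m n t : 3
    exact (mul_assoc _ _ _).symm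
  rw [h2]
  refine mulRight3_mem b' locSpan_isSaturated ?_ (h a ha c' hc')
  rintro _ ⟨a', ha', c'', hc'', rfl⟩
  exact subset_locSpan ⟨a', ha', b', hb', c'', hc'', rfl⟩

theorem ExchangeRev.triple {Γ : Subgroup ℂˣ} {A C : Set (E W)} (h : ExchangeRev Γ A C)
    {a b c : E W} (ha : a ∈ A) (hb : b ∈ A) (hc : c ∈ C) : opTripleRot a b c ∈ locSpan act3 Γ
      {F | ∃ a' ∈ A, ∃ b' ∈ A, ∃ c' ∈ C, F = opTriple a' b' c'} := by
  have h1 : opTripleRot a b c = mulRight3 b (opProdRev a c) := rfl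
  rw [h1]
  refine mulRight3_mem b locSpan_isSaturated ?_ (h a ha c hc)
  rintro _ ⟨a', ha', c', hc', rfl⟩
  have h2 : mulRight3 b (opProd a' c') = mulLeft3 a' (opProdRev b c') := by
    ext m n t : 3
    exact mul_assoc _ _ _
  rw [h2]
  refine mulLeft3_mem a' locSpan_isSaturated ?_ (h b hb c' hc')
  rintro _ ⟨b', hb', c'', hc'', rfl⟩
  refine subset_locSpan ⟨a', ha', b', hb', c'', hc'', ?_⟩
  ext m n t : 3
  exact (mul_assoc _ _ _).symm

end Exchange

/-! ### The series `Y_E` in two of three variables -/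

section Slices

variable {W W' : Type*} [AddCommGroup W] [Module ℂ W] [AddCommGroup W'] [Module ℂ W']

theorem YSer_X0 {F : ℤ → ℤ → W} (hF : F ∈ clearable W) :
    YSer (act2 (X 0) F) = act2 (X 0 + X 1) (YSer F) := by
  rw [YSer_act _ hF, shiftHom, MvPolynomial.aeval_X]
  rfl

theorem YSer_X1 {F : ℤ → ℤ → W} (hF : F ∈ clearable W) :
    YSer (act2 (X 1) F) = act2 (X 1) (YSer F) := by
  rw [YSer_act _ hF, shiftHom, MvPolynomial.aeval_X]
  rfl

theorem act2_X0_add_X1 (F : ℤ → ℤ → W) (m n : ℤ) :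
    act2 (X 0 + X 1) F m n = F (m - 1) n + F m (n - 1) := by
  rw [map_add, LinearMap.add_apply, Pi.add_apply, Pi.add_apply, act2_X0, act2_X1]

/-- The series in three variables that are clearable in the first and second variable. -/
def clearable01 (W : Type*) [AddCommGroup W] [Module ℂ W] : Submodule ℂ (ℤ → ℤ → ℤ → W) where
  carrier := {F | ∀ t, (fun m n => F m n t) ∈ clearable W}
  zero_mem' := fun _ => zero_mem (clearable W)
  add_mem' := fun hF hG t => add_mem (hF t) (hG t)
  smul_mem' := fun c _ hF t => Submodule.smul_mem _ c (hF t)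

/-- The series in three variables that are clearable in the first and third variable. -/
def clearable02 (W : Type*) [AddCommGroup W] [Module ℂ W] : Submodule ℂ (ℤ → ℤ → ℤ → W) where
  carrier := {F | ∀ n, (fun m t => F m n t) ∈ clearable W}
  zero_mem' := fun _ => zero_mem (clearable W)
  add_mem' := fun hF hG t => add_mem (hF t) (hG t)
  smul_mem' := fun c _ hF t => Submodule.smul_mem _ c (hF t)

/-- The series in three variables that are clearable in the second and third variable. -/
def clearable12 (W : Type*) [AddCommGroup W] [Module ℂ W] : Submodule ℂ (ℤ → ℤ → ℤ → W) where
  carrier := {F | ∀ m, (fun n t => F m n t) ∈ clearable W}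
  zero_mem' := fun _ => zero_mem (clearable W)
  add_mem' := fun hF hG t => add_mem (hF t) (hG t)
  smul_mem' := fun c _ hF t => Submodule.smul_mem _ c (hF t)

/-- `YSer` in the first and second variable. -/
def YSer01 (F : ℤ → ℤ → ℤ → W) : ℤ → ℤ → ℤ → W :=
  fun i s t => YSer (fun m n => F m n t) i s

/-- `YSer` in the first and third variable. -/
def YSer02 (F : ℤ → ℤ → ℤ → W) : ℤ → ℤ → ℤ → W :=
  fun i n s => YSer (fun m t => F m n t) i s

/-- `YSer` in the second and third variable. -/
def YSer12 (F : ℤ → ℤ → ℤ → W) : ℤ → ℤ → ℤ → W :=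
  fun m i s => YSer (fun n t => F m n t) i s

/-- The substitution `x₁ ↦ x₁ + x₂`. -/
def sub01 : MvPolynomial (Fin 3) ℂ →ₐ[ℂ] MvPolynomial (Fin 3) ℂ :=
  MvPolynomial.aeval ![X 0 + X 1, X 1, X 2]

/-- The substitution `x₁ ↦ x₁ + x₃`. -/
def sub02 : MvPolynomial (Fin 3) ℂ →ₐ[ℂ] MvPolynomial (Fin 3) ℂ :=
  MvPolynomial.aeval ![X 0 + X 2, X 1, X 2]

/-- The substitution `x₂ ↦ x₂ + x₃`. -/
def sub12 : MvPolynomial (Fin 3) ℂ →ₐ[ℂ] MvPolynomial (Fin 3) ℂ :=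
  MvPolynomial.aeval ![X 0, X 1 + X 2, X 2]

/-- The variable x₃ is a spectator: its powers index independent two-variable series. The other two
variables are governed by `YSer_X0` and `YSer_X1`. -/
theorem YSer01_act (p : MvPolynomial (Fin 3) ℂ) {F : ℤ → ℤ → ℤ → W} (hF : F ∈ clearable01 W) :
    act3 p F ∈ clearable01 W ∧ YSer01 (act3 p F) = act3 (sub01 p) (YSer01 F) := by
  refine act_intertwine act3 act3 sub01 (clearable01 W) YSer01 (fun F hF G hG => ?_)
    (fun c F hF => ?_) (fun i F hF t => ?_) (fun i F hF => ?_) p F hF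
  · ext i s t
    exact congrFun (congrFun (YSer_add (hF t) (hG t)) i) s
  · ext i s t
    exact congrFun (congrFun (YSer_smul c (hF t)) i) s
  · fin_cases i
    · convert clearable_X 0 _ (hF t) using 1
      ext m n
      exact (act3_X0 F m n t).trans (by rw [act2_X0])
    · convert clearable_X 1 _ (hF t) using 1
      ext m n
      exact (act3_X1 F m n t).trans (by rw [act2_X1])
    · convert hF (t - 1) using 1
      ext m n
      exact act3_X2 F m n t
  · ext j s t
    fin_cases i
    · have h : (fun m n => act3 (X 0) F m n t) = act2 (X 0) fun m n => F m n t := by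
        ext m n
        rw [act3_X0, act2_X0]
      have h' : sub01 (X 0) = X 0 + X 1 := by simp [sub01]
      change YSer (fun m n => act3 (X 0) F m n t) j s = act3 (sub01 (X 0)) (YSer01 F) j s t
      rw [h, YSer_X0 (hF t), h', act2_X0_add_X1, map_add, LinearMap.add_apply, Pi.add_apply,
        Pi.add_apply, Pi.add_apply, act3_X0, act3_X1]
      rfl
    · have h : (fun m n => act3 (X 1) F m n t) = act2 (X 1) fun m n => F m n t := by
        ext m n
        rw [act3_X1, act2_X1]
      have h' : sub01 (X 1) = X 1 := by simp [sub01]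
      change YSer (fun m n => act3 (X 1) F m n t) j s = act3 (sub01 (X 1)) (YSer01 F) j s t
      rw [h, YSer_X1 (hF t), h', act2_X1, act3_X1]
      rfl
    · have h' : sub01 (X 2) = X 2 := by simp [sub01]
      change YSer (fun m n => act3 (X 2) F m n t) j s = act3 (sub01 (X 2)) (YSer01 F) j s t
      rw [h', act3_X2]
      simp only [act3_X2]
      rfl

theorem YSer02_act (p : MvPolynomial (Fin 3) ℂ) {F : ℤ → ℤ → ℤ → W} (hF : F ∈ clearable02 W) :
    act3 p F ∈ clearable02 W ∧ YSer02 (act3 p F) = act3 (sub02 p) (YSer02 F) := by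
  refine act_intertwine act3 act3 sub02 (clearable02 W) YSer02 (fun F hF G hG => ?_)
    (fun c F hF => ?_) (fun i F hF t => ?_) (fun i F hF => ?_) p F hF
  · ext i t s
    exact congrFun (congrFun (YSer_add (hF t) (hG t)) i) s
  · ext i t s
    exact congrFun (congrFun (YSer_smul c (hF t)) i) s
  · fin_cases i
    · convert clearable_X 0 _ (hF t) using 1
      ext m n
      exact (act3_X0 F m t n).trans (by rw [act2_X0])
    · convert hF (t - 1) using 1
      ext m n
      exact act3_X1 F m t n
    · convert clearable_X 1 _ (hF t) using 1
      ext m n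
      exact (act3_X2 F m t n).trans (by rw [act2_X1])
  · ext j t s
    fin_cases i
    · have h : (fun m n => act3 (X 0) F m t n) = act2 (X 0) fun m n => F m t n := by
        ext m n
        rw [act3_X0, act2_X0]
      have h' : sub02 (X 0) = X 0 + X 2 := by simp [sub02]
      change YSer (fun m n => act3 (X 0) F m t n) j s = act3 (sub02 (X 0)) (YSer02 F) j t s
      rw [h, YSer_X0 (hF t), h', act2_X0_add_X1, map_add, LinearMap.add_apply, Pi.add_apply,
        Pi.add_apply, Pi.add_apply, act3_X0, act3_X2]
      rfl
    · have h' : sub02 (X 1) = X 1 := by simp [sub02]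
      change YSer (fun m n => act3 (X 1) F m t n) j s = act3 (sub02 (X 1)) (YSer02 F) j t s
      rw [h', act3_X1]
      simp only [act3_X1]
      rfl
    · have h : (fun m n => act3 (X 2) F m t n) = act2 (X 1) fun m n => F m t n := by
        ext m n
        rw [act3_X2, act2_X1]
      have h' : sub02 (X 2) = X 2 := by simp [sub02]
      change YSer (fun m n => act3 (X 2) F m t n) j s = act3 (sub02 (X 2)) (YSer02 F) j t s
      rw [h, YSer_X1 (hF t), h', act2_X1, act3_X2]
      rfl

theorem YSer12_act (p : MvPolynomial (Fin 3) ℂ) {F : ℤ → ℤ → ℤ → W} (hF : F ∈ clearable12 W) :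
    act3 p F ∈ clearable12 W ∧ YSer12 (act3 p F) = act3 (sub12 p) (YSer12 F) := by
  refine act_intertwine act3 act3 sub12 (clearable12 W) YSer12 (fun F hF G hG => ?_)
    (fun c F hF => ?_) (fun i F hF t => ?_) (fun i F hF => ?_) p F hF
  · ext t i s
    exact congrFun (congrFun (YSer_add (hF t) (hG t)) i) s
  · ext t i s
    exact congrFun (congrFun (YSer_smul c (hF t)) i) s
  · fin_cases i
    · convert hF (t - 1) using 1
      ext m n
      exact act3_X0 F t m n
    · convert clearable_X 0 _ (hF t) using 1
      ext m n
      exact (act3_X1 F t m n).trans (by rw [act2_X0])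
    · convert clearable_X 1 _ (hF t) using 1
      ext m n
      exact (act3_X2 F t m n).trans (by rw [act2_X1])
  · ext t j s
    fin_cases i
    · have h' : sub12 (X 0) = X 0 := by simp [sub12]
      change YSer (fun m n => act3 (X 0) F t m n) j s = act3 (sub12 (X 0)) (YSer12 F) t j s
      rw [h', act3_X0]
      simp only [act3_X0]
      rfl
    · have h : (fun m n => act3 (X 1) F t m n) = act2 (X 0) fun m n => F t m n := by
        ext m n
        rw [act3_X1, act2_X0]
      have h' : sub12 (X 1) = X 1 + X 2 := by simp [sub12]
      change YSer (fun m n => act3 (X 1) F t m n) j s = act3 (sub12 (X 1)) (YSer12 F) t j s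
      rw [h, YSer_X0 (hF t), h', act2_X0_add_X1, map_add, LinearMap.add_apply, Pi.add_apply,
        Pi.add_apply, Pi.add_apply, act3_X1, act3_X2]
      rfl
    · have h : (fun m n => act3 (X 2) F t m n) = act2 (X 1) fun m n => F t m n := by
        ext m n
        rw [act3_X2, act2_X1]
      have h' : sub12 (X 2) = X 2 := by simp [sub12]
      change YSer (fun m n => act3 (X 2) F t m n) j s = act3 (sub12 (X 2)) (YSer12 F) t j s
      rw [h, YSer_X1 (hF t), h', act2_X1, act3_X2]
      rfl

/-- The coefficient of `x₁ ^ i`. -/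
def slice (i : ℤ) : (ℤ → ℤ → ℤ → W) →ₗ[ℂ] (ℤ → ℤ → W) where
  toFun F := F i
  map_add' _ _ := rfl
  map_smul' _ _ := rfl

theorem act3_rename_slice (p : MvPolynomial (Fin 2) ℂ) (F : ℤ → ℤ → ℤ → W) (i : ℤ) :
    act3 (MvPolynomial.rename ![1, 2] p) F i = act2 p (F i) := by
  refine act_natural (act3.comp (MvPolynomial.rename ![1, 2])) act2 (slice i) (fun j F => ?_) p F
  rw [AlgHom.comp_apply, MvPolynomial.rename_X]
  ext m n
  fin_cases j
  · exact (act3_X1 F i m n).trans (act2_X0 (F i) m n).symm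
  · exact (act3_X2 F i m n).trans (act2_X1 (F i) m n).symm

/-- The series whose coefficients of `x₁ ^ i` all lie in `N`. -/
def slicesIn (N : Submodule ℂ (ℤ → ℤ → W)) : Submodule ℂ (ℤ → ℤ → ℤ → W) where
  carrier := {F | ∀ i, F i ∈ N}
  zero_mem' := fun _ => zero_mem N
  add_mem' := fun hF hG t => add_mem (hF t) (hG t)
  smul_mem' := fun c _ hF t => Submodule.smul_mem _ c (hF t)

theorem slicesIn_act {N : Submodule ℂ (ℤ → ℤ → W)} (hN : ∀ p, ∀ F ∈ N, act2 p F ∈ N)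
    (p : MvPolynomial (Fin 3) ℂ) {F : ℤ → ℤ → ℤ → W} (hF : F ∈ slicesIn N) :
    act3 p F ∈ slicesIn N := by
  refine act_mem act3 _ (fun j F hF i => ?_) p hF
  fin_cases j
  · convert hF (i - 1) using 1
    ext m n
    exact act3_X0 F i m n
  · convert hN (X 0) _ (hF i) using 1
    ext m n
    exact (act3_X1 F i m n).trans (act2_X0 (F i) m n).symm
  · convert hN (X 1) _ (hF i) using 1
    ext m n
    exact (act3_X2 F i m n).trans (act2_X1 (F i) m n).symm

/-- The series whose exponents of `x₁` are bounded below. -/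
def truncated (W : Type*) [AddCommGroup W] [Module ℂ W] : Submodule ℂ (ℤ → ℤ → ℤ → W) where
  carrier := {F | ∃ K, ∀ i < K, F i = 0}
  zero_mem' := ⟨0, fun _ _ => rfl⟩
  add_mem' := by
    rintro F G ⟨N, hN⟩ ⟨N', hN'⟩
    exact ⟨min N N', fun m h => by simp [hN m (by omega), hN' m (by omega)]⟩
  smul_mem' := by
    rintro c F ⟨N, hN⟩
    exact ⟨N, fun m h => by simp [hN m h]⟩

theorem truncated_act (p : MvPolynomial (Fin 3) ℂ) {F : ℤ → ℤ → ℤ → W} (hF : F ∈ truncated W) :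
    act3 p F ∈ truncated W := by
  refine act_mem act3 _ (fun j F hF => ?_) p hF
  obtain ⟨K, hK⟩ := hF
  refine ⟨K, fun i hi => ?_⟩
  ext m n
  fin_cases j
  · refine (act3_X0 F i m n).trans ?_
    simp [hK (i - 1) (by omega)]
  · refine (act3_X1 F i m n).trans ?_
    simp [hK i hi]
  · refine (act3_X2 F i m n).trans ?_
    simp [hK i hi]

/-- The coefficient of x₁^i in (εx₁ + δ)F is εF_{i-1} + δF_i. If δ is a product of linear forms,
this triangular system is solved upwards from the truncation bound; if δ = 0, multiplication by εx₁
merely shifts the slices. -/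
theorem mem_slicesIn_of_act_linear {Γ : Subgroup ℂˣ} {N : Submodule ℂ (ℤ → ℤ → W)}
    (hN : IsSaturated act2 Γ N) {ε : ℂ} {δ : MvPolynomial (Fin 2) ℂ}
    (hδ : δ ∈ linForms (Fin 2) Γ ∨ δ = 0 ∧ ε ≠ 0) {F : ℤ → ℤ → ℤ → W} (hF : F ∈ truncated W)
    (h : act3 (C ε * X 0 + MvPolynomial.rename ![1, 2] δ) F ∈ slicesIn N) : F ∈ slicesIn N := by
  have key : ∀ i, ε • F (i - 1) + act2 δ (F i) ∈ N := by
    intro i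
    convert h i using 1
    rw [map_add, LinearMap.add_apply, Pi.add_apply, act3_rename_slice, act3_mul, act3_C]
    congr 1
    ext m n
    exact (congrArg (ε • ·) (act3_X0 F i m n)).symm
  rcases hδ with hδ | ⟨rfl, hε⟩
  · obtain ⟨K, hK⟩ := hF
    have hind : ∀ (k : ℕ) (i : ℤ), i < K + k → F i ∈ N := by
      intro k
      induction k with
      | zero =>
        intro i hi
        rw [hK i (by simpa using hi)]
        exact zero_mem _
      | succ k ih =>
        intro i hi
        -- The slice F_{i-1} lies in N by induction, hence so does δF_i; saturation of N removes δ.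
        refine hN.of_act δ hδ _ ?_
        have := sub_mem (key i) (N.smul_mem ε (ih (i - 1) (by push_cast at hi; omega)))
        rwa [add_sub_cancel_left] at this
    exact fun i => hind (i - K + 1).toNat i (by omega)
  · intro i
    have := key (i + 1)
    rw [map_zero, LinearMap.zero_apply, add_zero, add_sub_cancel_right] at this
    have h2 := N.smul_mem ε⁻¹ this
    rwa [smul_smul, inv_mul_cancel₀ hε, one_smul] at h2

/-- Under x₁ ↦ x₁ + x₂ every generator of `linForms` takes the shape εx₁ + δ(x₂, x₃) treated above,
so forms can be stripped off factor by factor. -/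
theorem mem_slicesIn_of_act {Γ : Subgroup ℂˣ} {N : Submodule ℂ (ℤ → ℤ → W)}
    (hN : IsSaturated act2 Γ N) {p : MvPolynomial (Fin 3) ℂ} (hp : p ∈ linForms (Fin 3) Γ) :
    ∀ F ∈ truncated W, act3 (sub01 p) F ∈ slicesIn N → F ∈ slicesIn N := by
  induction hp using Submonoid.closure_induction with
  | one =>
    intro F hF h
    rwa [map_one, map_one] at h
  | mul p q _ _ hp hq =>
    intro F hF h
    rw [map_mul, act3_mul] at h
    exact hq F hF (hp _ (truncated_act _ hF) h)
  | mem d hd =>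
    intro F hF h
    -- The case δ = 0 occurs only for x₁ - x₂ and x₂ - x₁. For another α, the forms in x₁ and x₂
    -- leave δ = (1 - α)x₂ with 1 - α ≠ 0.
    have key : ∀ (ε : ℂ) (δ : MvPolynomial (Fin 2) ℂ),
        (δ ∈ linForms (Fin 2) Γ ∨ δ = 0 ∧ ε ≠ 0) →
        sub01 d = C ε * X 0 + MvPolynomial.rename ![1, 2] δ → F ∈ slicesIn N :=
      fun ε δ hδ e => mem_slicesIn_of_act_linear hN hδ hF (e ▸ h)
    rcases hd with ⟨c, hc, rfl⟩ | ⟨i, rfl⟩ | ⟨i, j, hij, α, hα, rfl⟩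
    · exact key 0 (C c) (Or.inl (linForms_C Γ hc)) (by simp [sub01])
    · fin_cases i
      · exact key 1 (X 0) (Or.inl (linForms_X Γ 0)) (by simp [sub01])
      · exact key 0 (X 0) (Or.inl (linForms_X Γ 0)) (by simp [sub01])
      · exact key 0 (X 1) (Or.inl (linForms_X Γ 1)) (by simp [sub01])
    · have hα0 : (α : ℂ) ≠ 0 := α.ne_zero
      fin_cases i <;> fin_cases j
      · exact absurd rfl hij
      · by_cases h1 : (α : ℂ) = 1
        · exact key 1 0 (Or.inr ⟨rfl, one_ne_zero⟩) (by simp [sub01, h1])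
        · refine key 1 (C (1 - (α : ℂ)) * X 0) (Or.inl (mul_mem (linForms_C Γ ?_)
            (linForms_X Γ 0))) ?_
          · exact sub_ne_zero.2 (Ne.symm h1)
          · simp [sub01]
            ring
      · refine key 1 (X 0 - C (α : ℂ) * X 1) (Or.inl (linForms_sub (by decide) hα)) ?_
        simp [sub01]
        ring
      · by_cases h1 : (α : ℂ) = 1
        · exact key (-1) 0 (Or.inr ⟨rfl, by simp⟩) (by simp [sub01, h1])
        · refine key (-(α : ℂ)) (C (1 - (α : ℂ)) * X 0) (Or.inl (mul_mem (linForms_C Γ ?_)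
            (linForms_X Γ 0))) ?_
          · exact sub_ne_zero.2 (Ne.symm h1)
          · simp [sub01]
            ring
      · exact absurd rfl hij
      · refine key 0 (X 0 - C (α : ℂ) * X 1) (Or.inl (linForms_sub (by decide) hα)) ?_
        simp [sub01]
      · refine key (-(α : ℂ)) (X 1 - C (α : ℂ) * X 0) (Or.inl (linForms_sub (by decide) hα)) ?_
        simp [sub01]
        ring
      · refine key 0 (X 1 - C (α : ℂ) * X 0) (Or.inl (linForms_sub (by decide) hα)) ?_
        simp [sub01]
      · exact absurd rfl hij

/-- `X'` is the series `YSer01 X`, for series of operators. -/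
def IsImage01 (X X' : ℤ → ℤ → ℤ → Module.End ℂ W) : Prop :=
  ∀ w : W, post3 (LinearMap.applyₗ w) X ∈ clearable01 W ∧
    YSer01 (post3 (LinearMap.applyₗ w) X) = post3 (LinearMap.applyₗ w) X'

theorem IsImage01.add {X X' Y Y' : ℤ → ℤ → ℤ → Module.End ℂ W} (hX : IsImage01 X X')
    (hY : IsImage01 Y Y') : IsImage01 (X + Y) (X' + Y') := fun w => by
  rw [map_add, map_add]
  refine ⟨add_mem (hX w).1 (hY w).1, ?_⟩
  rw [← (hX w).2, ← (hY w).2]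
  ext i s t
  exact congrFun (congrFun (YSer_add ((hX w).1 t) ((hY w).1 t)) i) s

theorem IsImage01.smul {X X' : ℤ → ℤ → ℤ → Module.End ℂ W} (c : ℂ) (hX : IsImage01 X X') :
    IsImage01 (c • X) (c • X') := fun w => by
  rw [map_smul, map_smul]
  refine ⟨Submodule.smul_mem _ c (hX w).1, ?_⟩
  rw [← (hX w).2]
  ext i s t
  exact congrFun (congrFun (YSer_smul c ((hX w).1 t)) i) s

theorem IsImage01.act {X X' : ℤ → ℤ → ℤ → Module.End ℂ W} (p : MvPolynomial (Fin 3) ℂ)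
    (hX : IsImage01 X X') : IsImage01 (act3 p X) (act3 (sub01 p) X') := fun w => by
  have := YSer01_act p (hX w).1
  rw [post3_act, post3_act, this.2, (hX w).2]
  exact ⟨this.1, rfl⟩

theorem IsImage01.unique {X X' X'' : ℤ → ℤ → ℤ → Module.End ℂ W} (h : IsImage01 X X')
    (h' : IsImage01 X X'') : X' = X'' := by
  ext i s t w
  exact congrFun (congrFun (congrFun ((h w).2.symm.trans (h' w).2) i) s) t

/-- The core of the inheritance argument. If pX is a polynomial combination of elements of S,
applying Y_E in x₁, x₂ shows that `sub01 p` times X' has its slices in N, and truncation in x₀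
allows the forms to be removed. -/
theorem slice_mem_of_isImage {Γ : Subgroup ℂˣ} {X X' : ℤ → ℤ → ℤ → Module.End ℂ W}
    {S : Set (ℤ → ℤ → ℤ → Module.End ℂ W)} (hX : X ∈ locSpan act3 Γ S) (h : IsImage01 X X')
    (ht : X' ∈ truncated (Module.End ℂ W)) {N : Submodule ℂ (ℤ → ℤ → Module.End ℂ W)}
    (hN : IsSaturated act2 Γ N) (hS : ∀ G ∈ S, ∃ G', IsImage01 G G' ∧ G' ∈ slicesIn N) :
    X' ∈ slicesIn N := by
  obtain ⟨p, hp, hX⟩ := hX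
  have key : ∀ G ∈ polySpan act3 S, ∃ G', IsImage01 G G' ∧ G' ∈ slicesIn N := by
    intro G hG
    induction hG using Submodule.span_induction with
    | mem G hG =>
      obtain ⟨f, F, hF, rfl⟩ := hG
      obtain ⟨F', h1, h2⟩ := hS F hF
      exact ⟨_, h1.act f, slicesIn_act hN.act _ h2⟩
    | zero =>
      refine ⟨0, fun w => ?_, zero_mem _⟩
      rw [map_zero]
      refine ⟨zero_mem _, ?_⟩
      ext i s t
      have := YSer_smul (0 : ℂ) (zero_mem (clearable W))
      rw [zero_smul, zero_smul] at this
      exact congrFun (congrFun this i) s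
    | add F G _ _ hF hG =>
      obtain ⟨F', h1, h2⟩ := hF
      obtain ⟨G', h3, h4⟩ := hG
      exact ⟨_, h1.add h3, add_mem h2 h4⟩
    | smul c F _ hF =>
      obtain ⟨F', h1, h2⟩ := hF
      exact ⟨_, h1.smul c, Submodule.smul_mem _ _ h2⟩
  obtain ⟨G', h1, h2⟩ := key _ hX
  rw [h1.unique (h.act p)] at h2
  exact mem_slicesIn_of_act hN hp X' ht h2

/-- With c on the right, Y_E is applied to the vectors c_t w. In the reversed order c acts on the
result instead, and there Y_E has to commute with the coefficients of c; this is `YSer_post`. -/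
theorem isImage_opTriple {a b : E W} (h : QuasiCompatible a b) (c : E W) :
    IsImage01 (opTriple a b c)
      (fun i s t => coeffEnd (nprod a b (-i - 1)) s * coeffEnd c t) := by
  intro w
  refine ⟨fun t => h.clearable ((c w).coeff t), ?_⟩
  ext i s t
  exact (nprod_coeff' h i _ s).symm

theorem isImage_opTripleRot {a b : E W} (h : QuasiCompatible a b) (c : E W) :
    IsImage01 (opTripleRot a b c)
      (fun i s t => coeffEnd c t * coeffEnd (nprod a b (-i - 1)) s) := by
  intro w
  refine ⟨fun t => clearable_post (coeffEnd c t) (h.clearable w), ?_⟩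
  ext i s t
  have := congrFun (congrFun (YSer_post (coeffEnd c t) (h.clearable w)) i) s
  refine this.trans ?_
  exact congrArg (coeffEnd c t) (nprod_coeff' h i w s).symm

/-- The products `a(x)_n b(x)` with `a(x), b(x) ∈ A`. -/
def products (A : Set (E W)) : Set (E W) := {e | ∃ a ∈ A, ∃ b ∈ A, ∃ n, e = nprod a b n}

theorem truncated_nprod {a b : E W} (h : QuasiCompatible a b) :
    ∃ K : ℤ, ∀ i < K, ∀ s, coeffEnd (nprod a b (-i - 1)) s = 0 := by
  obtain ⟨K, hK⟩ := nprod_truncated h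
  refine ⟨K, fun i hi s => ?_⟩
  rw [hK i hi]
  rfl

/-- The analogue of Dong's lemma: c(x₃) is exchanged with a(x₁)b(x₂), and extracting the coefficient
of x₀^{-n-1} on both sides turns the pairs of fields into their products. -/
theorem Exchange.products {Γ : Subgroup ℂˣ} {A C : Set (E W)} (h : Exchange Γ A C)
    (hA : ∀ a ∈ A, ∀ b ∈ A, QuasiCompatible a b) : Exchange Γ (products A) C := by
  rintro _ ⟨a, ha, b, hb, n, rfl⟩ c hc
  have := slice_mem_of_isImage (h.triple ha hb hc) (isImage_opTriple (hA a ha b hb) c)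
    (by
      obtain ⟨K, hK⟩ := truncated_nprod (hA a ha b hb)
      exact ⟨K, fun i hi => by ext s t : 2; simp [hK i hi]⟩)
    (locSpan_isSaturated (Γ := Γ) (S := {F | ∃ a' ∈ NVA.products A, ∃ c' ∈ C,
      F = opProdRev a' c'})) ?_ (-n - 1)
  · rwa [show -(-n - 1) - 1 = n by ring] at this
  · rintro _ ⟨a', ha', b', hb', c', hc', rfl⟩
    refine ⟨_, isImage_opTripleRot (hA a' ha' b' hb') c', fun i => subset_locSpan ?_⟩
    exact ⟨_, ⟨a', ha', b', hb', _, rfl⟩, c', hc', rfl⟩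

theorem ExchangeRev.products {Γ : Subgroup ℂˣ} {A C : Set (E W)} (h : ExchangeRev Γ A C)
    (hA : ∀ a ∈ A, ∀ b ∈ A, QuasiCompatible a b) : ExchangeRev Γ (products A) C := by
  rintro _ ⟨a, ha, b, hb, n, rfl⟩ c hc
  have := slice_mem_of_isImage (h.triple ha hb hc) (isImage_opTripleRot (hA a ha b hb) c)
    (by
      obtain ⟨K, hK⟩ := truncated_nprod (hA a ha b hb)
      exact ⟨K, fun i hi => by ext s t : 2; simp [hK i hi]⟩)
    (locSpan_isSaturated (Γ := Γ) (S := {F | ∃ a' ∈ NVA.products A, ∃ c' ∈ C,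
      F = opProd a' c'})) ?_ (-n - 1)
  · rwa [show -(-n - 1) - 1 = n by ring] at this
  · rintro _ ⟨a', ha', b', hb', c', hc', rfl⟩
    refine ⟨_, isImage_opTriple (hA a' ha' b' hb') c', fun i => subset_locSpan ?_⟩
    exact ⟨_, ⟨a', ha', b', hb', _, rfl⟩, c', hc', rfl⟩

end Slices

/-! ### Boundedness of products -/

section Bounded

variable {W : Type*} [AddCommGroup W] [Module ℂ W]

/-- The series of operators whose exponents of `x₁` are bounded below on each vector. -/
def lower2 (W : Type*) [AddCommGroup W] [Module ℂ W] :
    Submodule ℂ (ℤ → ℤ → Module.End ℂ W) where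
  carrier := {F | ∀ w, ∃ N, ∀ m < N, ∀ n, F m n w = 0}
  zero_mem' := fun _ => ⟨0, fun _ _ _ => rfl⟩
  add_mem' := fun {F G} hF hG w => by
    obtain ⟨N, hN⟩ := hF w
    obtain ⟨N', hN'⟩ := hG w
    exact ⟨min N N', fun m hm n => by simp [hN m (by omega) n, hN' m (by omega) n]⟩
  smul_mem' := fun c F hF w => by
    obtain ⟨N, hN⟩ := hF w
    exact ⟨N, fun m hm n => by simp [hN m hm n]⟩

theorem polySpan_le {σ M : Type*} [AddCommGroup M] [Module ℂ M]
    {A : MvPolynomial σ ℂ →ₐ[ℂ] Module.End ℂ M} {S : Set M} {N : Submodule ℂ M}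
    (hN : ∀ i, ∀ F ∈ N, A (X i) F ∈ N) (hS : S ⊆ N) : polySpan A S ≤ N := by
  refine Submodule.span_le.2 ?_
  rintro _ ⟨f, F, hF, rfl⟩
  exact act_mem A N hN f (hS hF)

/-- In a(x₁)c(x₂)w the exponents of x₂ are bounded below. After multiplication by d the series is a
combination of terms c'(x₂)a'(x₁)w, which bounds the exponents of x₁ as well. The form d serves
every w. -/
theorem Exchange.quasiCompatible {Γ : Subgroup ℂˣ} {A C : Set (E W)} (h : Exchange Γ A C)
    {a c : E W} (ha : a ∈ A) (hc : c ∈ C) : QuasiCompatible a c := by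
  obtain ⟨d, hd, hF⟩ := h a ha c hc
  have h1 : act2 d (opProd a c) ∈ lower2 W := by
    refine polySpan_le (fun i F hF w => ?_) ?_ hF
    · obtain ⟨N, hN⟩ := hF w
      refine ⟨N, fun m hm n => ?_⟩
      fin_cases i
      · change act2 (X 0) F m n w = 0
        rw [act2_X0, hN _ (by omega)]
      · change act2 (X 1) F m n w = 0
        rw [act2_X1, hN _ (by omega)]
    · rintro _ ⟨a', -, c', -, rfl⟩ w
      obtain ⟨N, hN⟩ := laurent_lower (a' w)
      refine ⟨N, fun m hm n => ?_⟩
      change coeffEnd c' n ((a' w).coeff m) = 0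
      rw [hN m hm, map_zero]
  refine ⟨d, linForms_ne_zero hd, fun w => ?_⟩
  rw [← act2_apply]
  obtain ⟨N, hN⟩ := h1 w
  have h2 : act2 d (prodSeries a c w) ∈ boundedSnd W := by
    refine act_mem act2 (boundedSnd W) boundedSnd_X d ?_
    obtain ⟨N, hN⟩ := laurent_lower (c w)
    exact ⟨N, fun m n hn => by rw [prodSeries, hN n hn]; simp⟩
  obtain ⟨N', hN'⟩ := h2
  refine ⟨min N N', fun m n hmn => ?_⟩
  by_cases hn : n < N'
  · exact hN' m n hn
  · have := hN m (by omega) n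
    have e := congrFun (congrFun (post2_act (LinearMap.applyₗ w) d (opProd a c)) m) n
    exact e.symm.trans this

end Bounded

/-! ### Iterated substitutions -/

section Iterated

variable {W : Type*} [AddCommGroup W] [Module ℂ W]

/-- Vandermonde for (m - i) + n, combined with binom(m, i) binom(m-i, j) = binom(i+j, j) binom(m,
i+j). It compares the coefficients of the two orders of substitution in `substOuter3_YSer`. -/
theorem choose_identity (m n : ℤ) (i k : ℕ) :
    Ring.choose (n + m - i) k * Ring.choose m i =
      ∑ j ∈ Finset.range (k + 1), ((i + j).choose j : ℤ) *
        (Ring.choose m (i + j) * Ring.choose n (k - j)) := by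
  have h1 : n + m - i = (m - i) + n := by ring
  rw [h1, Ring.add_choose_eq k (Commute.all _ _), Finset.sum_mul,
    Finset.Nat.sum_antidiagonal_eq_sum_range_succ_mk]
  refine Finset.sum_congr rfl fun j _ => ?_
  have h2 := Ring.choose_smul_choose m (Nat.le_add_right i j)
  rw [Nat.add_sub_cancel_left, nsmul_eq_mul, Nat.choose_symm_add] at h2
  simp only
  rw [← mul_assoc, h2]
  ring

theorem zsmul_finsum_of_finite {α : Type*} (c : ℤ) {f : α → W} (hf : (Function.support f).Finite) :
    c • ∑ᶠ a, f a = ∑ᶠ a, c • f a :=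
  (DistribSMul.toAddMonoidHom W c).map_finsum hf

/-- The series `F` in `W((x₁, x₂, x₃))`. -/
def IsBounded3 (F : ℤ → ℤ → ℤ → W) : Prop :=
  ∃ N, ∀ m n t, (m < N ∨ n < N ∨ t < N) → F m n t = 0

theorem IsBounded3.clearable12 {G : ℤ → ℤ → ℤ → W} (hG : IsBounded3 G) (m : ℤ) :
    (fun n t => G m n t) ∈ bounded2 W := by
  obtain ⟨N, hN⟩ := hG
  exact ⟨N, fun n t h => hN m n t (by tauto)⟩

theorem IsBounded3.clearable01 {G : ℤ → ℤ → ℤ → W} (hG : IsBounded3 G) (t : ℤ) :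
    (fun m n => G m n t) ∈ bounded2 W := by
  obtain ⟨N, hN⟩ := hG
  exact ⟨N, fun m n h => hN m n t (by tauto)⟩

theorem YSer12_apply {G : ℤ → ℤ → ℤ → W} (hG : IsBounded3 G) (m i s : ℤ) :
    YSer12 G m i s = substInner (fun n t => G m n t) i s := by
  rw [YSer12, YSer_of_bounded (hG.clearable12 m)]

theorem YSer01_apply {G : ℤ → ℤ → ℤ → W} (hG : IsBounded3 G) (i s t : ℤ) :
    YSer01 G i s t = substInner (fun m n => G m n t) i s := by
  rw [YSer01, YSer_of_bounded (hG.clearable01 t)]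

theorem YSer12_bounded {G : ℤ → ℤ → ℤ → W} (hG : IsBounded3 G) (i : ℤ) :
    (fun m s => YSer12 G m i s) ∈ bounded2 W := by
  obtain ⟨N, hN⟩ := hG
  refine ⟨min N (2 * N - i), fun m s h => ?_⟩
  simp only [YSer12_apply ⟨N, hN⟩]
  rcases lt_or_ge i 0 with hi | hi
  · rw [substInner_neg _ hi]
  · lift i to ℕ using hi
    rw [substInner_natCast]
    refine finsum_eq_zero_of_forall_eq_zero fun n => ?_
    rw [hN _ _ _ (by omega), smul_zero]

theorem YSer01_bounded {G : ℤ → ℤ → ℤ → W} (hG : IsBounded3 G) (i : ℤ) :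
    (fun s t => YSer01 G i s t) ∈ bounded2 W := by
  obtain ⟨N, hN⟩ := hG
  refine ⟨min N (2 * N - i), fun s t h => ?_⟩
  simp only [YSer01_apply ⟨N, hN⟩]
  rcases lt_or_ge i 0 with hi | hi
  · rw [substInner_neg _ hi]
  · lift i to ℕ using hi
    rw [substInner_natCast]
    refine finsum_eq_zero_of_forall_eq_zero fun n => ?_
    rw [hN _ _ _ (by omega), smul_zero]

/-- The substitution `x₁ = x₀ + x₂`, in nonnegative powers of `x₂`, in the first two variables. -/
def substOuter3 (F : ℤ → ℤ → ℤ → W) : ℤ → ℤ → ℤ → W :=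
  fun i j t => substOuter (fun m n => F m n t) i j

/-- The total exponent is fixed at T and each exponent is at least N, so each is also at most T -
2N. -/
theorem support_pair_finite {G : ℤ → ℤ → ℤ → W} (hG : IsBounded3 G) (T : ℤ) (c : ℤ × ℤ → ℤ) :
    (Function.support fun x : ℤ × ℤ => c x • G x.1 x.2 (T - x.1 - x.2)).Finite := by
  obtain ⟨N, hN⟩ := hG
  refine ((Set.finite_Icc N (T - 2 * N)).prod (Set.finite_Icc N (T - 2 * N))).subset
    fun x hx => ?_
  by_contra h
  refine hx ?_
  simp only
  rw [hN _ _ _ ?_, smul_zero]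
  simp only [Set.mem_prod, Set.mem_Icc] at h
  omega

theorem YSer02_YSer12 {G : ℤ → ℤ → ℤ → W} (hG : IsBounded3 G) (i k : ℕ) (t : ℤ) :
    YSer02 (YSer12 G) i k t = ∑ᶠ x : ℤ × ℤ,
      (Ring.choose x.1 i * Ring.choose x.2 k) • G x.1 x.2 (t + i + k - x.1 - x.2) := by
  rw [YSer02, YSer_of_bounded (YSer12_bounded hG k), substInner_natCast,
    finsum_curry _ (support_pair_finite hG _ _)]
  refine finsum_congr fun m => ?_
  rw [YSer12_apply hG, substInner_natCast,
    zsmul_finsum_of_finite _ (substInner_finite (hG.clearable12 m) k _)]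
  refine finsum_congr fun n => ?_
  rw [smul_smul]
  congr 2
  ring

theorem YSer12_YSer01 {G : ℤ → ℤ → ℤ → W} (hG : IsBounded3 G) (i k : ℕ) (t : ℤ) :
    YSer12 (YSer01 G) i k t = ∑ᶠ x : ℤ × ℤ,
      (Ring.choose (x.2 + x.1 - i) k * Ring.choose x.1 i) •
        G x.1 x.2 (t + i + k - x.1 - x.2) := by
  -- If x₁^m x₂^n contributes x₀^i, then x₂ is left with exponent m - i + n; the bijection passes
  -- from the exponents in G to this intermediate exponent.
  let e : ℤ × ℤ ≃ ℤ × ℤ :=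
    { toFun := fun x => (x.2 + x.1 - i, x.1)
      invFun := fun y => (y.2, y.1 - y.2 + i)
      left_inv := fun x => by ext <;> dsimp only <;> ring
      right_inv := fun y => by ext <;> dsimp only <;> ring }
  have h1 : YSer12 (YSer01 G) i k t = ∑ᶠ y : ℤ × ℤ,
      (Ring.choose y.1 k * Ring.choose y.2 i) • G y.2 (y.1 + i - y.2) (t + k - y.1) := by
    rw [YSer12, YSer_of_bounded (YSer01_bounded hG i), substInner_natCast, finsum_curry]
    · refine finsum_congr fun n => ?_
      rw [YSer01_apply hG, substInner_natCast,
        zsmul_finsum_of_finite _ (substInner_finite (hG.clearable01 _) i _)]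
      refine finsum_congr fun m => ?_
      rw [smul_smul]
    · have hfin := support_pair_finite hG (t + i + k)
        fun x => Ring.choose (x.2 + x.1 - i) k * Ring.choose x.1 i
      refine (hfin.image e).subset fun y hy => ⟨e.symm y, ?_, e.apply_symm_apply y⟩
      simp only [Function.mem_support] at hy ⊢
      have e1 : y.1 - y.2 + i + y.2 - i = y.1 := by ring
      have e2 : t + i + k - y.2 - (y.1 - y.2 + i) = t + k - y.1 := by ring
      have e3 : y.1 - y.2 + i = y.1 + i - y.2 := by ring
      simp only [e, Equiv.coe_fn_symm_mk]
      rw [e1, e2, e3]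
      exact hy
  rw [h1, ← finsum_comp_equiv e]
  refine finsum_congr fun x => ?_
  simp only [e, Equiv.coe_fn_mk]
  congr 1
  congr 1 <;> ring

/-- On W((x₁, x₂, x₃)) both sides substitute x₁ = x₀ + x₂ + x₃ and x₂ ↦ x₂ + x₃ in different orders.
All sums are finite, and `choose_identity` equates the coefficients. -/
theorem substOuter3_YSer {G : ℤ → ℤ → ℤ → W} (hG : IsBounded3 G) :
    substOuter3 (YSer02 (YSer12 G)) = YSer12 (YSer01 G) := by
  have hneg0 : ∀ i j t, i < 0 → YSer02 (YSer12 G) i j t = 0 := fun i j t hi => by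
    rw [YSer02, YSer_of_bounded (YSer12_bounded hG j), substInner_neg _ hi]
  have hneg1 : ∀ i j t, j < 0 → YSer02 (YSer12 G) i j t = 0 := fun i j t hj => by
    have h0 : (fun m s => YSer12 G m j s) = 0 := by
      ext m s
      rw [YSer12_apply hG, substInner_neg _ hj]
      rfl
    have := substInner_smul (0 : ℂ) (0 : ℤ → ℤ → W)
    rw [zero_smul, zero_smul] at this
    rw [YSer02, YSer_of_bounded (YSer12_bounded hG j), h0, this]
    rfl
  ext i j t
  rcases lt_or_ge i 0 with hi | hi
  · have h0 : (fun s t => YSer01 G i s t) = 0 := by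
      ext s t
      rw [YSer01_apply hG, substInner_neg _ hi]
      rfl
    have := substInner_smul (0 : ℂ) (0 : ℤ → ℤ → W)
    rw [zero_smul, zero_smul] at this
    rw [YSer12, YSer_of_bounded (YSer01_bounded hG i), h0, this]
    refine finsum_eq_zero_of_forall_eq_zero fun r => ?_
    -- For i < 0 ≤ i + r the coefficient binom(i+r, r) vanishes, because i + r < r.
    rcases lt_or_ge (i + r) 0 with h | h
    · simp only; rw [hneg0 _ _ _ h, smul_zero]
    · obtain ⟨k, hk⟩ := Int.eq_ofNat_of_zero_le h
      rw [hk, Ring.choose_natCast, Nat.choose_eq_zero_of_lt (by omega), Nat.cast_zero, zero_smul]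
  rcases lt_or_ge j 0 with hj | hj
  · rw [YSer12, YSer_of_bounded (YSer01_bounded hG i), substInner_neg _ hj]
    refine finsum_eq_zero_of_forall_eq_zero fun r => ?_
    simp only
    rw [hneg1 _ _ _ (by omega), smul_zero]
  lift i to ℕ using hi
  lift j to ℕ using hj
  rw [YSer12_YSer01 hG, substOuter3, substOuter]
  -- For r > j the second exponent j - r is negative, so only r ≤ j contributes.
  rw [finsum_eq_sum_of_support_subset (s := Finset.range (j + 1))]
  · have h1 : ∀ r ∈ Finset.range (j + 1),
        Ring.choose ((i : ℤ) + (r : ℤ)) r • YSer02 (YSer12 G) ((i : ℤ) + r) ((j : ℤ) - r) t =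
          ∑ᶠ x : ℤ × ℤ, (((i + r).choose r : ℤ) *
            (Ring.choose x.1 (i + r) * Ring.choose x.2 (j - r))) •
              G x.1 x.2 (t + i + j - x.1 - x.2) := by
      intro r hr
      rw [Finset.mem_range] at hr
      have e1 : (j : ℤ) - r = ((j - r : ℕ) : ℤ) := by omega
      have e2 : t + ((i + r : ℕ) : ℤ) + ((j - r : ℕ) : ℤ) = t + i + j := by omega
      rw [e1, ← Nat.cast_add, YSer02_YSer12 hG, Ring.choose_natCast, e2,
        zsmul_finsum_of_finite _ (support_pair_finite hG _ _)]
      refine finsum_congr fun x => ?_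
      rw [smul_smul]
    rw [Finset.sum_congr rfl h1, ← finsum_sum_comm _ _ fun r _ => support_pair_finite hG _ _]
    refine finsum_congr fun x => ?_
    rw [← Finset.sum_smul, choose_identity]
  · intro r hr
    by_contra h
    rw [Finset.mem_coe, Finset.mem_range] at h
    refine hr ?_
    simp only
    rw [hneg1 _ _ _ (by omega), smul_zero]

/-! ### Cancellation of linear forms -/

/-- Series with exponents of `x₂` bounded below, and, for each such exponent, exponents of `x₁`
bounded below. -/
def iterOuter (W : Type*) [AddCommGroup W] [Module ℂ W] : Submodule ℂ (ℤ → ℤ → ℤ → W) where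
  carrier := {F | (∃ N, ∀ i, ∀ j < N, ∀ t, F i j t = 0) ∧
    ∀ k, ∃ N, ∀ j < k, ∀ i < N, ∀ t, F i j t = 0}
  zero_mem' := ⟨⟨0, fun _ _ _ _ => rfl⟩, fun _ => ⟨0, fun _ _ _ _ _ => rfl⟩⟩
  add_mem' := by
    rintro F G ⟨⟨N, hN⟩, hF⟩ ⟨⟨N', hN'⟩, hG⟩
    refine ⟨⟨min N N', fun i j hj t => ?_⟩, fun k => ?_⟩
    · simp [hN i j (by omega) t, hN' i j (by omega) t]
    · obtain ⟨K, hK⟩ := hF k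
      obtain ⟨K', hK'⟩ := hG k
      exact ⟨min K K', fun j hj i hi t => by
        simp [hK j hj i (by omega) t, hK' j hj i (by omega) t]⟩
  smul_mem' := by
    rintro c F ⟨⟨N, hN⟩, hF⟩
    refine ⟨⟨N, fun i j hj t => by simp [hN i j hj t]⟩, fun k => ?_⟩
    obtain ⟨K, hK⟩ := hF k
    exact ⟨K, fun j hj i hi t => by simp [hK j hj i hi t]⟩

/-- The exchange of the first two variables. -/
def swap01 : (ℤ → ℤ → ℤ → W) →ₗ[ℂ] (ℤ → ℤ → ℤ → W) where
  toFun F := fun m n t => F n m t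
  map_add' _ _ := rfl
  map_smul' _ _ := rfl

theorem iterOuter_X (l : Fin 3) (F : ℤ → ℤ → ℤ → W) (hF : F ∈ iterOuter W) :
    act3 (X l) F ∈ iterOuter W := by
  obtain ⟨⟨N, hN⟩, hF⟩ := hF
  refine ⟨⟨N, fun i j hj t => ?_⟩, fun k => ?_⟩
  · fin_cases l
    · exact (act3_X0 F i j t).trans (hN _ _ hj _)
    · exact (act3_X1 F i j t).trans (hN _ _ (by omega) _)
    · exact (act3_X2 F i j t).trans (hN _ _ hj _)
  · obtain ⟨K, hK⟩ := hF k
    refine ⟨K, fun j hj i hi t => ?_⟩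
    fin_cases l
    · exact (act3_X0 F i j t).trans (hK _ hj _ (by omega) _)
    · exact (act3_X1 F i j t).trans (hK _ (by omega) _ hi _)
    · exact (act3_X2 F i j t).trans (hK _ hj _ hi _)

theorem iterOuter_act (p : MvPolynomial (Fin 3) ℂ) {F : ℤ → ℤ → ℤ → W} (hF : F ∈ iterOuter W) :
    act3 p F ∈ iterOuter W := act_mem act3 (iterOuter W) iterOuter_X p hF

theorem swap01_X (F : ℤ → ℤ → ℤ → W) :
    swap01 (act3 (X 0) F) = act3 (X 1) (swap01 F) ∧
    swap01 (act3 (X 1) F) = act3 (X 0) (swap01 F) ∧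
    swap01 (act3 (X 2) F) = act3 (X 2) (swap01 F) := by
  refine ⟨?_, ?_, ?_⟩
  · ext m n t
    exact (act3_X0 F n m t).trans (act3_X1 (swap01 F) m n t).symm
  · ext m n t
    exact (act3_X1 F n m t).trans (act3_X0 (swap01 F) m n t).symm
  · ext m n t
    exact (act3_X2 F n m t).trans (act3_X2 (swap01 F) m n t).symm

theorem swap01_iterOuter_act (p : MvPolynomial (Fin 3) ℂ) {F : ℤ → ℤ → ℤ → W}
    (hF : swap01 F ∈ iterOuter W) : swap01 (act3 p F) ∈ iterOuter W := by
  refine act_mem act3 ((iterOuter W).comap swap01) (fun l F hF => ?_) p hF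
  rw [Submodule.mem_comap] at hF ⊢
  fin_cases l
  · exact (swap01_X F).1 ▸ iterOuter_X 1 _ hF
  · exact (swap01_X F).2.1 ▸ iterOuter_X 0 _ hF
  · exact (swap01_X F).2.2 ▸ iterOuter_X 2 _ hF

/-- Since β ≠ 0, the relation expresses the coefficients at (i, j) through those at (i-1, j) and (i,
j-1). Induction on j, and for fixed j on i from the bound N', propagates the vanishing. -/
theorem eq_zero_of_linear_aux {μ ν β : ℂ} (hβ : β ≠ 0) {F : ℤ → ℤ → ℤ → W}
    (h : ∀ i j t, μ • F (i - 1) j t + ν • F i (j - 1) t + β • F i j (t - 1) = 0) {N : ℤ}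
    (hN : ∀ i j t, i < N → j < N → F i j t = 0)
    (hk : ∀ k, ∃ N', ∀ j < k, ∀ i < N', i < N → ∀ t, F i j t = 0) :
    ∀ i j t, i < N → F i j t = 0 := by
  have hj : ∀ (k : ℕ) (j : ℤ), j < N + k → ∀ i < N, ∀ t, F i j t = 0 := by
    intro k
    induction k with
    | zero => exact fun j hj i hi t => hN i j t hi (by simpa using hj)
    | succ k ih =>
      intro j hj
      by_cases hjk : j < N + k
      · exact ih j hjk
      obtain ⟨N', hN'⟩ := hk (j + 1)
      have hi : ∀ (l : ℕ) (i : ℤ), i < N' + l → i < N → ∀ t, F i j t = 0 := by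
        intro l
        induction l with
        | zero => exact fun i hi hiN t => hN' j (by omega) i (by simpa using hi) hiN t
        | succ l ihl =>
          intro i hi hiN t
          have := h i j (t + 1)
          rw [ihl (i - 1) (by push_cast at hi; omega) (by omega),
            ih (j - 1) (by push_cast at hj; omega) i hiN, smul_zero, smul_zero, zero_add, zero_add,
            add_sub_cancel_right] at this
          exact (smul_eq_zero.1 this).resolve_left hβ
      exact fun i hiN t => hi (i - N' + 1).toNat i (by omega) hiN t
  exact fun i j t hi => hj (j - N + 1).toNat j (by omega) i hi t

theorem act3_linear (μ ν β : ℂ) (F : ℤ → ℤ → ℤ → W) (i j t : ℤ) :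
    act3 (C μ * X 0 + C ν * X 1 + C β * X 2) F i j t =
      μ • F (i - 1) j t + ν • F i (j - 1) t + β • F i j (t - 1) := by
  rw [map_add, map_add, LinearMap.add_apply, LinearMap.add_apply, act3_mul, act3_mul, act3_mul,
    act3_C, act3_C, act3_C]
  simp only [Pi.add_apply, Pi.smul_apply, act3_X0, act3_X1, act3_X2]

/-- F and G belong to opposite iterated expansions, so neither space alone permits the cancellation.
It works because the x₃-coefficient β is invertible and the exponents of x₃ are unrestricted on both
sides. -/
theorem linear_cancel {μ ν β : ℂ} (hβ : β ≠ 0) {F G : ℤ → ℤ → ℤ → W} (hF : F ∈ iterOuter W)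
    (hG : swap01 G ∈ iterOuter W)
    (h : act3 (C μ * X 0 + C ν * X 1 + C β * X 2) F =
      act3 (C μ * X 0 + C ν * X 1 + C β * X 2) G) : F = G := by
  have h0 : ∀ i j t, μ • (F - G) (i - 1) j t + ν • (F - G) i (j - 1) t +
      β • (F - G) i j (t - 1) = 0 := by
    intro i j t
    rw [← act3_linear, map_sub, h, sub_self]
    rfl
  obtain ⟨⟨N₁, hN₁⟩, hF⟩ := hF
  obtain ⟨⟨N₂, hN₂⟩, hG⟩ := hG
  have hG0 : ∀ i j t, i < N₂ → G i j t = 0 := fun i j t hi => hN₂ j i hi t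
  have hD : ∀ i j t, (F - G) i j t = F i j t - G i j t := fun _ _ _ => rfl
  -- For small i the series G drops out, and the bounds on F start the induction; for small j the
  -- roles are reversed.
  have hA : ∀ i j t, i < min N₁ N₂ → (F - G) i j t = 0 := by
    refine eq_zero_of_linear_aux hβ h0 (fun i j t hi hj => ?_) fun k => ?_
    · rw [hD, hN₁ i j (by omega) t, hG0 i j t (by omega), sub_zero]
    · obtain ⟨N', hN'⟩ := hF k
      refine ⟨N', fun j hj i hi hi' t => ?_⟩
      rw [hD, hN' j hj i hi t, hG0 i j t (by omega), sub_zero]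
  have hB : ∀ j i t, j < min N₁ N₂ → (F - G) i j t = 0 := by
    refine eq_zero_of_linear_aux (F := fun j i t => (F - G) i j t) (μ := ν) (ν := μ) hβ
      (fun j i t => ?_) (fun j i t hj hi => ?_) fun k => ?_
    · have := h0 i j t
      rw [add_comm (μ • _)] at this
      exact this
    · rw [hD, hN₁ i j (by omega) t, hG0 i j t (by omega), sub_zero]
    · obtain ⟨N', hN'⟩ := hG k
      refine ⟨N', fun i hi j hj hj' t => ?_⟩
      have : G i j t = 0 := hN' i hi j hj t
      rw [hD, hN₁ i j (by omega) t, this, sub_zero]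
  -- If i + j < 2 min(N₁, N₂), one of i, j is below the minimum. From there the relation propagates
  -- vanishing along i + j.
  have hC : ∀ (k : ℕ) (i j t : ℤ), i + j < 2 * min N₁ N₂ + k → (F - G) i j t = 0 := by
    intro k
    induction k with
    | zero =>
      intro i j t hij
      by_cases hi : i < min N₁ N₂
      · exact hA i j t hi
      · exact hB j i t (by push_cast at hij; omega)
    | succ k ih =>
      intro i j t hij
      have := h0 i j (t + 1)
      rw [ih (i - 1) j _ (by push_cast at hij; omega), ih i (j - 1) _ (by push_cast at hij; omega),
        smul_zero, smul_zero, zero_add, zero_add, add_sub_cancel_right] at this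
      exact (smul_eq_zero.1 this).resolve_left hβ
  refine sub_eq_zero.1 ?_
  ext i j t
  exact hC (i + j - 2 * min N₁ N₂ + 1).toNat i j t (by omega)

theorem act3_C_X_cancel {c : ℂ} (hc : c ≠ 0) (l : Fin 3) {F G : ℤ → ℤ → ℤ → W}
    (h : act3 (C c * X l) F = act3 (C c * X l) G) : F = G := by
  rw [act3_mul, act3_mul, act3_C, act3_C] at h
  have h' := smul_right_injective _ hc h
  ext i j t
  fin_cases l
  · have := congrFun (congrFun (congrFun h' (i + 1)) j) t
    have e := (act3_X0 F (i + 1) j t).symm.trans (this.trans (act3_X0 G (i + 1) j t))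
    rwa [add_sub_cancel_right] at e
  · have := congrFun (congrFun (congrFun h' i) (j + 1)) t
    have e := (act3_X1 F i (j + 1) t).symm.trans (this.trans (act3_X1 G i (j + 1) t))
    rwa [add_sub_cancel_right] at e
  · have := congrFun (congrFun (congrFun h' i) j) (t + 1)
    have e := (act3_X2 F i j (t + 1)).symm.trans (this.trans (act3_X2 G i j (t + 1)))
    rwa [add_sub_cancel_right] at e

theorem act3_C_mul_cancel {c : ℂ} (hc : c ≠ 0) (p : MvPolynomial (Fin 3) ℂ) {F G : ℤ → ℤ → ℤ → W}
    (h : act3 (C c * p) F = act3 (C c * p) G) : act3 p F = act3 p G := by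
  rw [act3_mul, act3_mul, act3_C, act3_C] at h
  exact smul_right_injective _ hc h

/-- After the substitutions, x_i - αx_j has x₃-coefficient 1 - α. For α ≠ 1 it cancels by
`linear_cancel`; for α = 1 there remain, up to sign, the first variable, the second, or their sum.
Variables cancel as shifts, so l counts the sums. It depends on p only. -/
theorem linForms_cancel {Γ : Subgroup ℂˣ} {p : MvPolynomial (Fin 3) ℂ}
    (hp : p ∈ linForms (Fin 3) Γ) : ∃ l : ℕ, ∀ F G : ℤ → ℤ → ℤ → W, F ∈ iterOuter W →
      swap01 G ∈ iterOuter W → act3 (sub12 (sub01 p)) F = act3 (sub12 (sub01 p)) G →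
        act3 ((X 0 + X 1) ^ l) F = act3 ((X 0 + X 1) ^ l) G := by
  induction hp using Submonoid.closure_induction with
  | one => exact ⟨0, fun F G _ _ _ => by simp_all⟩
  | mul p q _ _ hp hq =>
    obtain ⟨l, hl⟩ := hp
    obtain ⟨k, hk⟩ := hq
    refine ⟨k + l, fun F G hF hG h => ?_⟩
    rw [map_mul, map_mul, act3_mul, act3_mul] at h
    have h1 := hl _ _ (iterOuter_act _ hF) (swap01_iterOuter_act _ hG) h
    rw [act3_comm, act3_comm _ _ G] at h1
    have h2 := hk _ _ (iterOuter_act _ hF) (swap01_iterOuter_act _ hG) h1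
    rwa [pow_add, act3_mul, act3_mul]
  | mem d hd =>
    -- The three possible outcomes of the substitution: a nonzero x₃-coefficient, a multiple of a
    -- variable, and a multiple of x₁ + x₂; only the third costs a factor.
    have key0 : ∀ μ ν β : ℂ, β ≠ 0 →
        sub12 (sub01 d) = C μ * X 0 + C ν * X 1 + C β * X 2 →
        ∃ l : ℕ, ∀ F G : ℤ → ℤ → ℤ → W, F ∈ iterOuter W →
          swap01 G ∈ iterOuter W → act3 (sub12 (sub01 d)) F = act3 (sub12 (sub01 d)) G →
          act3 ((X 0 + X 1) ^ l) F = act3 ((X 0 + X 1) ^ l) G := by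
      intro μ ν β hβ e
      refine ⟨0, fun F G hF hG h => ?_⟩
      rw [e] at h
      rw [linear_cancel hβ hF hG h]
    have key1 : ∀ (c : ℂ) (i : Fin 3), c ≠ 0 → sub12 (sub01 d) = C c * X i →
        ∃ l : ℕ, ∀ F G : ℤ → ℤ → ℤ → W, F ∈ iterOuter W →
          swap01 G ∈ iterOuter W → act3 (sub12 (sub01 d)) F = act3 (sub12 (sub01 d)) G →
          act3 ((X 0 + X 1) ^ l) F = act3 ((X 0 + X 1) ^ l) G := by
      intro c i hc e
      refine ⟨0, fun F G hF hG h => ?_⟩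
      rw [e] at h
      rw [act3_C_X_cancel hc i h]
    have key2 : ∀ c : ℂ, c ≠ 0 → sub12 (sub01 d) = C c * (X 0 + X 1) →
        ∃ l : ℕ, ∀ F G : ℤ → ℤ → ℤ → W, F ∈ iterOuter W →
          swap01 G ∈ iterOuter W → act3 (sub12 (sub01 d)) F = act3 (sub12 (sub01 d)) G →
          act3 ((X 0 + X 1) ^ l) F = act3 ((X 0 + X 1) ^ l) G := by
      intro c hc e
      refine ⟨1, fun F G hF hG h => ?_⟩
      rw [e] at h
      rw [pow_one]
      exact act3_C_mul_cancel hc _ h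
    have hX0 : sub12 (sub01 (X 0)) = X 0 + X 1 + X 2 := by simp [sub01, sub12]; ring
    have hX1 : sub12 (sub01 (X 1)) = X 1 + X 2 := by simp [sub01, sub12]
    have hX2 : sub12 (sub01 (X 2)) = X 2 := by simp [sub01, sub12]
    have hC : ∀ c : ℂ, sub12 (sub01 (C c)) = C c := fun c => by simp [sub01, sub12]
    rcases hd with ⟨c, hc, rfl⟩ | ⟨i, rfl⟩ | ⟨i, j, hij, α, -, rfl⟩
    · refine ⟨0, fun F G hF hG h => ?_⟩
      rw [hC, ← mul_one (C c)] at h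
      simpa using act3_C_mul_cancel hc _ h
    · fin_cases i
      · exact key0 1 1 1 one_ne_zero (by simpa using hX0)
      · exact key0 0 1 1 one_ne_zero (by simpa using hX1)
      · exact key0 0 0 1 one_ne_zero (by simpa using hX2)
    · have hα0 : (α : ℂ) ≠ 0 := α.ne_zero
      have hgen : ∀ i j : Fin 3, sub12 (sub01 (X i - C (α : ℂ) * X j)) =
          sub12 (sub01 (X i)) - C (α : ℂ) * sub12 (sub01 (X j)) := fun i j => by
        rw [map_sub, map_sub, map_mul, map_mul, hC]
      by_cases h1 : (α : ℂ) = 1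
      · have h2 : (C (α : ℂ) : MvPolynomial (Fin 3) ℂ) = 1 := by rw [h1, map_one]
        have h3 : (C (-1 : ℂ) : MvPolynomial (Fin 3) ℂ) = -1 := by simp
        have hm : (-1 : ℂ) ≠ 0 := by norm_num
        fin_cases i <;> fin_cases j
        · exact absurd rfl hij
        · refine key1 1 0 one_ne_zero ((hgen 0 1).trans ?_)
          rw [hX0, hX1, h2, map_one]; ring
        · refine key2 1 one_ne_zero ((hgen 0 2).trans ?_)
          rw [hX0, hX2, h2, map_one]; ring
        · refine key1 (-1) 0 hm ((hgen 1 0).trans ?_)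
          rw [hX0, hX1, h2, h3]; ring
        · exact absurd rfl hij
        · refine key1 1 1 one_ne_zero ((hgen 1 2).trans ?_)
          rw [hX1, hX2, h2, map_one]; ring
        · refine key2 (-1) hm ((hgen 2 0).trans ?_)
          rw [hX0, hX2, h2, h3]; ring
        · refine key1 (-1) 1 hm ((hgen 2 1).trans ?_)
          rw [hX1, hX2, h2, h3]; ring
        · exact absurd rfl hij
      · have hs : 1 - (α : ℂ) ≠ 0 := sub_ne_zero.2 (Ne.symm h1)
        fin_cases i <;> fin_cases j
        · exact absurd rfl hij
        · refine key0 1 (1 - α) (1 - α) hs ((hgen 0 1).trans ?_)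
          rw [hX0, hX1, map_sub, map_one]; ring
        · refine key0 1 1 (1 - α) hs ((hgen 0 2).trans ?_)
          rw [hX0, hX2, map_sub, map_one]; ring
        · refine key0 (-α) (1 - α) (1 - α) hs ((hgen 1 0).trans ?_)
          rw [hX0, hX1, map_sub, map_one, map_neg]; ring
        · exact absurd rfl hij
        · refine key0 0 1 (1 - α) hs ((hgen 1 2).trans ?_)
          rw [hX1, hX2, map_sub, map_one, map_zero]; ring
        · refine key0 (-α) (-α) (1 - α) hs ((hgen 2 0).trans ?_)
          rw [hX0, hX2, map_sub, map_one, map_neg]; ring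
        · refine key0 0 (-α) (1 - α) hs ((hgen 2 1).trans ?_)
          rw [hX1, hX2, map_sub, map_one, map_zero, map_neg]; ring
        · exact absurd rfl hij

end Iterated

/-! ### Weak associativity -/

section WeakAssoc

variable {W : Type*} [AddCommGroup W] [Module ℂ W]

theorem exists_common_lower {P : ℤ → ℤ → Prop} (h : ∀ j, ∃ N, ∀ i < N, P j i) (a b : ℤ) :
    ∃ N, ∀ j, a ≤ j → j < b → ∀ i < N, P j i := by
  choose N hN using h
  obtain ⟨M, hM⟩ := ((Finset.Ico a b).image fun j => -N j).exists_le
  refine ⟨-M, fun j h1 h2 i hi => hN j i ?_⟩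
  have := hM (-N j) (Finset.mem_image_of_mem (fun j => -N j) (Finset.mem_Ico.2 ⟨h1, h2⟩))
  omega

theorem mem_iterOuter {F : ℤ → ℤ → ℤ → W} (h : ∃ K, ∀ i, ∀ j < K, ∀ t, F i j t = 0)
    (h' : ∀ j, ∃ N, ∀ i < N, ∀ t, F i j t = 0) : F ∈ iterOuter W := by
  refine ⟨h, fun k => ?_⟩
  obtain ⟨K, hK⟩ := h
  obtain ⟨N, hN⟩ := exists_common_lower h' K k
  refine ⟨N, fun j hj i hi t => ?_⟩
  by_cases hjK : j < K
  · exact hK i j hjK t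
  · exact hN j (by omega) hj i hi t

theorem substOuter3_mem_iterOuter {F : ℤ → ℤ → ℤ → W} (hF : F ∈ iterOuter W) :
    substOuter3 F ∈ iterOuter W := by
  obtain ⟨⟨K, hK⟩, h⟩ := hF
  refine ⟨⟨K, fun i j hj t => finsum_eq_zero_of_forall_eq_zero fun r => ?_⟩, fun k => ?_⟩
  · simp only
    rw [hK _ _ (by omega), smul_zero]
  · obtain ⟨N, hN⟩ := h k
    -- A nonzero term has j - r ≥ K with j < k, hence r < k - K and i + r < N.
    refine ⟨N - (k - K), fun j hj i hi t => finsum_eq_zero_of_forall_eq_zero fun r => ?_⟩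
    simp only
    by_cases hr : j - r < K
    · rw [hK _ _ hr, smul_zero]
    · rw [hN _ (by omega) _ (by omega), smul_zero]

/-- The series in three variables with exponents of `x₂` bounded below for each exponent
of `x₃`. -/
def boundedSnd3 (W : Type*) [AddCommGroup W] [Module ℂ W] : Submodule ℂ (ℤ → ℤ → ℤ → W) where
  carrier := {F | ∀ t, (fun m n => F m n t) ∈ boundedSnd W}
  zero_mem' := fun _ => zero_mem (boundedSnd W)
  add_mem' := fun hF hG t => add_mem (hF t) (hG t)
  smul_mem' := fun c _ hF t => Submodule.smul_mem _ c (hF t)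

theorem iterOuter_le_boundedSnd3 : iterOuter W ≤ boundedSnd3 W := by
  rintro F ⟨⟨K, hK⟩, -⟩ t
  exact ⟨K, fun m n hn => hK m n hn t⟩

theorem substOuter3_act (p : MvPolynomial (Fin 3) ℂ) {F : ℤ → ℤ → ℤ → W}
    (hF : F ∈ boundedSnd3 W) : substOuter3 (act3 p F) = act3 (sub01 p) (substOuter3 F) := by
  refine (act_intertwine act3 act3 sub01 (boundedSnd3 W) substOuter3 (fun F hF G hG => ?_)
    (fun c F hF => ?_) (fun i F hF t => ?_) (fun i F hF => ?_) p F hF).2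
  · ext i s t
    exact congrFun (congrFun (substOuter_add (hF t) (hG t)) i) s
  · ext i s t
    exact congrFun (congrFun (substOuter_smul c _) i) s
  · fin_cases i
    · convert boundedSnd_X 0 _ (hF t) using 1
      ext m n
      exact (act3_X0 F m n t).trans (by rw [act2_X0])
    · convert boundedSnd_X 1 _ (hF t) using 1
      ext m n
      exact (act3_X1 F m n t).trans (by rw [act2_X1])
    · convert hF (t - 1) using 1
      ext m n
      exact act3_X2 F m n t
  · ext j s t
    fin_cases i
    · have h : (fun m n => act3 (X 0) F m n t) = act2 (X 0) fun m n => F m n t := by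
        ext m n
        rw [act3_X0, act2_X0]
      have h' : sub01 (X 0) = X 0 + X 1 := by simp [sub01]
      have h'' : shiftHom (X 0) = X 0 + X 1 := by simp [shiftHom]
      change substOuter (fun m n => act3 (X 0) F m n t) j s =
        act3 (sub01 (X 0)) (substOuter3 F) j s t
      rw [h, substOuter_X 0 _ (hF t), h', h'', act2_X0_add_X1, map_add, LinearMap.add_apply,
        Pi.add_apply, Pi.add_apply, Pi.add_apply, act3_X0, act3_X1]
      rfl
    · have h : (fun m n => act3 (X 1) F m n t) = act2 (X 1) fun m n => F m n t := by
        ext m n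
        rw [act3_X1, act2_X1]
      have h' : sub01 (X 1) = X 1 := by simp [sub01]
      have h'' : shiftHom (X 1) = X 1 := by simp [shiftHom]
      change substOuter (fun m n => act3 (X 1) F m n t) j s =
        act3 (sub01 (X 1)) (substOuter3 F) j s t
      rw [h, substOuter_X 1 _ (hF t), h', h'', act2_X1, act3_X1]
      rfl
    · have h' : sub01 (X 2) = X 2 := by simp [sub01]
      change substOuter (fun m n => act3 (X 2) F m n t) j s =
        act3 (sub01 (X 2)) (substOuter3 F) j s t
      rw [h', act3_X2]
      simp only [act3_X2]
      rfl

/-- Both composites send x₁ to x₁ + x₂ + x₃ and x₂ to x₂ + x₃: the polynomial counterpart of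
`substOuter3_YSer`. -/
theorem sub01_sub02_sub12 (p : MvPolynomial (Fin 3) ℂ) :
    sub01 (sub02 (sub12 p)) = sub12 (sub01 p) := by
  have : (sub01.comp sub02).comp sub12 = sub12.comp sub01 := by
    refine MvPolynomial.algHom_ext fun i => ?_
    fin_cases i <;> simp [sub01, sub02, sub12]
    ring
  exact DFunLike.congr_fun this p

/-- The series of operators whose exponents of `x_j` are bounded below on each vector. -/
def lower3 (W : Type*) [AddCommGroup W] [Module ℂ W] (j : Fin 3) :
    Submodule ℂ (ℤ → ℤ → ℤ → Module.End ℂ W) where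
  carrier := {F | ∀ w, ∃ N, ∀ m n t, ![m, n, t] j < N → F m n t w = 0}
  zero_mem' := fun _ => ⟨0, fun _ _ _ _ => rfl⟩
  add_mem' := fun {F G} hF hG w => by
    obtain ⟨N, hN⟩ := hF w
    obtain ⟨N', hN'⟩ := hG w
    exact ⟨min N N', fun m n t h => by
      simp [hN m n t (lt_of_lt_of_le h (min_le_left _ _)),
        hN' m n t (lt_of_lt_of_le h (min_le_right _ _))]⟩
  smul_mem' := fun c F hF w => by
    obtain ⟨N, hN⟩ := hF w
    exact ⟨N, fun m n t h => by simp [hN m n t h]⟩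

theorem lower3_X (j i : Fin 3) (F : ℤ → ℤ → ℤ → Module.End ℂ W) (hF : F ∈ lower3 W j) :
    act3 (X i) F ∈ lower3 W j := by
  intro w
  obtain ⟨N, hN⟩ := hF w
  refine ⟨N, fun m n t h => ?_⟩
  fin_cases i
  · refine (LinearMap.congr_fun (act3_X0 F m n t) w).trans (hN _ _ _ ?_)
    fin_cases j <;> simp at h ⊢ <;> omega
  · refine (LinearMap.congr_fun (act3_X1 F m n t) w).trans (hN _ _ _ ?_)
    fin_cases j <;> simp at h ⊢ <;> omega
  · refine (LinearMap.congr_fun (act3_X2 F m n t) w).trans (hN _ _ _ ?_)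
    fin_cases j <;> simp at h ⊢ <;> omega

theorem lower3_act (j : Fin 3) (p : MvPolynomial (Fin 3) ℂ)
    {F : ℤ → ℤ → ℤ → Module.End ℂ W} (hF : F ∈ lower3 W j) : act3 p F ∈ lower3 W j :=
  act_mem act3 (lower3 W j) (lower3_X j) p hF

theorem locSpan_lower3 {Γ : Subgroup ℂˣ} {j : Fin 3} {S : Set (ℤ → ℤ → ℤ → Module.End ℂ W)}
    (hS : S ⊆ lower3 W j) {F : ℤ → ℤ → ℤ → Module.End ℂ W} (hF : F ∈ locSpan act3 Γ S) :
    ∃ p ∈ linForms (Fin 3) Γ, act3 p F ∈ lower3 W j := by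
  obtain ⟨p, hp, hF⟩ := hF
  exact ⟨p, hp, polySpan_le (lower3_X j) hS hF⟩

/-- A variable is bounded below on each vector when its field acts first. This is already so for x₃;
exchanging b with c achieves it for x₂; moving c to the far left and then exchanging the other two
achieves it for x₁. The product of the forms used serves all variables and all w. -/
theorem Exchange.exists_bounded3 {Γ : Subgroup ℂˣ} {A : Set (E W)} (h : Exchange Γ A A)
    {a b c : E W} (ha : a ∈ A) (hb : b ∈ A) (hc : c ∈ A) : ∃ p ∈ linForms (Fin 3) Γ,
      ∀ w, IsBounded3 (act3 p (post3 (LinearMap.applyₗ w) (opTriple a b c))) := by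
  have h2 : opTriple a b c ∈ lower3 W 2 := fun w => by
    obtain ⟨N, hN⟩ := laurent_lower (c w)
    refine ⟨N, fun m n t ht => ?_⟩
    change coeffEnd a m (coeffEnd b n ((c w).coeff t)) = 0
    rw [hN t (by simpa using ht), map_zero, map_zero]
  obtain ⟨p, hp, h1⟩ : ∃ p ∈ linForms (Fin 3) Γ, act3 p (opTriple a b c) ∈ lower3 W 1 := by
    have e : opTriple a b c = mulLeft3 a (opProd b c) := by
      ext m n t : 3
      exact mul_assoc _ _ _
    rw [e]
    refine locSpan_lower3 (S := (lower3 W 1 : Set _)) subset_rfl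
      (mulLeft3_mem a locSpan_isSaturated ?_ (h b hb c hc))
    rintro _ ⟨b', -, c', -, rfl⟩
    refine subset_locSpan fun w => ?_
    obtain ⟨N, hN⟩ := laurent_lower (b' w)
    refine ⟨N, fun m n t ht => ?_⟩
    change coeffEnd a m (coeffEnd c' t ((b' w).coeff n)) = 0
    rw [hN n (by simpa using ht), map_zero, map_zero]
  obtain ⟨q, hq, h0⟩ : ∃ p ∈ linForms (Fin 3) Γ, act3 p (opTriple a b c) ∈ lower3 W 0 := by
    refine locSpan_lower3 (S := (lower3 W 0 : Set _)) subset_rfl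
      (mem_of_mem_locSpan locSpan_isSaturated ?_ (h.triple ha hb hc))
    rintro _ ⟨a', ha', b', hb', c', -, rfl⟩
    have e : opTripleRot a' b' c' = mulThird3 c' (opProd a' b') := by
      ext m n t : 3
      exact mul_assoc _ _ _
    rw [e]
    refine mulThird3_mem c' locSpan_isSaturated ?_ (h a' ha' b' hb')
    rintro _ ⟨a'', -, b'', -, rfl⟩
    refine subset_locSpan fun w => ?_
    obtain ⟨N, hN⟩ := laurent_lower (a'' w)
    refine ⟨N, fun m n t ht => ?_⟩
    change coeffEnd c' t (coeffEnd b'' n ((a'' w).coeff m)) = 0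
    rw [hN m (by simpa using ht), map_zero, map_zero]
  refine ⟨p * q, mul_mem hp hq, fun w => ?_⟩
  have e0 : act3 (p * q) (opTriple a b c) ∈ lower3 W 0 := by
    rw [act3_mul]
    exact lower3_act 0 p h0
  have e1 : act3 (p * q) (opTriple a b c) ∈ lower3 W 1 := by
    rw [mul_comm, act3_mul]
    exact lower3_act 1 q h1
  have e2 : act3 (p * q) (opTriple a b c) ∈ lower3 W 2 := lower3_act 2 _ h2
  obtain ⟨N₀, hN₀⟩ := e0 w
  obtain ⟨N₁, hN₁⟩ := e1 w
  obtain ⟨N₂, hN₂⟩ := e2 w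
  rw [← post3_act]
  refine ⟨min N₀ (min N₁ N₂), fun m n t hmnt => ?_⟩
  rcases hmnt with hm | hn | ht
  · exact hN₀ m n t (by simp only [Matrix.cons_val]; omega)
  · exact hN₁ m n t (by simp only [Matrix.cons_val]; omega)
  · exact hN₂ m n t (by simp only [Matrix.cons_val]; omega)

theorem YSer_zero : YSer (0 : ℤ → ℤ → W) = 0 := by
  have := YSer_smul (0 : ℂ) (zero_mem (clearable W))
  rwa [zero_smul, zero_smul] at this

theorem quasiCompatible_zero_left (b : E W) : QuasiCompatible 0 b :=
  quasiCompatible_of_bounded fun _ => ⟨0, fun _ _ _ => rfl⟩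

theorem quasiCompatible_zero_right (a : E W) : QuasiCompatible a 0 :=
  quasiCompatible_of_bounded fun _ => ⟨0, fun _ _ _ => by simp [prodSeries]⟩

theorem nprod_zero_left (b : E W) (n : ℤ) : nprod 0 b n = 0 := by
  ext w s
  have e : prodSeries 0 b w = 0 := rfl
  rw [nprod_coeff (quasiCompatible_zero_left b), e, YSer_zero]
  rfl

theorem nprod_zero_right (a : E W) (n : ℤ) : nprod a 0 n = 0 := by
  ext w s
  have e : prodSeries a 0 w = 0 := by ext m n; simp [prodSeries]
  rw [nprod_coeff (quasiCompatible_zero_right a), e, YSer_zero]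
  rfl

/-- The coefficients of `Y_E(a, x₁) Y_E(b, x₂) c w`. -/
def iterLeft (a b c : E W) (w : W) : ℤ → ℤ → ℤ → W :=
  fun i j t => (nprod a (nprod b c (-j - 1)) (-i - 1) w).coeff t

/-- The coefficients of `Y_E(Y_E(a, x₀) b, x₂) c w`. -/
def iterRight (a b c : E W) (w : W) : ℤ → ℤ → ℤ → W :=
  fun i j t => (nprod (nprod a b (-i - 1)) c (-j - 1) w).coeff t

theorem act3_rename_last (p : MvPolynomial (Fin 2) ℂ) (F : ℤ → ℤ → ℤ → W) (t : ℤ) :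
    (fun m n => act3 (MvPolynomial.rename ![0, 1] p) F m n t) =
      act2 p (fun m n => F m n t) := by
  refine act_natural (act3.comp (MvPolynomial.rename ![0, 1])) act2
    ({ toFun := fun F m n => F m n t, map_add' := fun _ _ => rfl, map_smul' := fun _ _ => rfl } :
      (ℤ → ℤ → ℤ → W) →ₗ[ℂ] (ℤ → ℤ → W)) (fun j F => ?_) p F
  rw [AlgHom.comp_apply, MvPolynomial.rename_X]
  ext m n
  fin_cases j
  · exact (act3_X0 F m n t).trans (act2_X0 (fun m n => F m n t) m n).symm
  · exact (act3_X1 F m n t).trans (act2_X1 (fun m n => F m n t) m n).symm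

/-- Both iterates are `YSer` images of a(x₁)b(x₂)c(x₃)w. They are compared on the bounded series
p·abc·w, and p is then cancelled by `linForms_cancel`, which requires the opposite truncation
properties `hB` and `hC`. -/
theorem Exchange.weak_assoc {Γ : Subgroup ℂˣ} {A : Set (E W)} (h : Exchange Γ A A)
    (hA : ∀ a ∈ A, ∀ b ∈ A, ∀ n, nprod a b n ∈ A) {a b c : E W}
    (ha : a ∈ A) (hb : b ∈ A) (hc : c ∈ A) : ∃ l : ℕ, ∀ (w : W) (t : ℤ),
      act2 ((X 0 + X 1) ^ l) (substOuter fun i j => iterLeft a b c w i j t) =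
        act2 ((X 0 + X 1) ^ l) (fun i j => iterRight a b c w i j t) := by
  obtain ⟨p, hp, hbd⟩ := h.exists_bounded3 ha hb hc
  obtain ⟨l, hl⟩ := linForms_cancel (W := W) hp
  have qc : ∀ {a b : E W}, a ∈ A → b ∈ A → QuasiCompatible a b := fun ha hb =>
    h.quasiCompatible ha hb
  refine ⟨l, fun w t => ?_⟩
  set F := post3 (LinearMap.applyₗ w) (opTriple a b c) with hF
  have h12 : F ∈ clearable12 W := fun m =>
    clearable_post (coeffEnd a m) ((qc hb hc).clearable w)
  have h01 : F ∈ clearable01 W := fun t => (qc ha hb).clearable ((c w).coeff t)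
  have e12 : YSer12 F = fun m j s => prodSeries a (nprod b c (-j - 1)) w m s := by
    ext m j s
    refine (congrFun (congrFun (YSer_post (coeffEnd a m) ((qc hb hc).clearable w)) j) s).trans ?_
    exact congrArg (coeffEnd a m) (nprod_coeff' (qc hb hc) j w s).symm
  have e01 : YSer01 F = fun i s t => prodSeries (nprod a b (-i - 1)) c w s t := by
    ext i s t
    exact (nprod_coeff' (qc ha hb) i _ s).symm
  have h02 : YSer12 F ∈ clearable02 W := fun j => by
    rw [e12]
    exact (qc ha (hA b hb c hc _)).clearable w
  have h12' : YSer01 F ∈ clearable12 W := fun i => by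
    rw [e01]
    exact (qc (hA a ha b hb _) hc).clearable w
  have e02 : YSer02 (YSer12 F) = iterLeft a b c w := by
    ext i j s
    rw [e12]
    exact (nprod_coeff' (qc ha (hA b hb c hc _)) i w s).symm
  have e12' : YSer12 (YSer01 F) = iterRight a b c w := by
    ext i j s
    rw [e01]
    exact (nprod_coeff' (qc (hA a ha b hb _) hc) j w s).symm
  have hB : iterLeft a b c w ∈ iterOuter W := by
    refine mem_iterOuter ?_ fun j => ?_
    · obtain ⟨K, hK⟩ := nprod_truncated (qc hb hc)
      refine ⟨K, fun i j hj t => ?_⟩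
      rw [iterLeft, hK j hj, nprod_zero_right]
      rfl
    · obtain ⟨K, hK⟩ := nprod_truncated (qc ha (hA b hb c hc (-j - 1)))
      refine ⟨K, fun i hi t => ?_⟩
      rw [iterLeft, hK i hi]
      rfl
  have hC : swap01 (iterRight a b c w) ∈ iterOuter W := by
    refine mem_iterOuter ?_ fun j => ?_
    · obtain ⟨K, hK⟩ := nprod_truncated (qc ha hb)
      refine ⟨K, fun i j hj t => ?_⟩
      change (nprod (nprod a b (-j - 1)) c (-i - 1) w).coeff t = 0
      rw [hK j hj, nprod_zero_left]
      rfl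
    · obtain ⟨K, hK⟩ := nprod_truncated (qc (hA a ha b hb (-j - 1)) hc)
      refine ⟨K, fun i hi t => ?_⟩
      change (nprod (nprod a b (-j - 1)) c (-i - 1) w).coeff t = 0
      rw [hK i hi]
      rfl
  have key := substOuter3_YSer (hbd w)
  obtain ⟨-, k1⟩ := YSer12_act p h12
  obtain ⟨-, k2⟩ := YSer02_act (sub12 p) h02
  obtain ⟨-, k3⟩ := YSer01_act p h01
  obtain ⟨-, k4⟩ := YSer12_act (sub01 p) h12'
  -- The substituted p comes out in front; on both sides it is the same polynomial by
  -- `sub01_sub02_sub12`.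
  rw [k1, k2, k3, k4, e02, e12', substOuter3_act _ (iterOuter_le_boundedSnd3 hB),
    sub01_sub02_sub12] at key
  have fin := hl _ _ (substOuter3_mem_iterOuter hB) hC key
  -- The power does not involve x₃, so the identity can be read off at each exponent t separately.
  have e : ((X 0 + X 1) ^ l : MvPolynomial (Fin 3) ℂ) =
      MvPolynomial.rename ![0, 1] ((X 0 + X 1) ^ l : MvPolynomial (Fin 2) ℂ) := by simp
  rw [e] at fin
  have s1 := act3_rename_last ((X 0 + X 1) ^ l) (substOuter3 (iterLeft a b c w)) t
  have s2 := act3_rename_last ((X 0 + X 1) ^ l) (iterRight a b c w) t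
  rw [fin] at s1
  exact s1.symm.trans s2

end WeakAssoc

/-! ### Exchange relations and pseudo `Γ`-locality -/

section Ratio

variable {W : Type*} [AddCommGroup W] [Module ℂ W]

theorem shift2_mul (i j i' j' : ℤ) :
    (shift2 i j * shift2 i' j' : Module.End ℂ (ℤ → ℤ → W)) = shift2 (i + i') (j + j') := by
  ext F m n
  simp [shift2, sub_sub]

theorem shift2_pow (k : ℕ) :
    (shift2 1 (-1) ^ k : Module.End ℂ (ℤ → ℤ → W)) = shift2 k (-k) := by
  induction k with
  | zero => ext F m n; simp [shift2]
  | succ k ih =>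
    rw [pow_succ, ih, shift2_mul]
    push_cast
    rw [neg_add]

theorem ratioMul_eq_aeval (p : Polynomial ℂ) (F : ℤ → ℤ → W) :
    ratioMul p F = Polynomial.aeval (shift2 1 (-1) : Module.End ℂ (ℤ → ℤ → W)) p F := by
  ext m n
  rw [Polynomial.aeval_eq_sum_range' (Nat.lt_succ_self _), ratioMul]
  simp only [LinearMap.sum_apply, Finset.sum_apply, shift2_pow]
  rw [Finset.sum_subset Polynomial.supp_subset_range_natDegree_succ]
  · simp [shift2]
  · intro k _ hk
    rw [Polynomial.notMem_support_iff.1 hk, zero_smul]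

theorem ratioMul_sum {ι : Type*} (s : Finset ι) (p : Polynomial ℂ) (F : ι → ℤ → ℤ → W) :
    ratioMul p (∑ i ∈ s, F i) = ∑ i ∈ s, ratioMul p (F i) := by
  simp only [ratioMul_eq_aeval, map_sum]

theorem ratioMul_mul (p q : Polynomial ℂ) (F : ℤ → ℤ → W) :
    ratioMul (p * q) F = ratioMul p (ratioMul q F) := by
  simp only [ratioMul_eq_aeval, map_mul, Module.End.mul_apply]

theorem ratioMul_one (F : ℤ → ℤ → W) : ratioMul 1 F = F := by
  simp only [ratioMul_eq_aeval, map_one, Module.End.one_apply]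

theorem ratioMul_smul (p : Polynomial ℂ) (c : ℂ) (F : ℤ → ℤ → W) :
    ratioMul p (c • F) = c • ratioMul p F := by
  simp only [ratioMul_eq_aeval, map_smul]

theorem ratioMul_linear (c : ℂ) (F : ℤ → ℤ → W) (m n : ℤ) :
    ratioMul (Polynomial.X - Polynomial.C c) F m n = F (m - 1) (n + 1) - c • F m n := by
  simp [ratioMul_eq_aeval, shift2]

theorem ratioMul_shift2 (p : Polynomial ℂ) (i j : ℤ) (F : ℤ → ℤ → W) :
    ratioMul p (shift2 i j F) = shift2 i j (ratioMul p F) := by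
  ext m n
  simp only [ratioMul, shift2, LinearMap.coe_mk, AddHom.coe_mk]
  refine Finset.sum_congr rfl fun k _ => ?_
  congr 2 <;> ring

theorem polyΓ_ne_zero {Γ : Subgroup ℂˣ} {p : Polynomial ℂ} (hp : p ∈ polyΓ Γ) : p ≠ 0 := by
  induction hp using Submonoid.closure_induction with
  | mem p hp =>
    obtain ⟨α, -, rfl⟩ := hp
    exact Polynomial.X_sub_C_ne_zero _
  | one => exact one_ne_zero
  | mul p q _ _ hp hq => exact mul_ne_zero hp hq

/-- Products of linear forms are homogeneous, hence a monomial times a polynomial in x₁/x₂, as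
pseudo locality demands. In particular x₂ - αx₁ = -αx₂(x₁/x₂ - α⁻¹). -/
theorem linForms_ratio {Γ : Subgroup ℂˣ} {d : MvPolynomial (Fin 2) ℂ}
    (hd : d ∈ linForms (Fin 2) Γ) : ∃ c : ℂ, c ≠ 0 ∧ ∃ i j : ℤ, ∃ p ∈ polyΓ Γ,
      ∀ F : ℤ → ℤ → W, act2 d F = c • shift2 i j (ratioMul p F) := by
  induction hd using Submonoid.closure_induction with
  | one =>
    refine ⟨1, one_ne_zero, 0, 0, 1, one_mem _, fun F => ?_⟩
    ext m n
    simp [ratioMul_one, shift2]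
  | mul d e _ _ hd he =>
    obtain ⟨c, hc, i, j, p, hp, h⟩ := hd
    obtain ⟨c', hc', i', j', p', hp', h'⟩ := he
    refine ⟨c * c', mul_ne_zero hc hc', i + i', j + j', p * p', mul_mem hp hp', fun F => ?_⟩
    rw [act2_mul, h', h, ratioMul_smul, ratioMul_shift2, map_smul, smul_smul,
      ← Module.End.mul_apply, shift2_mul, ratioMul_mul]
  | mem d hd =>
    rcases hd with ⟨c, hc, rfl⟩ | ⟨i, rfl⟩ | ⟨i, j, hij, α, hα, rfl⟩
    · refine ⟨c, hc, 0, 0, 1, one_mem _, fun F => ?_⟩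
      rw [act2_C, ratioMul_one]
      ext m n
      simp [shift2]
    · fin_cases i
      · refine ⟨1, one_ne_zero, 1, 0, 1, one_mem _, fun F => ?_⟩
        ext m n
        refine (act2_X0 F m n).trans ?_
        simp [ratioMul_one, shift2]
      · refine ⟨1, one_ne_zero, 0, 1, 1, one_mem _, fun F => ?_⟩
        ext m n
        refine (act2_X1 F m n).trans ?_
        simp [ratioMul_one, shift2]
    · have hsub : ∀ (k l : Fin 2) (β : ℂ) (F : ℤ → ℤ → W) (m n : ℤ),
          act2 (X k - C β * X l) F m n = act2 (X k) F m n - β • act2 (X l) F m n := by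
        intro k l β F m n
        rw [map_sub, LinearMap.sub_apply, act2_mul, act2_C]
        rfl
      fin_cases i <;> fin_cases j
      · exact absurd rfl hij
      · refine ⟨1, one_ne_zero, 0, 1, Polynomial.X - Polynomial.C (α : ℂ),
          Submonoid.subset_closure ⟨α, hα, rfl⟩, fun F => ?_⟩
        ext m n
        refine (hsub 0 1 α F m n).trans ?_
        rw [act2_X0, act2_X1, one_smul]
        change _ = ratioMul _ F (m - 0) (n - 1)
        rw [ratioMul_linear, sub_zero, sub_add_cancel]
      · refine ⟨-α, neg_ne_zero.2 α.ne_zero, 0, 1, Polynomial.X - Polynomial.C ((α⁻¹ : ℂˣ) : ℂ),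
          Submonoid.subset_closure ⟨α⁻¹, inv_mem hα, rfl⟩, fun F => ?_⟩
        ext m n
        refine (hsub 1 0 α F m n).trans ?_
        rw [act2_X0, act2_X1]
        change _ = -(α : ℂ) • ratioMul _ F (m - 0) (n - 1)
        rw [ratioMul_linear, sub_zero, sub_add_cancel, smul_sub, smul_smul, neg_smul, neg_mul,
          Units.mul_inv, neg_smul, one_smul]
        abel
      · exact absurd rfl hij

/-- The inclusion of `C[x, y]` into `C[[x, y]]`. -/
def polyPS : MvPolynomial (Fin 2) ℂ →ₐ[ℂ] PowerSeries2 := MvPolynomial.aeval ![varX, varY]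

theorem algebraMap_PowerSeries2 (c : ℂ) :
    algebraMap ℂ PowerSeries2 c = PowerSeries.C (PowerSeries.C c) := by
  rw [PowerSeries.algebraMap_apply, PowerSeries.algebraMap_apply]
  rfl

theorem embedPS_polyPS (p : MvPolynomial (Fin 2) ℂ) : embedPS (polyPS p) = polyLaurent p := by
  have hX : ∀ i, embedPS (polyPS (X i)) = polyLaurent (X i) := fun i => by
    fin_cases i <;> simp [embedPS, polyPS, polyLaurent, varX, varY]
  induction p using MvPolynomial.induction_on with
  | C c =>
    rw [← MvPolynomial.algebraMap_eq, AlgHom.commutes, algebraMap_PowerSeries2]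
    simp [embedPS, polyLaurent]
  | add p q hp hq => rw [map_add, map_add, map_add, hp, hq]
  | mul_X p i hp => rw [map_mul, map_mul, map_mul, hp, hX]

theorem linForms_denominators {Γ : Subgroup ℂˣ} {d : MvPolynomial (Fin 2) ℂ}
    (hd : d ∈ linForms (Fin 2) Γ) : ∃ c : ℂ, c ≠ 0 ∧ ∃ e ∈ denominators Γ, polyPS d = c • e := by
  induction hd using Submonoid.closure_induction with
  | one => exact ⟨1, one_ne_zero, 1, one_mem _, by rw [map_one, one_smul]⟩
  | mul d e _ _ hd he =>
    obtain ⟨c, hc, p, hp, h⟩ := hd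
    obtain ⟨c', hc', p', hp', h'⟩ := he
    exact ⟨c * c', mul_ne_zero hc hc', p * p', mul_mem hp hp', by
      rw [map_mul, h, h', smul_mul_smul_comm]⟩
  | mem d hd =>
    have hX0 : polyPS (X 0) = varX := by simp [polyPS]
    have hX1 : polyPS (X 1) = varY := by simp [polyPS]
    have hsub : ∀ (k l : Fin 2) (β : ℂ),
        polyPS (X k - C β * X l) = polyPS (X k) - β • polyPS (X l) := by
      intro k l β
      rw [map_sub, ← MvPolynomial.smul_eq_C_mul, map_smul]
    rcases hd with ⟨c, hc, rfl⟩ | ⟨i, rfl⟩ | ⟨i, j, hij, α, hα, rfl⟩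
    · refine ⟨c, hc, 1, one_mem _, ?_⟩
      rw [← MvPolynomial.algebraMap_eq, AlgHom.commutes, Algebra.algebraMap_eq_smul_one]
    · fin_cases i
      · exact ⟨1, one_ne_zero, varX, Submonoid.subset_closure (Or.inl (Or.inl rfl)),
          hX0.trans (one_smul _ _).symm⟩
      · exact ⟨1, one_ne_zero, varY, Submonoid.subset_closure (Or.inl (Or.inr rfl)),
          hX1.trans (one_smul _ _).symm⟩
    · fin_cases i <;> fin_cases j
      · exact absurd rfl hij
      · refine ⟨1, one_ne_zero, varX - (α : ℂ) • varY,
          Submonoid.subset_closure (Or.inr ⟨α, hα, rfl⟩), (hsub 0 1 α).trans ?_⟩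
        rw [hX0, hX1, one_smul]
      · refine ⟨-α, neg_ne_zero.2 α.ne_zero, varX - ((α⁻¹ : ℂˣ) : ℂ) • varY,
          Submonoid.subset_closure (Or.inr ⟨α⁻¹, inv_mem hα, rfl⟩), (hsub 1 0 α).trans ?_⟩
        rw [hX0, hX1, smul_sub, smul_smul, neg_mul, Units.mul_inv, neg_smul, neg_smul, one_smul]
        abel
      · exact absurd rfl hij

theorem exists_ratΓ {Γ : Subgroup ℂˣ} {d : MvPolynomial (Fin 2) ℂ}
    (hd : d ∈ linForms (Fin 2) Γ) (f : MvPolynomial (Fin 2) ℂ) :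
    ∃ ψ : RatΓ Γ, polyLaurent d * iota Γ ψ = polyLaurent f := by
  obtain ⟨c, hc, e, he, h⟩ := linForms_denominators hd
  have h1 : ∀ x, iota Γ (algebraMap PowerSeries2 (RatΓ Γ) x) = embedPS x := fun x =>
    IsLocalization.lift_eq _ x
  -- The element is f/d. The monoid `denominators` has no generators for the constants, so the
  -- scalar c in d = c·e is moved to the numerator.
  refine ⟨IsLocalization.mk' (RatΓ Γ) (polyPS (C c⁻¹ * f)) (⟨e, he⟩ : denominators Γ), ?_⟩
  have h2 := IsLocalization.mk'_spec (RatΓ Γ) (polyPS (C c⁻¹ * f)) (⟨e, he⟩ : denominators Γ)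
  have h3 := congrArg (iota Γ) h2
  rw [map_mul, h1, h1, embedPS_polyPS] at h3
  have h4 : polyLaurent d = polyLaurent (C c) * embedPS e := by
    rw [← embedPS_polyPS, ← embedPS_polyPS, h, ← map_mul, ← MvPolynomial.algebraMap_eq,
      AlgHom.commutes, Algebra.smul_def]
  have h5 : ∀ {R : Type} [CommRing R] {x y z t : R}, z * y = t → x * y * z = x * t := by
    rintro R _ x y z t rfl
    ring
  rw [h4]
  refine (h5 (R := Laurent2) h3).trans ?_
  rw [← map_mul, ← mul_assoc, ← map_mul, mul_inv_cancel₀ hc, map_one, one_mul]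

theorem swap_prodSeries_mem (u v : E W) (w : W) :
    (fun m n => prodSeries u v w n m) ∈ iterLaurent W := by
  refine ⟨?_, fun m => laurent_lower (u ((v w).coeff m))⟩
  obtain ⟨N, hN⟩ := laurent_lower (v w)
  refine ⟨N, fun m hm n => ?_⟩
  simp [prodSeries, hN m hm]

/-- If d·a(x₁)b(x₂) = Σ s_k f_k u_k(x₂)v_k(x₁), then ψ_k = s_k f_k / d. The series a(x₁)b(x₂)w does
not lie in W((x₂))((x₁)) in general, so d itself cannot be cancelled; this is why p(x₁/x₂) stays on
both sides. -/
theorem Exchange.pseudoLocal {Γ : Subgroup ℂˣ} {A : Set (E W)} (h : Exchange Γ A A) :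
    PseudoLocal Γ A := by
  intro a ha b hb
  obtain ⟨d, hd, hF⟩ := h a ha b hb
  obtain ⟨c, hc, i, j, p, hp, hdp⟩ := linForms_ratio (W := W) hd
  obtain ⟨r, s, g, hsum⟩ := (Submodule.mem_span_set' ..).1 hF
  choose f G hG hgG using fun k => (g k).2
  choose v hv u hu hGuv using hG
  choose ψ hψ using fun k => exists_ratΓ hd (C (s k) * f k)
  refine ⟨p, hp, polyΓ_ne_zero hp, r, ψ, u, v, fun k => ⟨hu k, hv k⟩, fun w => ?_⟩
  rw [← ratioMul_sum]
  have key : act2 d (prodSeries a b w) =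
      act2 d (∑ k, laurentMul (iota Γ (ψ k)) fun m n => prodSeries (u k) (v k) w n m) := by
    have e1 : prodSeries a b w = post2 (LinearMap.applyₗ w) (opProd a b) := rfl
    rw [e1, ← post2_act, ← hsum, map_sum, map_sum]
    refine Finset.sum_congr rfl fun k _ => ?_
    have hm := swap_prodSeries_mem (u k) (v k) w
    rw [← laurentMul_polyLaurent _ (laurentMul_mem _ hm), ← laurentMul_mul _ _ hm, hψ k,
      laurentMul_polyLaurent _ hm, hgG k, hGuv k, map_smul, post2_act, act2_mul, act2_C]
    rfl
  -- Of d, the constant and the monomial are invertible; what remains is the factor p(x₁/x₂).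
  rw [hdp, hdp] at key
  have k2 := congrArg (shift2 (-i) (-j)) (smul_right_injective _ hc key)
  rw [← Module.End.mul_apply, ← Module.End.mul_apply, shift2_mul, neg_add_cancel,
    neg_add_cancel] at k2
  ext m n
  simpa [shift2] using congrFun (congrFun k2 m) n

end Ratio

/-! ### The nonlocal vertex algebra of a closed subspace -/

section Closed

variable {W : Type*} [AddCommGroup W] [Module ℂ W]

theorem boundedSnd_prodSeries (a b : E W) (w : W) : prodSeries a b w ∈ boundedSnd W := by
  obtain ⟨N, hN⟩ := laurent_lower (b w)
  exact ⟨N, fun m n hn => by simp [prodSeries, hN n hn]⟩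

theorem act2_X0_pow (k : ℕ) (F : ℤ → ℤ → W) (m n : ℤ) :
    act2 (X 0 ^ k) F m n = F (m - k) n := by
  induction k generalizing m with
  | zero => simp
  | succ k ih =>
    rw [pow_succ', act2_mul, act2_X0, ih]
    congr 1
    push_cast
    ring

theorem QuasiCompatible.quasi_assoc {a b : E W} (h : QuasiCompatible a b) (w : W) :
    ∃ f : MvPolynomial (Fin 2) ℂ, f ≠ 0 ∧
      act2 (shiftHom f) (substOuter (prodSeries a b w)) =
        act2 (shiftHom f) (fun i s => (nprod a b (-i - 1) w).coeff s) := by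
  obtain ⟨p, hp, hb⟩ := h.exists_forall
  have hY : (fun i s => (nprod a b (-i - 1) w).coeff s) = YSer (prodSeries a b w) := by
    ext i s
    exact nprod_coeff' h i w s
  obtain ⟨N, hN⟩ := hb w
  -- A power of x₁ clears the negative exponents, so that expanding x₁ = x₀ + x₂ in powers of x₂ or
  -- of x₀ gives the same result. The power may depend on w.
  have hf : X 0 ^ (-N).toNat * p ≠ 0 := mul_ne_zero (pow_ne_zero _ (MvPolynomial.X_ne_zero 0)) hp
  have hb' : act2 (X 0 ^ (-N).toNat * p) (prodSeries a b w) ∈ bounded2 W := by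
    rw [act2_mul]
    exact bounded2_act _ (hb w)
  refine ⟨X 0 ^ (-N).toNat * p, hf, ?_⟩
  rw [hY, ← substOuter_act _ (boundedSnd_prodSeries a b w), YSer_spec hb' hf]
  refine substOuter_eq_substInner fun m n hm => ?_
  rw [act2_mul, act2_X0_pow]
  exact hN _ _ (Or.inl (by omega))

/-- The coefficient of `x ^ t` in `a(x) w`, as a function of `a(x)`. -/
def evalCoeff (w : W) (t : ℤ) : E W →ₗ[ℂ] W where
  toFun a := (a w).coeff t
  map_add' _ _ := by simp
  map_smul' _ _ := by simp

variable {Γ : Subgroup ℂˣ} (V : Submodule ℂ (E W))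

/-- The vertex operators on a closed subspace. -/
def vertexOp (hV : ∀ a ∈ V, ∀ b ∈ V, QuasiCompatible a b)
    (hcl : ∀ a ∈ V, ∀ b ∈ V, ∀ n, nprod a b n ∈ V) : V →ₗ[ℂ] E V :=
  LinearMap.mk₂ ℂ
    (fun a b => HahnSeries.ofSuppBddBelow
      (fun i : ℤ => (⟨nprod a b (-i - 1), hcl a a.2 b b.2 _⟩ : V)) (by
        obtain ⟨K, hK⟩ := nprod_truncated (hV a a.2 b b.2)
        exact ⟨K, fun i hi => not_lt.1 fun h => hi (Subtype.ext (hK i h))⟩))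
    (fun a a' b => by
      ext i : 2
      exact Subtype.ext (nprod_add_left (hV a a.2 b b.2) (hV a' a'.2 b b.2)
        (hV _ (add_mem a.2 a'.2) b b.2) _))
    (fun c a b => by
      ext i : 2
      exact Subtype.ext (nprod_smul_left (hV a a.2 b b.2)
        (hV _ (V.smul_mem c a.2) b b.2) _))
    (fun a b b' => by
      ext i : 2
      exact Subtype.ext (nprod_add_right (hV a a.2 b b.2) (hV a a.2 b' b'.2)
        (hV a a.2 _ (add_mem b.2 b'.2)) _))
    (fun c a b => by
      ext i : 2
      exact Subtype.ext (nprod_smul_right (hV a a.2 b b.2)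
        (hV a a.2 _ (V.smul_mem c b.2)) _))

theorem vertexOp_coeff (hV : ∀ a ∈ V, ∀ b ∈ V, QuasiCompatible a b)
    (hcl : ∀ a ∈ V, ∀ b ∈ V, ∀ n, nprod a b n ∈ V) (a b : V) (i : ℤ) :
    ((vertexOp V hV hcl a b).coeff i : E W) = nprod a b (-i - 1) := rfl

/-- The nonlocal vertex algebra `(V, Y_E, 1_W)`. -/
def vertexAlgebra (h : Exchange Γ (V : Set (E W)) V)
    (hcl : ∀ a ∈ V, ∀ b ∈ V, ∀ n, nprod a b n ∈ V) (h1 : oneE W ∈ V) :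
    NonlocalVertexAlgebra V where
  Y := vertexOp V (fun _ ha _ hb => h.quasiCompatible ha hb) hcl
  one := ⟨oneE W, h1⟩
  vacuum v := by
    ext i : 2
    refine Subtype.ext ?_
    rw [vertexOp_coeff, nprod_one_left, oneE_coeff]
    split_ifs <;> rfl
  creation v := by
    refine ⟨fun n hn => Subtype.ext ?_, Subtype.ext ?_⟩
    · rw [vertexOp_coeff, nprod_one_right _ hn]
      rfl
    · rw [vertexOp_coeff, neg_zero, zero_sub, nprod_one_right_zero]
  weak_assoc a b c := by
    obtain ⟨l, hl⟩ := h.weak_assoc hcl a.2 b.2 c.2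
    refine ⟨l, ?_⟩
    ext i j w t
    simp only [← act2_apply]
    -- The identity between series with coefficients in V is tested on each w and each power of x;
    -- `evalCoeff` commutes with the action and with the substitution.
    have key : ∀ F : ℤ → ℤ → V, (((act2 ((X 0 + X 1) ^ l) F i j : V) : E W) w).coeff t =
        act2 ((X 0 + X 1) ^ l) (post2 (evalCoeff w t ∘ₗ V.subtype) F) i j := fun F =>
      congrFun (congrFun (post2_act (evalCoeff w t ∘ₗ V.subtype) ((X 0 + X 1) ^ l) F) i) j
    rw [key, key, ← substOuter_post _ (boundedSnd_prodSeries _ _ _)]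
    exact congrFun (congrFun (hl w t) i) j

theorem vertexAlgebra_isPseudoLocalQuasiModule (h : Exchange Γ (V : Set (E W)) V)
    (hcl : ∀ a ∈ V, ∀ b ∈ V, ∀ n, nprod a b n ∈ V) (h1 : oneE W ∈ V) :
    (vertexAlgebra V h hcl h1).IsPseudoLocalQuasiModule Γ V.subtype where
  vacuum := rfl
  quasi_assoc a b w := by
    obtain ⟨f, hf, he⟩ := (h.quasiCompatible a.2 b.2).quasi_assoc w
    refine ⟨f, hf, ?_⟩
    rw [← act2_apply, ← act2_apply]
    exact he
  pseudoLocal := by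
    have e : Set.range V.subtype = (V : Set (E W)) := Subtype.range_coe
    rw [e]
    exact h.pseudoLocal

end Closed

/-! ### The closed stable subspace generated by a set -/

section Generated

variable {W : Type*} [AddCommGroup W] [Module ℂ W] {Γ : Subgroup ℂˣ}

/-- `R_α` as a linear map. -/
def scaleLin (α : ℂˣ) : E W →ₗ[ℂ] E W where
  toFun := scale α
  map_add' a b := by
    ext w m
    simp [scale]
  map_smul' c a := by
    ext w m
    simp only [scale, LinearMap.coe_mk, AddHom.coe_mk, LinearMap.smul_apply, HahnSeries.coeff_smul,
      RingHom.id_apply]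
    exact smul_comm _ _ _

theorem scale_scale (α β : ℂˣ) (a : E W) : scale α (scale β a) = scale (α * β) a := by
  ext w m
  simp [scale, smul_smul, mul_zpow]

theorem scale_one (a : E W) : scale 1 a = a := by
  ext w m
  simp [scale]

/-- The form γx_i - δγ'x_j equals γ(x_i - γ⁻¹δγ'x_j), and Γ is a group. -/
theorem scaleHom_linForms {α β : ℂˣ} (hα : α ∈ Γ) (hβ : β ∈ Γ) {d : MvPolynomial (Fin 2) ℂ}
    (hd : d ∈ linForms (Fin 2) Γ) : scaleHom α β d ∈ linForms (Fin 2) Γ := by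
  induction hd using Submonoid.closure_induction with
  | one => rw [map_one]; exact one_mem _
  | mul d e _ _ hd he => rw [map_mul]; exact mul_mem hd he
  | mem d hd =>
    have hv : ∀ i, ∃ γ : ℂˣ, γ ∈ Γ ∧ scaleHom α β (X i) = C (γ : ℂ) * X i := fun i => by
      fin_cases i
      · exact ⟨α, hα, by simp [scaleHom]⟩
      · exact ⟨β, hβ, by simp [scaleHom]⟩
    have hC : ∀ c, scaleHom α β (C c) = C c := fun c => by
      rw [← MvPolynomial.algebraMap_eq, AlgHom.commutes]
    rcases hd with ⟨c, hc, rfl⟩ | ⟨i, rfl⟩ | ⟨i, j, hij, δ, hδ, rfl⟩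
    · rw [hC]
      exact linForms_C Γ hc
    · obtain ⟨γ, -, e⟩ := hv i
      rw [e]
      exact mul_mem (linForms_C Γ γ.ne_zero) (linForms_X Γ i)
    · obtain ⟨γ, hγ, e⟩ := hv i
      obtain ⟨γ', hγ', e'⟩ := hv j
      have h : scaleHom α β (X i - C (δ : ℂ) * X j) =
          C (γ : ℂ) * (X i - C ((γ⁻¹ * δ * γ' : ℂˣ) : ℂ) * X j) := by
        rw [map_sub, map_mul, hC, e, e', mul_sub, ← mul_assoc (C (γ : ℂ)) (C _),
          ← MvPolynomial.C_mul, ← Units.val_mul, ← mul_assoc γ, mul_inv_cancel_left,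
          Units.val_mul, MvPolynomial.C_mul, mul_assoc]
      rw [h]
      exact mul_mem (linForms_C Γ γ.ne_zero)
        (linForms_sub hij (mul_mem (mul_mem (inv_mem hγ) hδ) hγ'))

theorem Exchange.scale {A : Set (E W)} (h : Exchange Γ A A) :
    Exchange Γ {c | ∃ α ∈ Γ, ∃ a ∈ A, c = scale α a} {c | ∃ α ∈ Γ, ∃ a ∈ A, c = scale α a} := by
  rintro _ ⟨α, hα, a, ha, rfl⟩ _ ⟨β, hβ, b, hb, rfl⟩
  have e : ∀ a b : E W,
      opProd (NVA.scale α a) (NVA.scale β b) = scale2 α β (opProd a b) := fun a b => by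
    ext m n w
    simp [opProd, coeffEnd, NVA.scale, scale2, smul_smul, mul_comm]
  have e' : ∀ a b : E W,
      opProdRev (NVA.scale α a) (NVA.scale β b) = scale2 α β (opProdRev a b) := fun a b => by
    ext m n w
    simp [opProdRev, coeffEnd, NVA.scale, scale2, smul_smul]
  rw [e]
  refine map_mem_of_mem_locSpan locSpan_isSaturated (scale2 α β) (scaleHom α β)
    (fun d hd => scaleHom_linForms hα hβ hd) (fun i F => scale2_act α β _ F) ?_ (h a ha b hb)
  rintro _ ⟨a', ha', b', hb', rfl⟩
  exact subset_locSpan ⟨_, ⟨α, hα, a', ha', rfl⟩, _, ⟨β, hβ, b', hb', rfl⟩, (e' a' b').symm⟩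

/-- The subspaces obtained from `S` by scaling and then taking products repeatedly. -/
def stage (Γ : Subgroup ℂˣ) (S : Set (E W)) : ℕ → Submodule ℂ (E W)
  | 0 => Submodule.span ℂ {c | ∃ α ∈ Γ, ∃ a ∈ S, c = scale α a}
  | k + 1 => Submodule.span ℂ (products (stage Γ S k))

variable {S : Set (E W)}

theorem subset_stage_zero : S ⊆ stage Γ S 0 := fun a ha =>
  Submodule.subset_span ⟨1, one_mem _, a, ha, (scale_one a).symm⟩

/-- Scaling and spans give the initial stage. For the next, `products` enlarges one argument, `rev`
turns to the other, and the step is repeated. -/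
theorem stage_exchange (h : Exchange Γ S S) (k : ℕ) :
    Exchange Γ (stage Γ S k : Set (E W)) (stage Γ S k) := by
  induction k with
  | zero => exact h.scale.span
  | succ k ih =>
    have hA : ∀ a ∈ (stage Γ S k : Set (E W)), ∀ b ∈ (stage Γ S k : Set (E W)),
        QuasiCompatible a b := fun a ha b hb => ih.quasiCompatible ha hb
    exact ((ih.products hA).rev.products hA).rev.span

theorem stage_mono (h1 : oneE W ∈ S) : Monotone (stage Γ S) := by
  have hsucc : ∀ k, oneE W ∈ stage Γ S k → stage Γ S k ≤ stage Γ S (k + 1) :=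
    fun k hk a ha => Submodule.subset_span ⟨a, ha, oneE W, hk, -1, (nprod_one_right_zero a).symm⟩
  have hone : ∀ k, oneE W ∈ stage Γ S k := fun k => by
    induction k with
    | zero => exact subset_stage_zero h1
    | succ k ih => exact hsucc k ih ih
  exact monotone_nat_of_le_succ fun k => hsucc k (hone k)

theorem mem_stage_iSup (h1 : oneE W ∈ S) {a : E W} :
    a ∈ ⨆ k, stage Γ S k ↔ ∃ k, a ∈ stage Γ S k :=
  Submodule.mem_iSup_of_directed _ (stage_mono h1).directed_le

theorem iSup_stage_exchange (h : Exchange Γ S S) (h1 : oneE W ∈ S) :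
    Exchange Γ ((⨆ k, stage Γ S k : Submodule ℂ (E W)) : Set (E W))
      ((⨆ k, stage Γ S k : Submodule ℂ (E W)) : Set (E W)) := by
  intro a ha b hb
  obtain ⟨k, hk⟩ := (mem_stage_iSup h1).1 ha
  obtain ⟨l, hl⟩ := (mem_stage_iSup h1).1 hb
  refine locSpan_mono ?_ (stage_exchange h (max k l) a (stage_mono h1 (le_max_left _ _) hk)
    b (stage_mono h1 (le_max_right _ _) hl))
  rintro _ ⟨a', ha', b', hb', rfl⟩
  exact ⟨a', (mem_stage_iSup h1).2 ⟨_, ha'⟩, b', (mem_stage_iSup h1).2 ⟨_, hb'⟩, rfl⟩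

theorem iSup_stage_nprod (h1 : oneE W ∈ S) :
    ∀ a ∈ ⨆ k, stage Γ S k, ∀ b ∈ ⨆ k, stage Γ S k, ∀ n, nprod a b n ∈ ⨆ k, stage Γ S k := by
  intro a ha b hb n
  obtain ⟨k, hk⟩ := (mem_stage_iSup h1).1 ha
  obtain ⟨l, hl⟩ := (mem_stage_iSup h1).1 hb
  exact (mem_stage_iSup h1).2 ⟨max k l + 1, Submodule.subset_span
    ⟨a, stage_mono h1 (le_max_left _ _) hk, b, stage_mono h1 (le_max_right _ _) hl, n, rfl⟩⟩

theorem stage_scale (h : Exchange Γ S S) {α : ℂˣ} (hα : α ∈ Γ) (k : ℕ) :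
    ∀ a ∈ stage Γ S k, scale α a ∈ stage Γ S k := by
  induction k with
  | zero =>
    refine (Submodule.span_le (p := (stage Γ S 0).comap (scaleLin α))).2 ?_
    rintro _ ⟨β, hβ, a, ha, rfl⟩
    exact Submodule.subset_span ⟨α * β, mul_mem hα hβ, a, ha, scale_scale α β a⟩
  | succ k ih =>
    refine (Submodule.span_le (p := (stage Γ S (k + 1)).comap (scaleLin α))).2 ?_
    rintro _ ⟨a, ha, b, hb, n, rfl⟩
    change scale α (nprod a b n) ∈ stage Γ S (k + 1)
    rw [scale_nprod ((stage_exchange h k).quasiCompatible ha hb)]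
    exact Submodule.smul_mem _ _
      (Submodule.subset_span ⟨_, ih a ha, _, ih b hb, n, rfl⟩)

theorem iSup_stage_isLeast (h : Exchange Γ S S) (h1 : oneE W ∈ S) :
    IsLeast (stableClosedSubspaces Γ S) (⨆ k, stage Γ S k) := by
  have hex := iSup_stage_exchange h h1
  refine ⟨⟨fun a ha b hb => ?_, hex.pseudoLocal, ?_, fun α hα a ha => ?_⟩, ?_⟩
  · have hq := hex.quasiCompatible ha hb
    exact ⟨hq, fun n => ⟨_, iSup_stage_nprod h1 a ha b hb n, isNthProduct_nprod hq n⟩⟩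
  · rintro a (ha | rfl)
    · exact (mem_stage_iSup h1).2 ⟨0, subset_stage_zero ha⟩
    · exact (mem_stage_iSup h1).2 ⟨0, subset_stage_zero h1⟩
  · obtain ⟨k, hk⟩ := (mem_stage_iSup h1).1 ha
    exact (mem_stage_iSup h1).2 ⟨k, stage_scale h hα k a hk⟩
  -- A competitor contains the initial stage by R_α-stability and each further one by closedness,
  -- its n-th products being given by `nprod`.
  · rintro V ⟨hcl, -, hS, hR⟩
    refine iSup_le fun k => ?_
    induction k with
    | zero =>
      refine Submodule.span_le.2 ?_
      rintro _ ⟨α, hα, a, ha, rfl⟩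
      exact hR α hα a (hS (Or.inl ha))
    | succ k ih =>
      refine Submodule.span_le.2 ?_
      rintro _ ⟨a, ha, b, hb, n, rfl⟩
      obtain ⟨c, hc, hn⟩ := (hcl a (ih ha) b (ih hb)).2 n
      rw [← hn.eq_nprod]
      exact hc

theorem Exchange.existsUnique_vertexAlgebra (h : Exchange Γ S S) (h1 : oneE W ∈ S) :
    ∃! V : Submodule ℂ (E W), IsLeast (stableClosedSubspaces Γ S) V ∧
      ∃ 𝒜 : NonlocalVertexAlgebra V, (𝒜.one : E W) = oneE W ∧
        (∀ (a b : V) (n : ℤ), IsNthProduct (a : E W) (b : E W) n ((𝒜.Y a b).coeff (-n - 1) : V)) ∧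
        𝒜.IsPseudoLocalQuasiModule Γ V.subtype ∧ Function.Injective V.subtype := by
  have hex := iSup_stage_exchange h h1
  have hone : oneE W ∈ ⨆ k, stage Γ S k := (mem_stage_iSup h1).2 ⟨0, subset_stage_zero h1⟩
  refine ⟨⨆ k, stage Γ S k, ⟨iSup_stage_isLeast h h1,
    vertexAlgebra _ hex (iSup_stage_nprod h1) hone, rfl, fun a b n => ?_,
    vertexAlgebra_isPseudoLocalQuasiModule _ hex (iSup_stage_nprod h1) hone,
    Submodule.subtype_injective _⟩, fun V hV => hV.1.unique (iSup_stage_isLeast h h1)⟩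
  have e : (((vertexAlgebra _ hex (iSup_stage_nprod h1) hone).Y a b).coeff (-n - 1) : E W) =
      nprod a b n := by
    change nprod (a : E W) (b : E W) (-(-n - 1) - 1) = nprod a b n
    congr 1
    ring
  rw [e]
  exact isNthProduct_nprod (hex.quasiCompatible a.2 b.2) n

end Generated

/-! ### Multiplication by power series in `x₁ / x₂` -/

section Related

variable {M : Type*} [AddCommGroup M] [Module ℂ M] {Γ : Subgroup ℂˣ}

/-- Two series that agree up to products of linear forms. -/
def Related (Γ : Subgroup ℂˣ) (F G : ℤ → ℤ → M) : Prop :=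
  ∃ d ∈ linForms (Fin 2) Γ, ∃ e ∈ linForms (Fin 2) Γ, act2 d F = act2 e G

theorem Related.refl (F : ℤ → ℤ → M) : Related Γ F F := ⟨1, one_mem _, 1, one_mem _, rfl⟩

theorem Related.symm {F G : ℤ → ℤ → M} (h : Related Γ F G) : Related Γ G F := by
  obtain ⟨d, hd, e, he, h⟩ := h
  exact ⟨e, he, d, hd, h.symm⟩

theorem Related.trans {F G H : ℤ → ℤ → M} (h : Related Γ F G) (h' : Related Γ G H) :
    Related Γ F H := by
  obtain ⟨d, hd, e, he, h⟩ := h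
  obtain ⟨d', hd', e', he', h'⟩ := h'
  refine ⟨d' * d, mul_mem hd' hd, e * e', mul_mem he he', ?_⟩
  rw [act2_mul, act2_mul, h, ← h', act2_comm]

theorem Related.swap {F G : ℤ → ℤ → M} (h : Related Γ F G) : Related Γ (swap2 F) (swap2 G) := by
  obtain ⟨d, hd, e, he, h⟩ := h
  have key : ∀ (p : MvPolynomial (Fin 2) ℂ) (F : ℤ → ℤ → M),
      swap2 (act2 p F) = act2 (MvPolynomial.rename (Equiv.swap 0 1) p) (swap2 F) := fun p F => by
    refine act_natural act2 (act2.comp (MvPolynomial.rename (Equiv.swap 0 1))) swap2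
      (fun i F => ?_) p F
    rw [AlgHom.comp_apply, MvPolynomial.rename_X]
    ext m n
    fin_cases i
    · change act2 (X 0) F n m = act2 (X (Equiv.swap 0 1 0)) (swap2 F) m n
      rw [Equiv.swap_apply_left, act2_X0, act2_X1]
      rfl
    · change act2 (X 1) F n m = act2 (X (Equiv.swap 0 1 1)) (swap2 F) m n
      rw [Equiv.swap_apply_right, act2_X0, act2_X1]
      rfl
  exact ⟨_, linForms_rename (Equiv.injective _) hd, _, linForms_rename (Equiv.injective _) he, by
    rw [← key, ← key, h]⟩

theorem linForms_lin {i j : Fin 2} (hij : i ≠ j) {u v : ℂˣ} (hu : u ∈ Γ) (hv : v ∈ Γ) :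
    C (u : ℂ) * X i - C (v : ℂ) * X j ∈ linForms (Fin 2) Γ := by
  have h : C (u : ℂ) * X i - C (v : ℂ) * X j =
      C (u : ℂ) * (X i - C ((u⁻¹ * v : ℂˣ) : ℂ) * X j) := by
    rw [mul_sub, ← mul_assoc (C (u : ℂ)) (C _), ← MvPolynomial.C_mul, ← Units.val_mul,
      mul_inv_cancel_left]
  rw [h]
  exact mul_mem (linForms_C Γ u.ne_zero) (linForms_sub hij (mul_mem (inv_mem hu) hv))

theorem act2_lin (u v : ℂ) (F : ℤ → ℤ → M) (m n : ℤ) :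
    act2 (C u * X 0 - C v * X 1) F m n = u • F (m - 1) n - v • F m (n - 1) := by
  rw [map_sub, LinearMap.sub_apply, act2_mul, act2_mul, act2_C, act2_C]
  simp only [Pi.sub_apply, Pi.smul_apply, act2_X0, act2_X1]

theorem act2_lin' (u v : ℂ) (F : ℤ → ℤ → M) (m n : ℤ) :
    act2 (C u * X 1 - C v * X 0) F m n = u • F m (n - 1) - v • F (m - 1) n := by
  rw [map_sub, LinearMap.sub_apply, act2_mul, act2_mul, act2_C, act2_C]
  simp only [Pi.sub_apply, Pi.smul_apply, act2_X0, act2_X1]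

/-- The hypothesis says (u x₁/x₂ - v)F = (u' x₁/x₂ - v')G, coefficient by coefficient;
multiplication by x₂ turns both factors into linear forms. -/
theorem related_of_linear {F G : ℤ → ℤ → M} {u v u' v' : ℂˣ} (hu : u ∈ Γ) (hv : v ∈ Γ)
    (hu' : u' ∈ Γ) (hv' : v' ∈ Γ)
    (h : ∀ m n, (u : ℂ) • F (m - 1) (n + 1) - (v : ℂ) • F m n =
      (u' : ℂ) • G (m - 1) (n + 1) - (v' : ℂ) • G m n) : Related Γ F G := by
  refine ⟨_, linForms_lin (i := 0) (j := 1) (by decide) hu hv, _,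
    linForms_lin (i := 0) (j := 1) (by decide) hu' hv', ?_⟩
  ext m n
  rw [act2_lin, act2_lin]
  have := h m (n - 1)
  rwa [sub_add_cancel] at this

theorem related_of_linear' {F G : ℤ → ℤ → M} {u v u' v' : ℂˣ} (hu : u ∈ Γ) (hv : v ∈ Γ)
    (hu' : u' ∈ Γ) (hv' : v' ∈ Γ)
    (h : ∀ m n, (u : ℂ) • F (m + 1) (n - 1) - (v : ℂ) • F m n =
      (u' : ℂ) • G (m + 1) (n - 1) - (v' : ℂ) • G m n) : Related Γ F G := by
  refine ⟨_, linForms_lin (i := 1) (j := 0) (by decide) hu hv, _,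
    linForms_lin (i := 1) (j := 0) (by decide) hu' hv', ?_⟩
  ext m n
  rw [act2_lin', act2_lin']
  have := h (m - 1) n
  rwa [sub_add_cancel] at this

/-- The product `h(x₁ / x₂) F(x₁, x₂)` for a power series `h` and a series `F` with nonnegative
exponents of `x₁`. -/
def ratioSeries (h : PowerSeries ℂ) (F : ℤ → ℤ → M) : ℤ → ℤ → M :=
  fun m n => ∑ r ∈ Finset.range (m + 1).toNat, PowerSeries.coeff r h • F (m - r) (n + r)

theorem ratioSeries_neg (h : PowerSeries ℂ) (F : ℤ → ℤ → M) {m : ℤ} (hm : m < 0) (n : ℤ) :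
    ratioSeries h F m n = 0 := by
  rw [ratioSeries, Int.toNat_of_nonpos (by omega), Finset.sum_range_zero]

theorem ratioSeries_natCast (h : PowerSeries ℂ) (F : ℤ → ℤ → M) (m : ℕ) (n : ℤ) :
    ratioSeries h F m n =
      ∑ r ∈ Finset.range (m + 1), PowerSeries.coeff r h • F ((m : ℤ) - r) (n + r) := rfl

/-- Both sides sum over the triangle a + b ≤ m, once along its diagonals and once by rows. -/
theorem ratioSeries_mul (h h' : PowerSeries ℂ) (F : ℤ → ℤ → M) :
    ratioSeries (h * h') F = ratioSeries h (ratioSeries h' F) := by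
  ext m n
  rcases lt_or_ge m 0 with hm | hm
  · rw [ratioSeries_neg _ _ hm, ratioSeries_neg _ _ hm]
  lift m to ℕ using hm
  have h1 : ∀ r ∈ Finset.range (m + 1),
      PowerSeries.coeff r (h * h') • F ((m : ℤ) - r) (n + r) =
        ∑ k ∈ Finset.range (r + 1), (PowerSeries.coeff k h * PowerSeries.coeff (r - k) h') •
          F ((m : ℤ) - k - (r - k : ℕ)) (n + k + (r - k : ℕ)) := by
    intro r _
    rw [PowerSeries.coeff_mul, Finset.Nat.sum_antidiagonal_eq_sum_range_succ_mk, Finset.sum_smul]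
    refine Finset.sum_congr rfl fun k hk => ?_
    rw [Finset.mem_range] at hk
    congr 2 <;> omega
  rw [ratioSeries_natCast, ratioSeries_natCast, Finset.sum_congr rfl h1,
    Finset.sum_range_diag_flip (m + 1) fun a b =>
      (PowerSeries.coeff a h * PowerSeries.coeff b h') • F ((m : ℤ) - a - b) (n + a + b)]
  refine Finset.sum_congr rfl fun a ha => ?_
  rw [Finset.mem_range] at ha
  have h2 : (m : ℤ) - a = ((m - a : ℕ) : ℤ) := by omega
  have h3 : m + 1 - a = m - a + 1 := by omega
  rw [h2, ratioSeries_natCast, Finset.smul_sum, h3]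
  exact Finset.sum_congr rfl fun b _ => mul_smul _ _ _

/-- The vanishing of F at negative exponents justifies the cutoff in `ratioSeries`: at m = 0 the
linear term of the polynomial is absent from the sum, and F(-1, n+1) is zero. -/
theorem ratioSeries_linear (u v : ℂ) {F : ℤ → ℤ → M} (hF : ∀ m n, m < 0 → F m n = 0) (m n : ℤ) :
    ratioSeries (PowerSeries.C u * PowerSeries.X - PowerSeries.C v) F m n =
      u • F (m - 1) (n + 1) - v • F m n := by
  rcases lt_or_ge m 0 with hm | hm
  · rw [ratioSeries_neg _ _ hm, hF _ _ hm, hF _ _ (by omega), smul_zero, smul_zero, sub_zero]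
  lift m to ℕ using hm
  rw [ratioSeries_natCast, Finset.sum_range_succ']
  have h0 : PowerSeries.coeff 0 (PowerSeries.C u * PowerSeries.X - PowerSeries.C v) = -v := by
    simp
  rw [h0, Nat.cast_zero, sub_zero, add_zero, neg_smul, ← sub_eq_add_neg]
  congr 1
  cases m with
  | zero => rw [Finset.sum_range_zero, hF _ _ (by simp), smul_zero]
  | succ m =>
    rw [Finset.sum_range_succ', Finset.sum_eq_zero, zero_add]
    · have h1 : PowerSeries.coeff (0 + 1)
          (PowerSeries.C u * PowerSeries.X - PowerSeries.C v) = u := by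
        simp [PowerSeries.coeff_C]
      rw [h1]
      simp
    · intro r _
      have h1 : PowerSeries.coeff (r + 1 + 1)
          (PowerSeries.C u * PowerSeries.X - PowerSeries.C v) = 0 := by
        simp
      rw [h1, zero_smul]

/-- The quotients of the linear polynomials `u x - v` with `u, v ∈ Γ`. -/
def IsLinearQuotient (Γ : Subgroup ℂˣ) (h : PowerSeries ℂ) : Prop :=
  ∃ u ∈ Γ, ∃ v ∈ Γ, ∃ u' ∈ Γ, ∃ v' ∈ Γ,
    (PowerSeries.C ((u : ℂˣ) : ℂ) * PowerSeries.X - PowerSeries.C ((v : ℂˣ) : ℂ)) * h =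
      PowerSeries.C ((u' : ℂˣ) : ℂ) * PowerSeries.X - PowerSeries.C ((v' : ℂˣ) : ℂ)

theorem IsLinearQuotient.related {h : PowerSeries ℂ} (hh : IsLinearQuotient Γ h)
    {F : ℤ → ℤ → M} (hF : ∀ m n, m < 0 → F m n = 0) : Related Γ (ratioSeries h F) F := by
  obtain ⟨u, hu, v, hv, u', hu', v', hv', e⟩ := hh
  refine related_of_linear hu hv hu' hv' fun m n => ?_
  rw [← ratioSeries_linear _ _ (fun _ n hm => ratioSeries_neg h F hm n), ← ratioSeries_mul, e,
    ratioSeries_linear _ _ hF]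

/-- For series with exponents of x₁ at most 0, such as ψ_i, the multiplier is h(x₂/x₁); inverting
both variables reduces to `ratioSeries`. -/
theorem IsLinearQuotient.related_reflect {h : PowerSeries ℂ} (hh : IsLinearQuotient Γ h)
    {F G : ℤ → ℤ → M} (hG : ∀ m n, 0 < m → G m n = 0)
    (hFG : (fun m n => F (-m) (-n)) = ratioSeries h fun m n => G (-m) (-n)) : Related Γ F G := by
  obtain ⟨u, hu, v, hv, u', hu', v', hv', e⟩ := hh
  refine related_of_linear' hu hv hu' hv' fun m n => ?_
  have hG' : ∀ m n, m < 0 → (fun m n => G (-m) (-n)) m n = 0 := fun m n hm =>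
    hG _ _ (by omega)
  have key := congrFun (congrFun (ratioSeries_mul
    (PowerSeries.C (u : ℂ) * PowerSeries.X - PowerSeries.C (v : ℂ)) h
      fun m n => G (-m) (-n)) (-m)) (-n)
  rw [e, ratioSeries_linear _ _ hG',
    ratioSeries_linear _ _ (fun _ n hm => ratioSeries_neg h _ hm n), ← hFG] at key
  simp only [neg_sub, neg_add, neg_neg, sub_neg_eq_add, ← sub_eq_add_neg] at key
  rw [add_comm m 1]
  exact key.symm

end Related

/-! ### The power series `g_{ij}` -/

section GSeries

variable {Γ : Subgroup ℂˣ} {l : ℕ} (A : Matrix (Fin l) (Fin l) ℤ) {q : ℂˣ} (i j : Fin l)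

theorem gSeries_spec : (PowerSeries.X - PowerSeries.C ((q : ℂ) ^ A i j)) * gSeries A q i j =
    PowerSeries.C ((q : ℂ) ^ A i j) * PowerSeries.X - 1 := by
  rw [gSeries, mul_comm, mul_assoc, PowerSeries.inv_mul_cancel, mul_one]
  simp [zpow_ne_zero]

theorem gSeries_mul_inv : gSeries A q i j * (gSeries A q i j)⁻¹ = 1 := by
  refine PowerSeries.mul_inv_cancel _ ?_
  simp [gSeries, zpow_ne_zero]

theorem gPow_isLinearQuotient (hq : q ∈ Γ) (ε : ℤˣ) {c : ℂˣ} (hc : c ∈ Γ) :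
    IsLinearQuotient Γ (PowerSeries.rescale (c : ℂ) (gPow A q i j ε)) := by
  have hQ : q ^ A i j ∈ Γ := zpow_mem hq _
  have hr : ∀ u v : ℂ, PowerSeries.rescale (c : ℂ)
      (PowerSeries.C u * PowerSeries.X - PowerSeries.C v) =
        PowerSeries.C (u * c) * PowerSeries.X - PowerSeries.C v := by
    intro u v
    ext n
    rw [PowerSeries.coeff_rescale]
    rcases n with _ | _ | n <;> simp [PowerSeries.coeff_C, PowerSeries.coeff_X, mul_comm]
  have h1 : (PowerSeries.C 1 * PowerSeries.X - PowerSeries.C ((q : ℂ) ^ A i j)) *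
      gSeries A q i j = PowerSeries.C ((q : ℂ) ^ A i j) * PowerSeries.X - PowerSeries.C 1 := by
    rw [map_one, one_mul]
    exact gSeries_spec A i j
  have h2 : (PowerSeries.C ((q : ℂ) ^ A i j) * PowerSeries.X - PowerSeries.C 1) *
      (gSeries A q i j)⁻¹ = PowerSeries.C 1 * PowerSeries.X - PowerSeries.C ((q : ℂ) ^ A i j) := by
    rw [← h1, mul_assoc, gSeries_mul_inv, mul_one]
  have e1 := congrArg (PowerSeries.rescale (c : ℂ)) h1
  have e2 := congrArg (PowerSeries.rescale (c : ℂ)) h2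
  rw [map_mul, hr, hr] at e1 e2
  unfold gPow
  split_ifs
  · exact ⟨1 * c, mul_mem (one_mem _) hc, q ^ A i j, hQ, q ^ A i j * c, mul_mem hQ hc, 1,
      one_mem _, by simpa using e1⟩
  · exact ⟨q ^ A i j * c, mul_mem hQ hc, 1, one_mem _, 1 * c, mul_mem (one_mem _) hc,
      q ^ A i j, hQ, by simpa using e2⟩

end GSeries

/-! ### Exchange relations in restricted modules for `U_q(ĝ)` -/

section Relations

variable {l : ℕ} {A : Matrix (Fin l) (Fin l) ℤ} {q : ℂ} {W : Type*} [AddCommGroup W] [Module ℂ W]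

/-- The action of the free algebra on a module for `U_q(ĝ)`. -/
def freeAction (ρ : Uq A q →ₐ[ℂ] Module.End ℂ W) : Free l →ₐ[ℂ] Module.End ℂ W :=
  ρ.comp (toUq A q)

variable {ρ : Uq A q →ₐ[ℂ] Module.End ℂ W}

theorem freeAction_rel {x y : Free l} (h : Rel A q x y) : freeAction ρ x = freeAction ρ y :=
  congrArg ρ (RingQuot.mkAlgHom_rel ℂ h)

theorem IsGenFun.coeffEnd {c : ℤ → Free l} {a : E W} (h : IsGenFun ρ c a) (m : ℤ) :
    coeffEnd a m = freeAction ρ (c (-m)) := by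
  ext w
  exact h w m

theorem IsGenFun.opProd {c d : ℤ → Free l} {a b : E W} (ha : IsGenFun ρ c a)
    (hb : IsGenFun ρ d b) (m n : ℤ) : opProd a b m n = freeAction ρ (c (-m) * d (-n)) := by
  rw [NVA.opProd, ha.coeffEnd, hb.coeffEnd, map_mul]

theorem IsGenFun.opProdRev {c d : ℤ → Free l} {a b : E W} (ha : IsGenFun ρ c a)
    (hb : IsGenFun ρ d b) (m n : ℤ) : opProdRev a b m n = freeAction ρ (d (-n) * c (-m)) := by
  rw [NVA.opProdRev, ha.coeffEnd, hb.coeffEnd, map_mul]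

theorem fPhi_pos (i : Fin l) {m : ℤ} (hm : 0 < m) : fPhi i m = 0 := if_neg (by omega)

theorem fPsi_neg (i : Fin l) {m : ℤ} (hm : m < 0) : fPsi i m = 0 := if_neg (by omega)

theorem freeAction_fGam {κ : ℂˣ}
    (h : ∀ w : W, ρ (toUq A q (FreeAlgebra.ι ℂ Gen.gam)) w = (κ : ℂ) • w)
    (h' : ∀ w : W, ρ (toUq A q (FreeAlgebra.ι ℂ Gen.gamInv)) w = ((κ⁻¹ : ℂˣ) : ℂ) • w) (k : ℤ) :
    freeAction ρ (fGam l k) = ((κ ^ k : ℂˣ) : ℂ) • 1 := by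
  have e : freeAction ρ (FreeAlgebra.ι ℂ Gen.gam) = (κ : ℂ) • 1 := by
    ext w
    exact h w
  have e' : freeAction ρ (FreeAlgebra.ι ℂ Gen.gamInv) = ((κ⁻¹ : ℂˣ) : ℂ) • 1 := by
    ext w
    exact h' w
  unfold fGam
  split_ifs with hk
  · lift k to ℕ using hk
    rw [map_pow, e, smul_pow, one_pow, Int.toNat_natCast, zpow_natCast, Units.val_pow_eq_pow_val]
  · obtain ⟨n, hn⟩ := Int.exists_eq_neg_ofNat (not_le.1 hk).le
    rw [hn, map_pow, e', smul_pow, one_pow, neg_neg, Int.toNat_natCast, zpow_neg, zpow_natCast,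
      ← Units.val_pow_eq_pow_val, inv_pow]

theorem related_X_X {Γ : Subgroup ℂˣ} {Q : ℂˣ} (hQ : Q ∈ Γ) {ε : ℤˣ} {i j : Fin l}
    (hq : q ^ ((ε : ℤ) * A i j) = Q) {a b : E W} (ha : IsGenFun ρ (fX ε i) a)
    (hb : IsGenFun ρ (fX ε j) b) : Related Γ (opProd a b) (opProdRev a b) := by
  refine related_of_linear (one_mem _) hQ hQ (one_mem _) fun m n => ?_
  -- Modes k belong to z^{-k}; these indices give the coefficient of x₁^m x₂^n in the relation
  -- divided by x₂.
  have h := freeAction_rel (ρ := ρ) (Rel.X_X (A := A) (q := q) ε i j (-m) (-n - 1))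
  rw [hq, map_sub, map_sub, map_smul, map_smul, sub_add_cancel] at h
  simp only [ha.opProd hb, ha.opProdRev hb, Units.val_one, one_smul]
  rw [show -(m - 1) = -m + 1 by ring, show -(n + 1) = -n - 1 by ring]
  exact h

/-- The series is δ(x₁/(κ²x₂)) times the series in κx₂ with coefficients Φ, and (x₁ - κ²x₂)
annihilates the delta function. -/
theorem act2_ratio_power {M : Type*} [AddCommGroup M] [Module ℂ M] (κ : ℂˣ) (Φ : ℤ → M) :
    act2 (C ((1 : ℂˣ) : ℂ) * X 0 - C ((κ ^ 2 : ℂˣ) : ℂ) * X 1)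
      (fun m n => ((κ ^ (n - m) : ℂˣ) : ℂ) • Φ (m + n)) = 0 := by
  ext m n
  rw [act2_lin, smul_smul, smul_smul, ← Units.val_mul, ← Units.val_mul, one_mul]
  have e : κ ^ 2 * κ ^ (n - 1 - m) = κ ^ (n - (m - 1)) := by
    rw [← zpow_natCast, ← zpow_add]
    congr 1
    push_cast
    ring
  rw [e, show m + (n - 1) = m - 1 + n by ring, sub_self]
  rfl

/-- The commutator consists of two delta functions, at x₁ = κ²x₂ and x₁ = κ⁻²x₂ because γ acts as
κ². The product d·e kills both, so the two orders agree after multiplication by it. -/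
theorem related_Xp_Xm {Γ : Subgroup ℂˣ} {κ : ℂˣ} (hκ : κ ∈ Γ)
    (hγ : ∀ k, freeAction ρ (fGam l k) = ((κ ^ k : ℂˣ) : ℂ) • 1) {i j : Fin l} {a b : E W}
    (ha : IsGenFun ρ (fX 1 i) a) (hb : IsGenFun ρ (fX (-1) j) b) :
    Related Γ (opProd a b) (opProdRev a b) := by
  by_cases hij : i = j
  · subst hij
    set d : MvPolynomial (Fin 2) ℂ := C ((1 : ℂˣ) : ℂ) * X 0 - C ((κ ^ 2 : ℂˣ) : ℂ) * X 1 with hd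
    set e : MvPolynomial (Fin 2) ℂ := C ((1 : ℂˣ) : ℂ) * X 0 - C ((κ⁻¹ ^ 2 : ℂˣ) : ℂ) * X 1 with he
    set Ψ : ℤ → Module.End ℂ W := fun s => freeAction ρ (fPsi i (-s))
    set Φ : ℤ → Module.End ℂ W := fun s => freeAction ρ (fPhi i (-s))
    have hD : opProd a b - opProdRev a b = (q - q⁻¹)⁻¹ •
        ((fun m n => ((κ ^ (n - m) : ℂˣ) : ℂ) • Ψ (m + n)) -
          fun m n => ((κ⁻¹ ^ (n - m) : ℂˣ) : ℂ) • Φ (m + n)) := by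
      ext m n : 2
      have h := freeAction_rel (ρ := ρ) (Rel.Xp_Xm (A := A) (q := q) i i (-m) (-n))
      rw [if_pos rfl, map_sub, map_smul, map_sub, map_mul _ (fGam l _), map_mul _ (fGam l _), hγ,
        hγ, smul_mul_assoc, smul_mul_assoc, one_mul, one_mul] at h
      simp only [Pi.sub_apply, Pi.smul_apply, ha.opProd hb, ha.opProdRev hb, Ψ, Φ]
      rw [h, show -m - -n = n - m by ring, show -n - -m = -(n - m) by ring, neg_add, zpow_neg,
        inv_zpow]
    have hmem : ∀ κ : ℂˣ, κ ∈ Γ → (C ((1 : ℂˣ) : ℂ) * X 0 - C ((κ ^ 2 : ℂˣ) : ℂ) * X 1 :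
        MvPolynomial (Fin 2) ℂ) ∈ linForms (Fin 2) Γ := fun κ hκ => linForms_lin (by decide) (one_mem _) (pow_mem hκ 2)
    have hde : d * e ∈ linForms (Fin 2) Γ := mul_mem (hmem κ hκ) (hmem κ⁻¹ (inv_mem hκ))
    refine ⟨d * e, hde, d * e, hde, sub_eq_zero.1 ?_⟩
    rw [← map_sub, hD, map_smul, map_sub, act2_mul d e (fun m n => _ • Φ (m + n)), mul_comm d e,
      act2_mul, hd, he, act2_ratio_power, act2_ratio_power, map_zero, map_zero, sub_zero,
      smul_zero]
  · have e : opProd a b = opProdRev a b := by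
      ext m n : 2
      have h := freeAction_rel (ρ := ρ) (Rel.Xp_Xm (A := A) (q := q) i j (-m) (-n))
      rw [if_neg hij, map_zero, map_sub, sub_eq_zero] at h
      rw [ha.opProd hb, ha.opProdRev hb, h]
    rw [e]
    exact Related.refl _

/-- The relation is multiplication by g_ij(x₁κ^{-ε}/x₂)^ε, a quotient of linear polynomials, since
γ^{-ε/2} acts as κ^{-ε}; φ_i has nonnegative exponents only. -/
theorem related_phi_X {Γ : Subgroup ℂˣ} {κ r : ℂˣ} (hκ : κ ∈ Γ) (hr : r ∈ Γ) (hq : q = r)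
    (hγ : ∀ k, freeAction ρ (fGam l k) = ((κ ^ k : ℂˣ) : ℂ) • 1) {ε : ℤˣ} {i j : Fin l}
    {a b : E W} (ha : IsGenFun ρ (fPhi i) a) (hb : IsGenFun ρ (fX ε j) b) :
    Related Γ (opProd a b) (opProdRev a b) := by
  subst hq
  have e : opProd a b = ratioSeries
      (PowerSeries.rescale ((κ ^ (-(ε : ℤ)) : ℂˣ) : ℂ) (gPow A r i j ε)) (opProdRev a b) := by
    ext m n : 2
    rw [ha.opProd hb]
    rcases lt_or_ge m 0 with hm | hm
    · rw [fPhi_pos i (by omega), zero_mul, map_zero, ratioSeries_neg _ _ hm]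
    lift m to ℕ using hm
    rw [freeAction_rel (Rel.phi_X ε i j m (-n)), ratioSeries_natCast, map_sum]
    refine Finset.sum_congr rfl fun k _ => ?_
    rw [map_smul, map_mul, hγ, ha.opProdRev hb, PowerSeries.coeff_rescale, smul_mul_assoc, one_mul,
      smul_smul, neg_add', mul_comm, zpow_mul, zpow_natCast, Units.val_pow_eq_pow_val]
  rw [e]
  refine (gPow_isLinearQuotient A i j hr ε (zpow_mem hκ _)).related fun m n hm => ?_
  rw [ha.opProdRev hb, fPhi_pos i (by omega), mul_zero, map_zero]

theorem related_psi_X {Γ : Subgroup ℂˣ} {κ r : ℂˣ} (hκ : κ ∈ Γ) (hr : r ∈ Γ) (hq : q = r)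
    (hγ : ∀ k, freeAction ρ (fGam l k) = ((κ ^ k : ℂˣ) : ℂ) • 1) {ε : ℤˣ} {i j : Fin l}
    {a b : E W} (ha : IsGenFun ρ (fPsi i) a) (hb : IsGenFun ρ (fX ε j) b) :
    Related Γ (opProd a b) (opProdRev a b) := by
  subst hq
  refine (gPow_isLinearQuotient A i j hr (-ε) (zpow_mem hκ (-(ε : ℤ)))).related_reflect
    (fun m n hm => ?_) ?_
  · rw [ha.opProdRev hb, fPsi_neg i (by omega), mul_zero, map_zero]
  ext m n : 2
  rw [ha.opProd hb, neg_neg, neg_neg]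
  rcases lt_or_ge m 0 with hm | hm
  · rw [fPsi_neg i hm, zero_mul, map_zero, ratioSeries_neg _ _ hm]
  lift m to ℕ using hm
  rw [freeAction_rel (Rel.psi_X ε i j m n), ratioSeries_natCast, map_sum]
  refine Finset.sum_congr rfl fun k _ => ?_
  rw [map_smul, map_mul, hγ, ha.opProdRev hb, PowerSeries.coeff_rescale, smul_mul_assoc, one_mul,
    smul_smul, neg_neg, neg_neg, mul_comm, zpow_mul, zpow_natCast, Units.val_pow_eq_pow_val]

theorem related_phi_psi {Γ : Subgroup ℂˣ} {κ r : ℂˣ} (hκ : κ ∈ Γ) (hr : r ∈ Γ) (hq : q = r)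
    (hγ : ∀ k, freeAction ρ (fGam l k) = ((κ ^ k : ℂˣ) : ℂ) • 1) {i j : Fin l}
    {a b : E W} (ha : IsGenFun ρ (fPhi i) a) (hb : IsGenFun ρ (fPsi j) b) :
    Related Γ (opProd a b) (opProdRev a b) := by
  subst hq
  have hH : ∀ m n, m < 0 → opProdRev a b m n = 0 := fun m n hm => by
    rw [ha.opProdRev hb, fPhi_pos i (by omega), mul_zero, map_zero]
  have e : opProd a b = ratioSeries
      (PowerSeries.rescale ((κ ^ (-2 : ℤ) : ℂˣ) : ℂ) (gPow A r i j 1) *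
        PowerSeries.rescale ((κ ^ (2 : ℤ) : ℂˣ) : ℂ) (gPow A r i j (-1))) (opProdRev a b) := by
    ext m n : 2
    rw [ha.opProd hb]
    rcases lt_or_ge m 0 with hm | hm
    · rw [fPhi_pos i (by omega), zero_mul, map_zero, ratioSeries_neg _ _ hm]
    -- The relation covers only modes n ≥ 0 of ψ_j; at positive exponents of x₂ both sides vanish
    -- with ψ_j.
    rcases lt_or_ge 0 n with hn | hn
    · rw [fPsi_neg j (by omega), mul_zero, map_zero, ratioSeries, Finset.sum_eq_zero]
      intro k _
      rw [ha.opProdRev hb, fPsi_neg j (by omega), zero_mul, map_zero, smul_zero]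
    lift m to ℕ using hm
    obtain ⟨n, rfl⟩ := Int.exists_eq_neg_ofNat hn
    rw [neg_neg, freeAction_rel (Rel.phi_psi i j m n), ratioSeries_natCast, map_sum]
    refine Finset.sum_congr rfl fun k _ => ?_
    have hg : freeAction ρ (gRatio A r i j k) = PowerSeries.coeff k
        (PowerSeries.rescale ((κ ^ (-2 : ℤ) : ℂˣ) : ℂ) (gPow A r i j 1) *
          PowerSeries.rescale ((κ ^ (2 : ℤ) : ℂˣ) : ℂ) (gPow A r i j (-1))) • 1 := by
      rw [gRatio, map_sum, PowerSeries.coeff_mul, Finset.sum_smul]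
      refine Finset.sum_congr rfl fun x _ => ?_
      rw [map_smul, map_mul, hγ, hγ, PowerSeries.coeff_rescale, PowerSeries.coeff_rescale,
        smul_mul_smul_comm, one_mul, smul_smul, zpow_mul, zpow_mul, zpow_natCast, zpow_natCast,
        Units.val_pow_eq_pow_val, Units.val_pow_eq_pow_val]
      congr 1
      ring
    rw [map_mul, hg, ha.opProdRev hb, smul_mul_assoc, one_mul]
    congr 4
    ring
  -- Each of the factors g_ij(x₁κ⁻²/x₂) and g_ij(x₁κ²/x₂)⁻¹ is a linear quotient; they are removed
  -- one at a time.
  rw [e, ratioSeries_mul]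
  exact ((gPow_isLinearQuotient A i j hr 1 (zpow_mem hκ _)).related
      fun m n hm => ratioSeries_neg _ _ hm n).trans
    ((gPow_isLinearQuotient A i j hr (-1) (zpow_mem hκ _)).related hH)

theorem related_swap {Γ : Subgroup ℂˣ} {a b : E W} (h : Related Γ (opProd a b) (opProdRev a b)) :
    Related Γ (opProd b a) (opProdRev b a) := h.swap.symm

theorem related_one {Γ : Subgroup ℂˣ} (b : E W) :
    Related Γ (opProd (oneE W) b) (opProdRev (oneE W) b) := by
  have e : opProd (oneE W) b = opProdRev (oneE W) b := by
    ext m n w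
    change (oneE W ((b w).coeff n)).coeff m = (b ((oneE W w).coeff m)).coeff n
    rw [oneE_coeff, oneE_coeff]
    split_ifs <;> simp
  rw [e]
  exact Related.refl _

theorem exchange_of_related {Γ : Subgroup ℂˣ} {S : Set (E W)}
    (h : ∀ a ∈ S, ∀ b ∈ S, Related Γ (opProd a b) (opProdRev a b)) : Exchange Γ S S := by
  intro a ha b hb
  obtain ⟨d, hd, e, -, hde⟩ := h a ha b hb
  exact ⟨d, hd, hde ▸ polySpan_act _ _ e
    (Submodule.subset_span ⟨1, _, ⟨a, ha, b, hb, rfl⟩, by rw [map_one]; rfl⟩)⟩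

theorem related_of_commute {Γ : Subgroup ℂˣ} {c d : ℤ → Free l} {a b : E W}
    (ha : IsGenFun ρ c a) (hb : IsGenFun ρ d b) (h : ∀ m n, Rel A q (c m * d n) (d n * c m)) :
    Related Γ (opProd a b) (opProdRev a b) := by
  have e : opProd a b = opProdRev a b := by
    ext m n : 2
    rw [ha.opProd hb, ha.opProdRev hb, freeAction_rel (h _ _)]
  rw [e]
  exact Related.refl _

theorem exchange_genSet {Γ : Subgroup ℂˣ} {κ r : ℂˣ} (hκ : κ ∈ Γ) (hr : r ∈ Γ) (hq : q = r)
    (hγ : ∀ k, freeAction ρ (fGam l k) = ((κ ^ k : ℂˣ) : ℂ) • 1) :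
    Exchange Γ (genSet ρ) (genSet ρ) := by
  refine exchange_of_related fun a ha b hb => ?_
  rcases ha with rfl | ⟨i, ha⟩
  · exact related_one b
  rcases hb with rfl | ⟨j, hb⟩
  · exact related_swap (related_one a)
  rcases ha with ha | ha | ⟨ε, ha⟩ <;> rcases hb with hb | hb | ⟨ε', hb⟩
  · exact related_of_commute ha hb fun m n => Rel.phi_phi i j m n
  · exact related_phi_psi hκ hr hq hγ ha hb
  · exact related_phi_X hκ hr hq hγ ha hb
  · exact related_swap (related_phi_psi hκ hr hq hγ hb ha)
  · exact related_of_commute ha hb fun m n => Rel.psi_psi i j m n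
  · exact related_psi_X hκ hr hq hγ ha hb
  · exact related_swap (related_phi_X hκ hr hq hγ hb ha)
  · exact related_swap (related_psi_X hκ hr hq hγ hb ha)
  · by_cases h : ε' = ε
    · subst h
      exact related_X_X (zpow_mem hr ((ε' : ℤ) * A i j)) (by rw [hq, Units.val_zpow_eq_zpow_val])
        ha hb
    · rcases Int.units_eq_one_or ε with rfl | rfl <;> rcases Int.units_eq_one_or ε' with rfl | rfl
      · exact absurd rfl h
      · exact related_Xp_Xm hκ hγ ha hb
      · exact related_swap (related_Xp_Xm hκ hγ hb ha)
      · exact absurd rfl h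

theorem exchange_genSet_of_level {L ℓ : ℂ} (hL : Complex.exp L = q) (h : HasLevel ρ L ℓ) :
    Exchange (gammaGroup L ℓ) (genSet ρ) (genSet ρ) := by
  -- The scalar κ = q^{ℓ/4} of γ^{1/2} has exponents (m, n) = (0, 1) in Γ(q, ℓ), and q itself has
  -- (1, 0).
  refine exchange_genSet (κ := Units.mk0 (Complex.exp (ℓ / 4 * L)) (Complex.exp_ne_zero _))
    (r := Units.mk0 (Complex.exp L) (Complex.exp_ne_zero _)) ⟨0, 1, ?_⟩ ⟨1, 0, ?_⟩ hL.symm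
    (freeAction_fGam h.1 fun w => ?_)
  · simp
  · simp
  · rw [h.2 w, Units.val_inv_eq_inv_val, Units.val_mk0, ← Complex.exp_neg]
    congr 2
    ring

end Relations

end NVA

end

theorem proposition4p8 {l : ℕ} (A : Matrix (Fin l) (Fin l) ℤ) (hA : NVA.IsADE l A)
    (q L ℓ : ℂ) (hL : Complex.exp L = q) (hq : q ^ 2 ≠ 1)
    {W : Type*} [AddCommGroup W] [Module ℂ W]
    (ρ : NVA.Uq A q →ₐ[ℂ] Module.End ℂ W)
    (hres : NVA.IsRestricted ρ) (hlevel : NVA.HasLevel ρ L ℓ) :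
    NVA.PseudoLocal (NVA.gammaGroup L ℓ) (NVA.genSet ρ) ∧
    ∃! V : Submodule ℂ (NVA.E W),
      IsLeast (NVA.stableClosedSubspaces (NVA.gammaGroup L ℓ) (NVA.genSet ρ)) V ∧
      ∃ 𝒜 : NVA.NonlocalVertexAlgebra V,
        (𝒜.one : NVA.E W) = NVA.oneE W ∧
        (∀ (a b : V) (n : ℤ),
          NVA.IsNthProduct (a : NVA.E W) (b : NVA.E W) n ((𝒜.Y a b).coeff (-n - 1) : V)) ∧
        𝒜.IsPseudoLocalQuasiModule (NVA.gammaGroup L ℓ) V.subtype ∧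
        Function.Injective V.subtype := by
  have h := NVA.exchange_genSet_of_level hL hlevel
  exact ⟨h.pseudoLocal, h.existsUnique_vertexAlgebra (Or.inl rfl)⟩
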